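/- Let $d\ge 2$ and let $(S_k)_{k\ge 0}$ be a simple random walk on $\mathbb{Z}^d$ started at the origin, with law $P$: $S_0=0$ and the increments $S_{k+1}-S_k$ are independent and uniformly distributed on the $2d$ unit vectors $\{e\in\mathbb{Z}^d:|e|=1\}$. Write $R(n)=\{S_0,\dots,S_n\}$; for $A\subset\mathbb{Z}^d$ let $\partial A$ be the inner boundary of $A$, i.e. the set of $x\in A$ such that some $z\in\mathbb{Z}^d$ with $|x-z|=1$ is not in $A$. Let $K(n,x)=\sum_{j=0}^{n}1_{\{S_j=x\}}$ and $$M(n)=\max_{x\in\partial R(n)}K(n,x).$$ For $x\in\mathbb{Z}^d$ let $T_x=\inf\{m\ge 1:S_m=x\}$, with $\inf\emptyset=\infty$. Then the probability $P(T_0<T_b)$ lies in $(0,1)$ and is the same for every neighbour $b$ of the origin, i.e. for every $b\in\mathbb{Z}^d$ with $|b|=1$; it depends only on $d$. Moreover $$\lim_{n\to\infty}\frac{M(n)}{\log n}=\beta_d\quad\text{almost surely},\qquad\text{where}\quad \beta_d=\frac{1}{-\log P(T_0<T_b)}.$$ -/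

import Mathlib

open MeasureTheory ProbabilityTheory Filter Topology
open scoped ENNReal

noncomputable section

namespace SimpleWalk

/-- The set of neighbours of `a` in `ℤ^d`: the lattice points at Euclidean distance one
(written with the square of the distance). -/
def neighbors {d : ℕ} (a : Fin d → ℤ) : Set (Fin d → ℤ) :=
  {z | ∑ i, (a i - z i) ^ 2 = 1}

/-- `S` is a simple random walk on `ℤ^d` started at `a`, under the measure `P`: its increments are
independent, and each of them is uniformly distributed on the `2 d` neighbours of the origin. -/
structure IsSimpleRandomWalk {d : ℕ} {Ω : Type*} [MeasurableSpace Ω] (P : Measure Ω)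
    (a : Fin d → ℤ) (S : ℕ → Ω → (Fin d → ℤ)) : Prop where
  measurable : ∀ n, Measurable (S n)
  start : ∀ᵐ ω ∂P, S 0 ω = a
  indep : iIndepFun (fun (n : ℕ) (ω : Ω) => S (n + 1) ω - S n ω) P
  law : ∀ n, ∀ e ∈ neighbors (0 : Fin d → ℤ),
    P {ω | S (n + 1) ω - S n ω = e} = (2 * (d : ℝ≥0∞))⁻¹

/-- The range `{s 0, …, s n}` of a path up to time `n`. -/
def pathRange {d : ℕ} (s : ℕ → (Fin d → ℤ)) (n : ℕ) : Finset (Fin d → ℤ) :=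
  (Finset.range (n + 1)).image s

open Classical in
/-- The inner boundary of a finite set `A`: the points of `A` having a neighbour outside `A`. -/
def innerBoundary {d : ℕ} (A : Finset (Fin d → ℤ)) : Finset (Fin d → ℤ) :=
  A.filter (fun x => ¬ neighbors x ⊆ (A : Set (Fin d → ℤ)))

/-- The number of visits of a path to `x` during the times `0, …, n`. -/
def visits {d : ℕ} (s : ℕ → (Fin d → ℤ)) (n : ℕ) (x : Fin d → ℤ) : ℕ :=
  ((Finset.range (n + 1)).filter (fun j => s j = x)).card

/-- The maximal number of visits up to time `n` to a point of the inner boundary of the range up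
to time `n`. For `d ≥ 1` this boundary is nonempty, so the supremum is a maximum. -/
def maxBoundaryVisits {d : ℕ} (s : ℕ → (Fin d → ℤ)) (n : ℕ) : ℕ :=
  (innerBoundary (pathRange s n)).sup (visits s n)

/-- The first passage time `inf {m ≥ 1 : s m = x}`, which is `⊤` if there is no such `m`. -/
def hittingTime {d : ℕ} (s : ℕ → (Fin d → ℤ)) (x : Fin d → ℤ) : ℕ∞ :=
  ⨅ (m : ℕ) (_ : 1 ≤ m ∧ s m = x), (m : ℕ∞)

end SimpleWalk

end

/-!
The walk is realised on the canonical space `Noise d` of sequences of steps, where the Markov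
property at a stopping time says that gluing two independent sequences preserves the law
(`measurePreserving_glue_stop`). Write `q = P(T₀ < T_b)`; it does not depend on `b` since the signed
permutations of the coordinates act transitively on the unit vectors (`measure_returns_eq`).

*Upper bound* (`ae_maxBoundaryVisits_le`). Let `x` be a point of the inner boundary of the range at
time `n`, first visited at time `j`, and let `b` be an unvisited neighbour of `x`. Each visit to `x`
after time `j` is a return that precedes the first visit of `b`, so that `k + 1` visits have
probability at most `q ^ k`, given `j` and the direction of `b`. With `k = ⌈r log j⌉` and
`r > β_d = 1 / (-log q)` these probabilities are summable in `j`, and Borel–Cantelli applies.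

*Lower bound* (`ae_le_maxBoundaryVisits`). For `r < β_d` a point with `r log n` visits and a
neighbour that stays unvisited has to be found, for every large `n` at once. At scale `l` the walk
runs for a time `n_l = 2 ^ (d l² + 11 l)`.
* Each time the walk has an unvisited neighbour `e`, it makes `k = r log n_l` quick returns to its
  current position before `e` with probability about `q ^ k`, and then avoids `e` until the end of
  a block of time (`exists_avoid_ge`: the latter costs a factor `1 / log` at most, since the Green
  function is at most logarithmic). As `q ^ k` is much larger than `1 / n_l`, the second moment
  method yields such a point in a block with a probability controlled by the number of sites
  discovered in the block (`block_success`). The range is large, because the expected number of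
  self-intersections is small (`measure_range_small_le`), so that one of many blocks succeeds
  (`measure_noSuccess_le`).
* In dimension two the unvisited neighbour is visited eventually. From a distance `2 ^ l²`, the
  probability to hit it before the end of the next scale is of order `1 / l` (`exists_hits_le`),
  which is not summable. The search is therefore made twice, for two neighbours far apart: both are
  hit with probability of order `1 / l²` (`measure_bothHit_le`), and Borel–Cantelli applies along
  the scales (`ae_eventually_mem_lasting`).
* The candidate found at scale `l` serves all the times between `n_l` and `n_{l+1}`, and
  `log n_{l+1} / log n_l` tends to one: this is why the scales grow like `2 ^ (d l²)`.

The bounds on hitting and return probabilities come from a bound on the heat kernel, obtained by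
Fourier inversion (`exists_heat_le`), and its consequence far from the origin
(`exists_heat_far_le`).
-/

noncomputable section

namespace SimpleWalk

variable {d : ℕ}

/-! ### The canonical space of the walk -/

/-- The `2 d` steps of the walk: a coordinate direction together with a sign. -/
abbrev Step (d : ℕ) := Fin d × Bool

/-- A sequence of steps, that is, a point of the canonical probability space. -/
abbrev Noise (d : ℕ) := ℕ → Step d

/-- The unit vector of `ℤ^d` encoded by a step. -/
def stepVec (e : Step d) : Fin d → ℤ := Pi.single e.1 (if e.2 then 1 else -1)

/-- The walk started at the origin driven by a sequence of steps. -/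
def walk (ω : Noise d) (n : ℕ) : Fin d → ℤ := ∑ i ∈ Finset.range n, stepVec (ω i)

/-- The uniform law on the steps. -/
def stepLaw (d : ℕ) : Measure (Step d) := uniformOn Set.univ

instance [NeZero d] : IsProbabilityMeasure (stepLaw d) :=
  isProbabilityMeasure_uniformOn Set.finite_univ Set.univ_nonempty

/-- The law of an independent sequence of uniform steps. -/
def noiseLaw (d : ℕ) [NeZero d] : Measure (Noise d) := Measure.infinitePi fun _ => stepLaw d

instance [NeZero d] : IsProbabilityMeasure (noiseLaw d) := by
  unfold noiseLaw; infer_instance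

/-- The sequence of steps from time `n` on. -/
def shift (n : ℕ) (ω : Noise d) : Noise d := fun i => ω (n + i)

/-- The sequence which follows `ω` before time `n`, and then starts `ω'` afresh. -/
def glue (n : ℕ) (ω ω' : Noise d) : Noise d := fun i => if i < n then ω i else ω' (i - n)

lemma measurable_shift (n : ℕ) : Measurable (shift n : Noise d → Noise d) :=
  measurable_pi_lambda _ fun i => measurable_pi_apply (n + i)

lemma measurable_glue (n : ℕ) : Measurable fun p : Noise d × Noise d => glue n p.1 p.2 := by
  refine measurable_pi_lambda _ fun i => ?_
  unfold glue
  split_ifs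
  · exact (measurable_pi_apply i).comp measurable_fst
  · exact (measurable_pi_apply (i - n)).comp measurable_snd

@[simp] lemma shift_glue (n : ℕ) (ω ω' : Noise d) : shift n (glue n ω ω') = ω' := by
  funext i; simp [shift, glue]

lemma glue_apply_of_lt {n i : ℕ} (h : i < n) (ω ω' : Noise d) : glue n ω ω' i = ω i := by
  simp [glue, h]

lemma shift_shift (m n : ℕ) (ω : Noise d) : shift n (shift m ω) = shift (m + n) ω := by
  funext i; simp [shift, add_assoc]

@[simp] lemma shift_zero (ω : Noise d) : shift 0 ω = ω := by
  funext i; simp [shift]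

@[simp] lemma walk_zero (ω : Noise d) : walk ω 0 = 0 := by simp [walk]

lemma walk_succ (ω : Noise d) (n : ℕ) : walk ω (n + 1) = walk ω n + stepVec (ω n) := by
  simp [walk, Finset.sum_range_succ]

lemma walk_congr {ω ω' : Noise d} {n : ℕ} (h : ∀ i < n, ω' i = ω i) : walk ω' n = walk ω n :=
  Finset.sum_congr rfl fun i hi => by rw [h i (Finset.mem_range.1 hi)]

lemma walk_add (ω : Noise d) (m n : ℕ) : walk ω (m + n) = walk ω m + walk (shift m ω) n := by
  simp [walk, Finset.sum_range_add, shift]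

lemma walk_glue_of_le {n i : ℕ} (h : i ≤ n) (ω ω' : Noise d) :
    walk (glue n ω ω') i = walk ω i :=
  walk_congr fun _ hj => glue_apply_of_lt (hj.trans_le h) _ _

lemma walk_glue_add (n i : ℕ) (ω ω' : Noise d) :
    walk (glue n ω ω') (n + i) = walk ω n + walk ω' i := by
  rw [walk_add, walk_glue_of_le le_rfl, shift_glue]

/-- The event `A` only depends on the steps before time `n`. -/
def DetBy (n : ℕ) (A : Set (Noise d)) : Prop :=
  ∀ ω ω' : Noise d, (∀ i < n, ω' i = ω i) → ω ∈ A → ω' ∈ A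

lemma DetBy.mem_iff {n : ℕ} {A : Set (Noise d)} (hA : DetBy n A) {ω ω' : Noise d}
    (h : ∀ i < n, ω' i = ω i) : ω' ∈ A ↔ ω ∈ A :=
  ⟨hA _ _ fun i hi => (h i hi).symm, hA _ _ h⟩

lemma DetBy.glue_mem_iff {n : ℕ} {A : Set (Noise d)} (hA : DetBy n A) (ω ω' : Noise d) :
    glue n ω ω' ∈ A ↔ ω ∈ A :=
  hA.mem_iff fun _ hi => glue_apply_of_lt hi _ _

lemma DetBy.mono {m n : ℕ} {A : Set (Noise d)} (hA : DetBy m A) (h : m ≤ n) : DetBy n A :=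
  fun ω ω' hω => hA ω ω' fun i hi => hω i (hi.trans_le h)

lemma DetBy.measurableSet {n : ℕ} {A : Set (Noise d)} (hA : DetBy n A) : MeasurableSet A := by
  let r : Noise d → (Fin n → Step d) := fun ω i => ω i
  have hr : Measurable r := measurable_pi_lambda _ fun i => measurable_pi_apply (i : ℕ)
  have h : A = r ⁻¹' (r '' A) := by
    refine Set.Subset.antisymm (Set.subset_preimage_image _ _) ?_
    rintro ω ⟨ω', h', he⟩
    refine hA ω' ω (fun i hi => ?_) h'
    exact (congrFun he ⟨i, hi⟩).symm
  rw [h]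
  exact hr (Set.toFinite _).measurableSet

lemma measurable_of_detBy {β : Type*} [MeasurableSpace β] {n : ℕ} {f : Noise d → β}
    (hf : ∀ ω ω' : Noise d, (∀ i < n, ω' i = ω i) → f ω' = f ω) : Measurable f := fun s _ =>
  DetBy.measurableSet (n := n) fun ω ω' h hω => by
    rw [Set.mem_preimage, hf ω ω' h]; exact hω

lemma measurable_walk (n : ℕ) : Measurable fun ω : Noise d => walk ω n :=
  measurable_of_detBy (n := n) fun _ _ h => walk_congr h

/-- A stopping time: its value is determined by the steps made before it. -/
def IsStop (τ : Noise d → ℕ) : Prop :=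
  ∀ ω ω' : Noise d, (∀ i < τ ω, ω' i = ω i) → τ ω' = τ ω

lemma IsStop.detBy_eq {τ : Noise d → ℕ} (hτ : IsStop τ) (n : ℕ) : DetBy n {ω | τ ω = n} := by
  intro ω ω' h hω
  have h' : τ ω = n := hω
  change τ ω' = n
  rw [hτ ω ω' (by rwa [h']), h']

lemma IsStop.measurable {τ : Noise d → ℕ} (hτ : IsStop τ) : Measurable τ :=
  measurable_to_countable' fun n => (hτ.detBy_eq n).measurableSet

lemma isStop_const (n : ℕ) : IsStop fun _ : Noise d => n := fun _ _ _ => rfl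

lemma IsStop.glue_eq {τ : Noise d → ℕ} (hτ : IsStop τ) (ω ω' : Noise d) :
    τ (glue (τ ω) ω ω') = τ ω :=
  hτ ω _ fun _ hi => glue_apply_of_lt hi _ _

section Markov

variable [NeZero d]

/-- The Markov property at a fixed time. -/
lemma measurePreserving_glue (n : ℕ) :
    MeasurePreserving (fun p : Noise d × Noise d => glue n p.1 p.2)
      ((noiseLaw d).prod (noiseLaw d)) (noiseLaw d) := by
  refine ⟨measurable_glue n, ?_⟩
  refine Measure.eq_infinitePi _ fun s t ht => ?_
  rw [Measure.map_apply (measurable_glue n) (.pi s.countable_toSet fun _ _ => ht _)]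
  have h : (fun p : Noise d × Noise d => glue n p.1 p.2) ⁻¹' ((s : Set ℕ).pi t) =
      (Set.pi (s.filter (· < n) : Finset ℕ) t) ×ˢ
      (Set.pi ((s.filter (¬ · < n)).image (· - n) : Finset ℕ) fun i => t (n + i)) := by
    ext ⟨ω, ω'⟩
    simp only [Set.mem_preimage, Set.mem_pi, Finset.mem_coe, Set.mem_prod, Finset.mem_filter,
      Finset.mem_image, glue]
    constructor
    · intro h
      refine ⟨fun i hi => by simpa [hi.2] using h i hi.1, ?_⟩
      rintro i ⟨j, ⟨hj, hjn⟩, rfl⟩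
      have := h j hj
      rw [if_neg hjn] at this
      rwa [show n + (j - n) = j by omega]
    · rintro ⟨h1, h2⟩ i hi
      split_ifs with hin
      · exact h1 i ⟨hi, hin⟩
      · have := h2 (i - n) ⟨i, ⟨hi, hin⟩, rfl⟩
        rwa [show n + (i - n) = i by omega] at this
  rw [h, Measure.prod_prod, noiseLaw, Measure.infinitePi_pi _ (fun i _ => ht i),
    Measure.infinitePi_pi _ (fun i _ => ht _), Finset.prod_image,
    ← Finset.prod_filter_mul_prod_filter_not s (· < n)]
  · congr 1
    refine Finset.prod_congr rfl fun i hi => ?_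
    have := (Finset.mem_filter.1 hi).2
    rw [show n + (i - n) = i by omega]
  · intro i hi j hj hij
    have h1 := (Finset.mem_filter.1 (Finset.mem_coe.1 hi)).2
    have h2 := (Finset.mem_filter.1 (Finset.mem_coe.1 hj)).2
    simp only at hij
    omega

lemma measurePreserving_shift (n : ℕ) :
    MeasurePreserving (shift n) (noiseLaw d) (noiseLaw d) := by
  refine ⟨measurable_shift n, ?_⟩
  have h := (measurePreserving_glue (d := d) n).map_eq
  conv_lhs => rw [← h]
  rw [Measure.map_map (measurable_shift n) (measurable_glue n)]
  have : (shift n ∘ fun p : Noise d × Noise d => glue n p.1 p.2) = Prod.snd := by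
    funext p; simp
  rw [this]
  exact measurePreserving_snd.map_eq

omit [NeZero d] in
lemma measurable_glue_stop {τ : Noise d → ℕ} (hτ : IsStop τ) :
    Measurable fun p : Noise d × Noise d => glue (τ p.1) p.1 p.2 := by
  have h : Measurable fun q : ℕ × (Noise d × Noise d) => glue q.1 q.2.1 q.2.2 :=
    measurable_from_prod_countable_right fun n => measurable_glue n
  exact h.comp ((hτ.measurable.comp measurable_fst).prodMk measurable_id)

/-- The strong Markov property. -/
lemma measurePreserving_glue_stop {τ : Noise d → ℕ} (hτ : IsStop τ) :
    MeasurePreserving (fun p : Noise d × Noise d => glue (τ p.1) p.1 p.2)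
      ((noiseLaw d).prod (noiseLaw d)) (noiseLaw d) := by
  refine ⟨measurable_glue_stop hτ, ?_⟩
  ext E hE
  rw [Measure.map_apply (measurable_glue_stop hτ) hE]
  have hm : ∀ n, MeasurableSet (τ ⁻¹' {n}) := fun n => (hτ.detBy_eq n).measurableSet
  have h1 : ∀ n, ((noiseLaw d).prod (noiseLaw d))
      ((fun p : Noise d × Noise d => glue (τ p.1) p.1 p.2) ⁻¹' E ∩
        (fun p : Noise d × Noise d => τ p.1) ⁻¹' {n}) =
      noiseLaw d (E ∩ τ ⁻¹' {n}) := by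
    intro n
    rw [← (measurePreserving_glue (d := d) n).measure_preimage
      (hE.inter (hm n)).nullMeasurableSet]
    congr 1
    ext ⟨ω, ω'⟩
    have h2 : τ (glue n ω ω') = n ↔ τ ω = n := (hτ.detBy_eq n).glue_mem_iff ω ω'
    simp only [Set.mem_inter_iff, Set.mem_preimage, Set.mem_singleton_iff, h2]
    constructor
    · rintro ⟨h3, rfl⟩; exact ⟨h3, rfl⟩
    · rintro ⟨h3, rfl⟩; exact ⟨h3, rfl⟩
  have e1 := tsum_measure_preimage_singleton (μ := (noiseLaw d).restrict E) (f := τ)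
    (s := Set.univ) Set.countable_univ (fun n _ => hm n)
  have e2 := tsum_measure_preimage_singleton
    (μ := ((noiseLaw d).prod (noiseLaw d)).restrict
      ((fun p : Noise d × Noise d => glue (τ p.1) p.1 p.2) ⁻¹' E))
    (f := fun p : Noise d × Noise d => τ p.1) (s := Set.univ) Set.countable_univ
    (fun n _ => measurable_fst (hm n))
  simp only [Set.preimage_univ, Measure.restrict_apply_univ] at e1 e2
  rw [← e1, ← e2]
  refine tsum_congr fun n => ?_
  have h3 : MeasurableSet ((fun p : Noise d × Noise d => τ p.1) ⁻¹' {(n : ℕ)}) :=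
    measurable_fst (hm n)
  rw [Measure.restrict_apply h3, Measure.restrict_apply (hm n), Set.inter_comm, h1,
    Set.inter_comm]

lemma lintegral_glue {τ : Noise d → ℕ} (hτ : IsStop τ) {E : Set (Noise d)}
    (hE : MeasurableSet E) :
    noiseLaw d E = ∫⁻ ω, noiseLaw d {ω' | glue (τ ω) ω ω' ∈ E} ∂(noiseLaw d) := by
  rw [← (measurePreserving_glue_stop hτ).measure_preimage hE.nullMeasurableSet,
    Measure.prod_apply (measurable_glue_stop hτ hE)]
  rfl

lemma integral_glue {τ : Noise d → ℕ} (hτ : IsStop τ) {f : Noise d → ℝ}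
    (hf : Integrable f (noiseLaw d)) :
    ∫ ω, f ω ∂(noiseLaw d) = ∫ ω, ∫ ω', f (glue (τ ω) ω ω') ∂(noiseLaw d) ∂(noiseLaw d) := by
  have h := measurePreserving_glue_stop hτ
  conv_lhs => rw [← h.map_eq]
  rw [integral_map h.measurable.aemeasurable (by rw [h.map_eq]; exact hf.aestronglyMeasurable)]
  exact integral_prod _ ((h.integrable_comp hf.aestronglyMeasurable).2 hf)

/-- If `f` has a smaller conditional expectation than `g` given the past of a stopping time, it
has a smaller expectation. -/
lemma integral_le_of_glue {τ : Noise d → ℕ} (hτ : IsStop τ) {f g : Noise d → ℝ}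
    (hf : Integrable f (noiseLaw d)) (hg : Integrable g (noiseLaw d))
    (h : ∀ ω, ∫ ω', f (glue (τ ω) ω ω') ∂(noiseLaw d) ≤
      ∫ ω', g (glue (τ ω) ω ω') ∂(noiseLaw d)) :
    ∫ ω, f ω ∂(noiseLaw d) ≤ ∫ ω, g ω ∂(noiseLaw d) := by
  rw [integral_glue hτ hf, integral_glue hτ hg]
  have hp := measurePreserving_glue_stop hτ
  exact integral_mono
    ((hp.integrable_comp hf.aestronglyMeasurable).2 hf).integral_prod_left
    ((hp.integrable_comp hg.aestronglyMeasurable).2 hg).integral_prod_left h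

/-- If an event inside `A` has conditional probability at most `c` given the past of a stopping
time, its probability is at most `c` times that of `A`, where `A` belongs to the past. -/
lemma measure_le_mul_of_glue {τ : Noise d → ℕ} (hτ : IsStop τ) {A E : Set (Noise d)}
    (hA : MeasurableSet A) (hE : MeasurableSet E) {c : ℝ} (hc : 0 ≤ c)
    (h0 : ∀ ω ω', ω ∉ A → glue (τ ω) ω ω' ∉ E)
    (h : ∀ ω ∈ A, (noiseLaw d).real {ω' | glue (τ ω) ω ω' ∈ E} ≤ c) :
    (noiseLaw d).real E ≤ c * (noiseLaw d).real A := by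
  have h1 : noiseLaw d E ≤ ENNReal.ofReal c * noiseLaw d A := by
    rw [lintegral_glue hτ hE, ← lintegral_indicator_const hA]
    refine lintegral_mono fun ω => ?_
    by_cases hω : ω ∈ A
    · rw [Set.indicator_of_mem hω]
      exact ENNReal.le_ofReal_iff_toReal_le (measure_ne_top _ _) hc |>.2 (h ω hω)
    · have : {ω' | glue (τ ω) ω ω' ∈ E} = ∅ := by
        ext ω'; simpa using h0 ω ω' hω
      rw [this]; simp
  have := ENNReal.toReal_mono (by finiteness) h1
  rwa [ENNReal.toReal_mul, ENNReal.toReal_ofReal hc] at this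

lemma measure_inter_shift {n : ℕ} {A G : Set (Noise d)} (hA : DetBy n A)
    (hG : MeasurableSet G) :
    noiseLaw d (A ∩ shift n ⁻¹' G) = noiseLaw d A * noiseLaw d G := by
  rw [← (measurePreserving_glue (d := d) n).measure_preimage
    (hA.measurableSet.inter (measurable_shift n hG)).nullMeasurableSet, ← Measure.prod_prod]
  congr 1
  ext ⟨ω, ω'⟩
  simp [hA.glue_mem_iff]

lemma measureReal_inter_shift {n : ℕ} {A G : Set (Noise d)} (hA : DetBy n A)
    (hG : MeasurableSet G) :
    (noiseLaw d).real (A ∩ shift n ⁻¹' G) = (noiseLaw d).real A * (noiseLaw d).real G := by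
  simp [measureReal_def, measure_inter_shift hA hG]

lemma measureReal_shift {n : ℕ} {G : Set (Noise d)} (hG : MeasurableSet G) :
    (noiseLaw d).real (shift n ⁻¹' G) = (noiseLaw d).real G := by
  simp [measureReal_def, (measurePreserving_shift n).measure_preimage hG.nullMeasurableSet]

end Markov

/-! ### Steps and symmetries -/

lemma stepVec_apply (e : Step d) (i : Fin d) :
    stepVec e i = if i = e.1 then (if e.2 then 1 else -1) else 0 := by
  simp [stepVec, Pi.single_apply]

lemma mem_neighbors_iff (a z : Fin d → ℤ) : z ∈ neighbors a ↔ ∃ e, z = a + stepVec e := by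
  constructor
  · intro h
    have h : ∑ i, (a i - z i) ^ 2 = 1 := h
    obtain ⟨i, hi⟩ : ∃ i, a i - z i ≠ 0 := by
      by_contra! hc
      simp [hc] at h
    have hsplit : (a i - z i) ^ 2 + ∑ j ∈ Finset.univ.erase i, (a j - z j) ^ 2 =
        ∑ j, (a j - z j) ^ 2 :=
      Finset.add_sum_erase Finset.univ (fun i => (a i - z i) ^ 2) (Finset.mem_univ i)
    have hrest : 0 ≤ ∑ j ∈ Finset.univ.erase i, (a j - z j) ^ 2 :=
      Finset.sum_nonneg fun j _ => sq_nonneg _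
    have hpos : 0 < (a i - z i) ^ 2 := by positivity
    have hone : (a i - z i) ^ 2 = 1 := by omega
    have hzero : ∑ j ∈ Finset.univ.erase i, (a j - z j) ^ 2 = 0 := by omega
    have hz : ∀ j, j ≠ i → a j = z j := by
      intro j hj
      have := (Finset.sum_eq_zero_iff_of_nonneg fun j _ => sq_nonneg _).1 hzero j (by simp [hj])
      have := pow_eq_zero_iff (two_ne_zero) |>.1 this
      omega
    rcases (by simpa using hone : a i - z i = 1 ∨ a i - z i = -1) with h1 | h1
    · refine ⟨(i, false), ?_⟩
      funext j
      by_cases hj : j = i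
      · subst hj; simp [stepVec_apply]; omega
      · simp [stepVec_apply, hj, hz j hj]
    · refine ⟨(i, true), ?_⟩
      funext j
      by_cases hj : j = i
      · subst hj; simp [stepVec_apply]; omega
      · simp [stepVec_apply, hj, hz j hj]
  · rintro ⟨e, rfl⟩
    change ∑ i, (a i - (a + stepVec e) i) ^ 2 = 1
    have h : ∀ i, (a i - (a + stepVec e) i) ^ 2 = if i = e.1 then 1 else 0 := by
      intro i
      simp only [Pi.add_apply, stepVec_apply]
      split_ifs <;> ring
    rw [Finset.sum_congr rfl fun i _ => h i]
    simp

lemma neighbors_zero : neighbors (0 : Fin d → ℤ) = Set.range stepVec := by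
  ext z
  simp [mem_neighbors_iff, eq_comm]

lemma stepVec_injective : Function.Injective (stepVec (d := d)) := by
  rintro ⟨i, s⟩ ⟨j, t⟩ h
  have h1 := congrFun h i
  simp only [stepVec_apply, if_true] at h1
  by_cases hij : i = j
  · subst hij
    cases s <;> cases t <;> simp_all
  · cases s <;> simp [hij] at h1

lemma stepVec_ne_zero (e : Step d) : stepVec e ≠ 0 := by
  intro h
  have := congrFun h e.1
  simp only [stepVec_apply, if_true, Pi.zero_apply] at this
  (split_ifs at this; all_goals omega)

lemma measure_stepLaw_singleton (e : Step d) : stepLaw d {e} = (2 * (d : ℝ≥0∞))⁻¹ := by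
  rw [stepLaw, uniformOn_univ]
  simp [mul_comm]

/-- Any two steps are exchanged by a permutation of the steps which comes from a lattice
automorphism: a swap of coordinates, followed by a global change of sign if need be. -/
lemma exists_symmetry (e e' : Step d) :
    ∃ (g : Equiv.Perm (Step d)) (A : (Fin d → ℤ) →+ (Fin d → ℤ)), Function.Injective A ∧
      (∀ s, stepVec (g s) = A (stepVec s)) ∧ g e = e' := by
  let b : Bool := xor e.2 e'.2
  let σ : Equiv.Perm (Fin d) := Equiv.swap e.1 e'.1
  let c : ℤ := if b then -1 else 1
  refine ⟨Equiv.prodCongr σ ⟨fun x => xor b x, fun x => xor b x, by intro x; simp,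
    by intro x; simp⟩, ⟨⟨fun z i => c * z (σ i), by funext i; simp⟩,
    fun x y => by funext i; simp [mul_add]⟩, ?_, ?_, ?_⟩
  · intro x y hxy
    funext i
    have h := congrFun hxy (σ i)
    have h' : c * x (σ (σ i)) = c * y (σ (σ i)) := h
    have hc : c ≠ 0 := by simp only [c]; split_ifs <;> norm_num
    simpa [σ] using mul_left_cancel₀ hc h'
  · rintro ⟨i, s⟩
    funext j
    change stepVec (σ i, xor b s) j = c * stepVec (i, s) (σ j)
    have hij : j = σ i ↔ σ j = i := by
      constructor
      · rintro rfl; simp [σ]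
      · rintro rfl; simp [σ]
    simp only [stepVec_apply, hij, c]
    cases b <;> cases s <;> simp
  · refine Prod.ext ?_ ?_
    · simp [σ]
    · change xor (xor e.2 e'.2) e.2 = e'.2
      cases e.2 <;> cases e'.2 <;> rfl

section

variable [NeZero d]

lemma measurePreserving_map_step (g : Equiv.Perm (Step d)) :
    MeasurePreserving (fun (ω : Noise d) i => g (ω i)) (noiseLaw d) (noiseLaw d) := by
  refine ⟨measurable_pi_lambda _ fun i => (measurable_of_countable g).comp
    (measurable_pi_apply i), ?_⟩
  have h : (stepLaw d).map g = stepLaw d := by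
    refine Measure.ext_of_singleton fun e => ?_
    rw [Measure.map_apply (measurable_of_countable g) (measurableSet_singleton e),
      measure_stepLaw_singleton]
    have : g ⁻¹' {e} = {g.symm e} := by
      ext x; simp [Equiv.eq_symm_apply]
    rw [this, measure_stepLaw_singleton]
  have h2 := Measure.infinitePi_map_pi (fun _ : ℕ => stepLaw d) (f := fun _ => g)
    (fun _ => measurable_of_countable g)
  rw [noiseLaw]
  refine h2.trans ?_
  congr 1
  funext i
  exact h

omit [NeZero d] in
lemma walk_map_step {g : Equiv.Perm (Step d)} {A : (Fin d → ℤ) →+ (Fin d → ℤ)}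
    (h : ∀ s, stepVec (g s) = A (stepVec s)) (ω : Noise d) (n : ℕ) :
    walk (fun i => g (ω i)) n = A (walk ω n) := by
  simp [walk, h]

lemma integral_step (f : Step d → ℝ) :
    ∫ ω, f (ω 0) ∂(noiseLaw d) = (2 * d : ℝ)⁻¹ * ∑ e, f e := by
  have h := measurePreserving_eval_infinitePi (fun _ : ℕ => stepLaw d) 0
  have h1 : ∫ ω, f (ω 0) ∂(noiseLaw d) = ∫ e, f e ∂(stepLaw d) := by
    have hm := h.map_eq
    conv_rhs => rw [← hm]
    rw [integral_map h.measurable.aemeasurable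
      (measurable_of_countable f).aestronglyMeasurable]
    rfl
  rw [h1, integral_fintype Integrable.of_finite, Finset.mul_sum]
  refine Finset.sum_congr rfl fun e _ => ?_
  simp [measureReal_def, measure_stepLaw_singleton]

lemma integrable_of_detBy {n : ℕ} {f : Noise d → ℝ}
    (hf : ∀ ω ω' : Noise d, (∀ i < n, ω' i = ω i) → f ω' = f ω) : Integrable f (noiseLaw d) := by
  let ext : (Fin n → Step d) → Noise d := fun v i => if h : i < n then v ⟨i, h⟩ else (0, true)
  refine Integrable.of_bound (measurable_of_detBy hf).aestronglyMeasurable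
    (∑ v, |f (ext v)|) (ae_of_all _ fun ω => ?_)
  have h : f ω = f (ext fun i => ω i) := by
    refine hf _ _ fun i hi => ?_
    simp [ext, hi]
  rw [h, Real.norm_eq_abs]
  exact Finset.single_le_sum (f := fun v => |f (ext v)|) (fun _ _ => abs_nonneg _)
    (Finset.mem_univ fun i : Fin n => ω i)

lemma integral_walk_succ (f : (Fin d → ℤ) → ℝ) (t : ℕ) :
    ∫ ω, f (walk ω (t + 1)) ∂(noiseLaw d) =
      ∫ ω, (2 * d : ℝ)⁻¹ * ∑ e, f (walk ω t + stepVec e) ∂(noiseLaw d) := by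
  rw [integral_glue (isStop_const t) (integrable_of_detBy (n := t + 1) fun ω ω' h => by
    rw [walk_congr h])]
  refine integral_congr_ae (ae_of_all _ fun ω => ?_)
  have h : ∀ ω' : Noise d, walk (glue t ω ω') (t + 1) = walk ω t + stepVec (ω' 0) := by
    intro ω'
    rw [walk_glue_add, walk_succ ω' 0, walk_zero, zero_add]
  simp only [h]
  exact integral_step fun e => f (walk ω t + stepVec e)

/-- The heat kernel of the walk: the probability of being at `x` at time `t`. -/
def heat (d : ℕ) [NeZero d] (t : ℕ) (x : Fin d → ℤ) : ℝ := (noiseLaw d).real {ω | walk ω t = x}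

lemma heat_nonneg (t : ℕ) (x : Fin d → ℤ) : 0 ≤ heat d t x := measureReal_nonneg

lemma heat_le_one (t : ℕ) (x : Fin d → ℤ) : heat d t x ≤ 1 := measureReal_le_one

@[simp] lemma heat_zero_zero : heat d 0 0 = 1 := by simp [heat]

omit [NeZero d] in
lemma detBy_walk {t n : ℕ} (h : t ≤ n) (s : Set (Fin d → ℤ)) : DetBy n {ω | walk ω t ∈ s} := by
  intro ω ω' hω h1
  have : walk ω' t = walk ω t := walk_congr fun i hi => hω i (hi.trans_le h)
  change walk ω' t ∈ s
  rwa [this]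

omit [NeZero d] in
lemma detBy_walk_eq {t n : ℕ} (h : t ≤ n) (x : Fin d → ℤ) : DetBy n {ω | walk ω t = x} :=
  detBy_walk h {x}

omit [NeZero d] in
lemma measurableSet_walk_eq (t : ℕ) (x : Fin d → ℤ) :
    MeasurableSet {ω : Noise d | walk ω t = x} :=
  (detBy_walk_eq le_rfl x).measurableSet

lemma heat_neg (t : ℕ) (x : Fin d → ℤ) : heat d t (-x) = heat d t x := by
  let g : Equiv.Perm (Step d) := Equiv.prodCongr (Equiv.refl _) Equiv.boolNot
  have hg : ∀ s, stepVec (g s) = (-AddMonoidHom.id (Fin d → ℤ)) (stepVec s) := by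
    rintro ⟨i, s⟩
    funext j
    simp only [g, stepVec_apply, Equiv.prodCongr_apply, Prod.map, Equiv.refl_apply,
      Equiv.boolNot_apply, AddMonoidHom.neg_apply, AddMonoidHom.id_apply, Pi.neg_apply]
    cases s <;> by_cases hj : j = i <;> simp [hj]
  rw [heat, heat, measureReal_def, measureReal_def,
    ← (measurePreserving_map_step g).measure_preimage
      (measurableSet_walk_eq t (-x)).nullMeasurableSet]
  congr 2
  ext ω
  simp [walk_map_step hg, neg_eq_iff_eq_neg]

lemma integral_sum_sq_walk (t : ℕ) :
    ∫ ω, ∑ i, (walk ω t i : ℝ) ^ 2 ∂(noiseLaw d) = t := by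
  induction t with
  | zero => simp
  | succ t ih =>
    rw [integral_walk_succ (fun x => ∑ i, (x i : ℝ) ^ 2)]
    have hd : (d : ℝ) ≠ 0 := Nat.cast_ne_zero.2 (NeZero.ne d)
    have h : ∀ ω : Noise d, (2 * d : ℝ)⁻¹ * ∑ e : Step d,
        ∑ i, (((walk ω t + stepVec e) i : ℤ) : ℝ) ^ 2 =
        ∑ i, (walk ω t i : ℝ) ^ 2 + 1 := by
      intro ω
      have h1 : ∀ (e : Step d), ∑ i, (((walk ω t + stepVec e) i : ℤ) : ℝ) ^ 2 =
          ∑ i, (walk ω t i : ℝ) ^ 2 + 1 + 2 * (if e.2 then 1 else -1) * walk ω t e.1 := by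
        intro e
        have h2 : ∀ i, (((walk ω t + stepVec e) i : ℤ) : ℝ) ^ 2 = (walk ω t i : ℝ) ^ 2 +
            if i = e.1 then (1 + 2 * (if e.2 then 1 else -1) * (walk ω t i : ℝ)) else 0 := by
          intro i
          simp only [Pi.add_apply, stepVec_apply]
          split_ifs <;> push_cast <;> ring
        simp only [h2, Finset.sum_add_distrib, Finset.sum_ite_eq', Finset.mem_univ, if_true]
        ring
      simp only [h1, Fintype.sum_prod_type, Fintype.sum_bool]
      simp only [Finset.sum_add_distrib, Finset.sum_const, Finset.card_univ, Fintype.card_fin,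
        nsmul_eq_mul]
      simp
      field_simp
      ring
    simp only [h]
    rw [integral_add (integrable_of_detBy (n := t) fun ω ω' h => by simp only [walk_congr h])
      (integrable_const _), ih]
    simp

/-- Chebyshev's inequality for the walk at a fixed time. -/
lemma measure_far_le (t : ℕ) {ρ : ℝ} (hρ : 0 < ρ) :
    (noiseLaw d).real {ω | ∃ i, ρ ≤ |(walk ω t i : ℝ)|} ≤ t / ρ ^ 2 := by
  have h := mul_meas_ge_le_integral_of_nonneg (μ := noiseLaw d)
    (f := fun ω => ∑ i, (walk ω t i : ℝ) ^ 2)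
    (ae_of_all _ fun ω => Finset.sum_nonneg fun i _ => sq_nonneg _)
    (integrable_of_detBy (n := t) fun ω ω' h => by simp only [walk_congr h]) (ρ ^ 2)
  rw [integral_sum_sq_walk] at h
  rw [le_div_iff₀ (by positivity), mul_comm]
  refine le_trans (mul_le_mul_of_nonneg_left (measureReal_mono ?_) (by positivity)) h
  rintro ω ⟨i, hi⟩
  change ρ ^ 2 ≤ ∑ i, (walk ω t i : ℝ) ^ 2
  calc ρ ^ 2 ≤ |(walk ω t i : ℝ)| ^ 2 := by gcongr
    _ = (walk ω t i : ℝ) ^ 2 := sq_abs _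
    _ ≤ _ := Finset.single_le_sum (f := fun i => (walk ω t i : ℝ) ^ 2)
      (fun i _ => sq_nonneg _) (Finset.mem_univ i)

end

/-! ### Bounds on the heat kernel -/

section

variable [NeZero d]

/-- The characteristic function of a step. -/
def charStep (θ : Fin d → ℝ) : ℝ := (d : ℝ)⁻¹ * ∑ i, Real.cos (θ i)

/-- The characteristic function of the walk, in real form and with a phase shift. -/
lemma integral_cos_walk (θ : Fin d → ℝ) (t : ℕ) (a : ℝ) :
    ∫ ω, Real.cos (∑ i, θ i * (walk ω t i : ℝ) - a) ∂(noiseLaw d) =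
      charStep θ ^ t * Real.cos a := by
  induction t with
  | zero => simp
  | succ t ih =>
    rw [integral_walk_succ (fun x => Real.cos (∑ i, θ i * (x i : ℝ) - a))]
    have h : ∀ ω : Noise d, (2 * d : ℝ)⁻¹ * ∑ e : Step d,
        Real.cos (∑ i, θ i * (((walk ω t + stepVec e) i : ℤ) : ℝ) - a) =
        charStep θ * Real.cos (∑ i, θ i * (walk ω t i : ℝ) - a) := by
      intro ω
      have h1 : ∀ (e : Step d), ∑ i, θ i * (((walk ω t + stepVec e) i : ℤ) : ℝ) =
          ∑ i, θ i * (walk ω t i : ℝ) + (if e.2 then 1 else -1) * θ e.1 := by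
        intro e
        have h2 : ∀ i, θ i * (((walk ω t + stepVec e) i : ℤ) : ℝ) = θ i * (walk ω t i : ℝ) +
            if i = e.1 then (if e.2 then 1 else -1) * θ i else 0 := by
          intro i
          simp only [Pi.add_apply, stepVec_apply]
          split_ifs <;> push_cast <;> ring
        simp only [h2, Finset.sum_add_distrib, Finset.sum_ite_eq', Finset.mem_univ, if_true]
      simp only [h1, Fintype.sum_prod_type, Fintype.sum_bool, if_true, Bool.false_eq_true,
        if_false, charStep]
      have h3 : ∀ i, Real.cos (∑ i, θ i * (walk ω t i : ℝ) + 1 * θ i - a) +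
          Real.cos (∑ i, θ i * (walk ω t i : ℝ) + -1 * θ i - a) =
          2 * Real.cos (∑ i, θ i * (walk ω t i : ℝ) - a) * Real.cos (θ i) := by
        intro i
        generalize ∑ i, θ i * (walk ω t i : ℝ) = s
        rw [show s + 1 * θ i - a = (s - a) + θ i by ring,
          show s + -1 * θ i - a = (s - a) - θ i by ring, Real.cos_add (s - a),
          Real.cos_sub (s - a)]
        ring
      simp only [h3, ← Finset.mul_sum]
      have hd : (d : ℝ) ≠ 0 := Nat.cast_ne_zero.2 (NeZero.ne d)
      field_simp
    simp only [h]
    rw [integral_const_mul, ih]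
    ring

/-- The Lebesgue measure on the fundamental domain of the dual torus. -/
def torusMeasure (d : ℕ) : Measure (Fin d → ℝ) :=
  Measure.pi fun _ => volume.restrict (Set.Ioc (-Real.pi) Real.pi)

omit [NeZero d] in
instance : IsFiniteMeasure (torusMeasure d) := by
  unfold torusMeasure; infer_instance

lemma integral_exp_int (n : ℤ) :
    ∫ x, Complex.exp ((x * n : ℝ) * Complex.I) ∂(volume.restrict (Set.Ioc (-Real.pi) Real.pi)) =
      if n = 0 then (2 * Real.pi : ℂ) else 0 := by
  rw [← intervalIntegral.integral_of_le (by linarith [Real.pi_pos])]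
  split_ifs with h
  · subst h
    simp
    ring
  · have hc : (n * Complex.I : ℂ) ≠ 0 := by simp [h]
    have h1 : ∀ x : ℝ, Complex.exp ((x * n : ℝ) * Complex.I) =
        Complex.exp ((n * Complex.I) * x) := by
      intro x; congr 1; push_cast; ring
    simp only [h1]
    rw [integral_exp_mul_complex hc]
    have h2 : Complex.exp (n * Complex.I * (Real.pi : ℝ)) =
        Complex.exp (n * Complex.I * ((-Real.pi : ℝ) : ℂ)) := by
      rw [Complex.exp_eq_exp_iff_exists_int]
      exact ⟨n, by push_cast; ring⟩
    rw [h2]; simp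

omit [NeZero d] in
lemma integral_cos_torus (z : Fin d → ℤ) :
    ∫ θ, Real.cos (∑ i, θ i * (z i : ℝ)) ∂(torusMeasure d) =
      if z = 0 then (2 * Real.pi) ^ d else 0 := by
  have h1 : ∫ θ, Complex.exp ((∑ i, θ i * (z i : ℝ) : ℝ) * Complex.I) ∂(torusMeasure d) =
      if z = 0 then ((2 * Real.pi : ℝ) : ℂ) ^ d else 0 := by
    have h2 : ∀ θ : Fin d → ℝ, Complex.exp ((∑ i, θ i * (z i : ℝ) : ℝ) * Complex.I) =
        ∏ i, Complex.exp ((θ i * (z i : ℝ) : ℝ) * Complex.I) := by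
      intro θ
      rw [← Complex.exp_sum, Complex.ofReal_sum, Finset.sum_mul]
    simp only [h2]
    rw [torusMeasure, integral_fintype_prod_eq_prod
      (f := fun i (x : ℝ) => Complex.exp ((x * (z i : ℝ) : ℝ) * Complex.I))]
    have h3 : ∀ i, ∫ x, Complex.exp ((x * (z i : ℝ) : ℝ) * Complex.I)
        ∂(volume.restrict (Set.Ioc (-Real.pi) Real.pi)) =
          if z i = 0 then (2 * Real.pi : ℂ) else 0 :=
      fun i => integral_exp_int (z i)
    simp only [h3]
    split_ifs with hz
    · subst hz; simp
    · obtain ⟨i, hi⟩ := Function.ne_iff.1 hz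
      exact Finset.prod_eq_zero (Finset.mem_univ i) (by simpa using hi)
  have h4 : Integrable (fun θ : Fin d → ℝ =>
      Complex.exp ((∑ i, θ i * (z i : ℝ) : ℝ) * Complex.I)) (torusMeasure d) := by
    refine Integrable.of_bound (Continuous.aestronglyMeasurable (by fun_prop)) 1
      (ae_of_all _ fun θ => ?_)
    rw [Complex.norm_exp_ofReal_mul_I]
  have h5 : ∫ θ, Real.cos (∑ i, θ i * (z i : ℝ)) ∂(torusMeasure d) =
      (∫ θ, Complex.exp ((∑ i, θ i * (z i : ℝ) : ℝ) * Complex.I) ∂(torusMeasure d)).re := by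
    have := integral_re h4
    rw [show (∫ θ, Complex.exp ((∑ i, θ i * (z i : ℝ) : ℝ) * Complex.I) ∂(torusMeasure d)).re
      = RCLike.re (∫ θ, Complex.exp ((∑ i, θ i * (z i : ℝ) : ℝ) * Complex.I) ∂(torusMeasure d))
      from rfl, ← this]
    refine integral_congr_ae (ae_of_all _ fun θ => ?_)
    exact (Complex.exp_ofReal_mul_I_re _).symm
  rw [h5, h1]
  split_ifs
  · rw [← Complex.ofReal_pow, Complex.ofReal_re]
  · simp

/-- Fourier inversion for the heat kernel. -/
lemma heat_eq_integral (t : ℕ) (x : Fin d → ℤ) :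
    heat d t x * (2 * Real.pi) ^ d =
      ∫ θ, charStep θ ^ t * Real.cos (∑ i, θ i * (x i : ℝ)) ∂(torusMeasure d) := by
  simp only [← integral_cos_walk _ t]
  have hmeas : Measurable fun p : (Fin d → ℝ) × Noise d =>
      Real.cos (∑ i, p.1 i * (walk p.2 t i : ℝ) - ∑ i, p.1 i * (x i : ℝ)) := by
    have h1 : ∀ i, Measurable fun p : (Fin d → ℝ) × Noise d => (walk p.2 t i : ℝ) := fun i =>
      (measurable_of_countable (fun z : Fin d → ℤ => (z i : ℝ))).comp
        ((measurable_walk t).comp measurable_snd)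
    fun_prop
  rw [integral_integral_swap (Integrable.of_bound hmeas.aestronglyMeasurable 1
    (ae_of_all _ fun p => Real.abs_cos_le_one _))]
  have h2 : ∀ ω : Noise d, ∫ θ, Real.cos (∑ i, θ i * (walk ω t i : ℝ) - ∑ i, θ i * (x i : ℝ))
      ∂(torusMeasure d) = Set.indicator {ω | walk ω t = x} (fun _ => (2 * Real.pi) ^ d) ω := by
    intro ω
    have h3 : ∀ θ : Fin d → ℝ, ∑ i, θ i * (walk ω t i : ℝ) - ∑ i, θ i * (x i : ℝ) =
        ∑ i, θ i * (((walk ω t - x) i : ℤ) : ℝ) := by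
      intro θ
      rw [← Finset.sum_sub_distrib]
      refine Finset.sum_congr rfl fun i _ => ?_
      push_cast [Pi.sub_apply]; ring
    simp only [h3]
    rw [integral_cos_torus]
    simp [Set.indicator_apply, sub_eq_zero]
  simp only [h2]
  rw [integral_indicator_const _ (measurableSet_walk_eq t x)]
  rfl

/-- The characteristic function has modulus one at `0` and at `(π, …, π)`: the walk is periodic,
so that a Gaussian bound has to be stated in terms of the sine. -/
lemma abs_charStep_le (θ : Fin d → ℝ) :
    |charStep θ| ≤ ∏ i, Real.exp (-(Real.sin (θ i) ^ 2 / (2 * d))) := by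
  have hd : (0 : ℝ) < d := Nat.cast_pos.2 (Nat.pos_of_ne_zero (NeZero.ne d))
  rw [← Real.exp_sum]
  have h1 : ∀ x : ℝ, |Real.cos x| ≤ 1 - Real.sin x ^ 2 / 2 := by
    intro x
    refine abs_le_of_sq_le_sq ?_ (by nlinarith [Real.sin_sq_le_one x])
    nlinarith [Real.sin_sq_add_cos_sq x, sq_nonneg (Real.sin x ^ 2)]
  have h2 : |charStep θ| ≤ (d : ℝ)⁻¹ * ∑ i, (1 - Real.sin (θ i) ^ 2 / 2) := by
    rw [charStep, abs_mul, abs_of_pos (inv_pos.2 hd)]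
    gcongr
    exact (Finset.abs_sum_le_sum_abs _ _).trans (Finset.sum_le_sum fun i _ => h1 _)
  have h3 : (d : ℝ)⁻¹ * ∑ i, (1 - Real.sin (θ i) ^ 2 / 2) =
      (∑ i, -(Real.sin (θ i) ^ 2 / (2 * d))) + 1 := by
    rw [Finset.sum_sub_distrib, Finset.sum_neg_distrib, ← Finset.sum_div, ← Finset.sum_div]
    simp
    field_simp
    ring
  exact (h2.trans h3.le).trans (Real.add_one_le_exp _)

/-- On a period, `sin ^ 2` is at least a quarter of the squared distance to one of its zeros `-π`,
`0`, `π`. -/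
lemma exp_sin_sq_le {c x : ℝ} (hc : 0 ≤ c) (hx : x ∈ Set.Ioc (-Real.pi) Real.pi) :
    Real.exp (-(c * Real.sin x ^ 2)) ≤ Real.exp (-(c / 4) * x ^ 2) +
      Real.exp (-(c / 4) * (x - Real.pi) ^ 2) + Real.exp (-(c / 4) * (x + Real.pi) ^ 2) := by
  have hpi := Real.pi_pos
  have key : ∀ y : ℝ, |y| ≤ Real.pi / 2 → Real.exp (-(c * Real.sin y ^ 2)) ≤
      Real.exp (-(c / 4) * y ^ 2) := by
    intro y hy
    rw [Real.exp_le_exp]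
    have h1 := Real.mul_abs_le_abs_sin hy
    have h2 : |y| / 2 ≤ |Real.sin y| := by
      refine le_trans ?_ h1
      have : (1 : ℝ) / 2 ≤ 2 / Real.pi := by
        rw [div_le_div_iff₀ two_pos hpi]; linarith [Real.pi_le_four]
      nlinarith [abs_nonneg y]
    have h3 : (|y| / 2) ^ 2 ≤ |Real.sin y| ^ 2 := by gcongr
    rw [sq_abs, div_pow, sq_abs] at h3
    nlinarith
  have p1 := Real.exp_pos (-(c / 4) * x ^ 2)
  have p2 := Real.exp_pos (-(c / 4) * (x - Real.pi) ^ 2)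
  have p3 := Real.exp_pos (-(c / 4) * (x + Real.pi) ^ 2)
  by_cases h1 : Real.pi / 2 < x
  · have := key (x - Real.pi) (by rw [abs_le]; constructor <;> linarith [hx.2])
    rw [Real.sin_sub_pi, neg_sq] at this
    linarith
  by_cases h2 : x < -(Real.pi / 2)
  · have := key (x + Real.pi) (by rw [abs_le]; constructor <;> linarith [hx.1])
    rw [Real.sin_add_pi, neg_sq] at this
    linarith
  · have := key x (by rw [abs_le]; constructor <;> linarith)
    linarith

lemma integral_exp_sin_sq_le {c : ℝ} (hc : 0 < c) :
    ∫ x, Real.exp (-(c * Real.sin x ^ 2)) ∂(volume.restrict (Set.Ioc (-Real.pi) Real.pi)) ≤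
      3 * √(Real.pi / (c / 4)) := by
  have i0 := integrable_exp_neg_mul_sq (b := c / 4) (by positivity)
  have i1 : Integrable fun x : ℝ => Real.exp (-(c / 4) * (x - Real.pi) ^ 2) :=
    i0.comp_sub_right Real.pi
  have i2 : Integrable fun x : ℝ => Real.exp (-(c / 4) * (x + Real.pi) ^ 2) :=
    i0.comp_add_right Real.pi
  calc _ ≤ ∫ x, (Real.exp (-(c / 4) * x ^ 2) +
      Real.exp (-(c / 4) * (x - Real.pi) ^ 2) + Real.exp (-(c / 4) * (x + Real.pi) ^ 2))
        ∂(volume.restrict (Set.Ioc (-Real.pi) Real.pi)) := by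
        refine setIntegral_mono_on ?_ ((i0.add i1).add i2).integrableOn measurableSet_Ioc
          fun x hx => exp_sin_sq_le hc.le hx
        refine Integrable.of_bound (by fun_prop) 1 (ae_of_all _ fun x => ?_)
        rw [Real.norm_eq_abs, abs_of_pos (Real.exp_pos _), Real.exp_le_one_iff]
        nlinarith [sq_nonneg (Real.sin x)]
    _ ≤ ∫ x, (Real.exp (-(c / 4) * x ^ 2) +
      Real.exp (-(c / 4) * (x - Real.pi) ^ 2) + Real.exp (-(c / 4) * (x + Real.pi) ^ 2)) :=
        setIntegral_le_integral ((i0.add i1).add i2) (ae_of_all _ fun x => by positivity)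
    _ = _ := by
        rw [integral_add (f := fun x => Real.exp (-(c / 4) * x ^ 2) +
          Real.exp (-(c / 4) * (x - Real.pi) ^ 2)) (i0.add i1) i2, integral_add i0 i1,
          integral_sub_right_eq_self (fun x : ℝ => Real.exp (-(c / 4) * x ^ 2)) Real.pi,
          integral_add_right_eq_self (fun x : ℝ => Real.exp (-(c / 4) * x ^ 2)) Real.pi,
          integral_gaussian]
        ring

/-- The on-diagonal heat kernel bound: Fourier inversion reduces it to a product of one-dimensional
Gaussian integrals. -/
lemma exists_heat_le (d : ℕ) [NeZero d] :
    ∃ C : ℝ, 1 ≤ C ∧ ∀ (t : ℕ) (x : Fin d → ℤ), heat d t x ≤ C / (√(t + 1)) ^ d := by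
  have hd : (0 : ℝ) < d := Nat.cast_pos.2 (Nat.pos_of_ne_zero (NeZero.ne d))
  have hpi := Real.pi_pos
  let K : ℝ := 3 * √(16 * d * Real.pi)
  refine ⟨max 1 (K ^ d / (2 * Real.pi) ^ d), le_max_left _ _, fun t x => ?_⟩
  rcases Nat.eq_zero_or_pos t with rfl | ht
  · simp only [Nat.cast_zero, zero_add, Real.sqrt_one, one_pow, div_one]
    exact (heat_le_one _ _).trans (le_max_left _ _)
  have ht' : (1 : ℝ) ≤ t := by exact_mod_cast ht
  let c : ℝ := t / (2 * d)
  have hc : 0 < c := by positivity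
  have h1 : heat d t x * (2 * Real.pi) ^ d ≤ (3 * √(Real.pi / (c / 4))) ^ d := by
    rw [heat_eq_integral]
    calc _ ≤ ∫ θ, ∏ i, Real.exp (-(c * Real.sin (θ i) ^ 2)) ∂(torusMeasure d) := by
          have hb : ∀ θ : Fin d → ℝ, |charStep θ ^ t * Real.cos (∑ i, θ i * (x i : ℝ))| ≤
              ∏ i, Real.exp (-(c * Real.sin (θ i) ^ 2)) := by
            intro θ
            rw [abs_mul, abs_pow]
            calc _ ≤ |charStep θ| ^ t * 1 := by gcongr; exact Real.abs_cos_le_one _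
              _ ≤ (∏ i, Real.exp (-(Real.sin (θ i) ^ 2 / (2 * d)))) ^ t := by
                  rw [mul_one]; gcongr; exact abs_charStep_le θ
              _ = _ := by
                  rw [← Finset.prod_pow]
                  refine Finset.prod_congr rfl fun i _ => ?_
                  rw [← Real.exp_nat_mul]
                  congr 1
                  simp only [c]; ring
          have hle : ∀ θ : Fin d → ℝ, ∏ i, Real.exp (-(c * Real.sin (θ i) ^ 2)) ≤ 1 := by
            intro θ
            refine Finset.prod_le_one (fun _ _ => (Real.exp_pos _).le) fun i _ => ?_
            rw [Real.exp_le_one_iff]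
            nlinarith [sq_nonneg (Real.sin (θ i))]
          refine integral_mono (Integrable.of_bound ?_ 1 (ae_of_all _ fun θ =>
            (hb θ).trans (hle θ)))
            (Integrable.of_bound (Continuous.aestronglyMeasurable (by fun_prop)) 1
            (ae_of_all _ fun θ => ?_)) fun θ => (le_abs_self _).trans (hb θ)
          · unfold charStep; fun_prop
          · rw [Real.norm_eq_abs, abs_of_nonneg (by positivity)]
            exact hle θ
      _ = ∏ i : Fin d, ∫ x, Real.exp (-(c * Real.sin x ^ 2))
            ∂(volume.restrict (Set.Ioc (-Real.pi) Real.pi)) := by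
          rw [torusMeasure]
          exact integral_fintype_prod_eq_prod (fun _ x => Real.exp (-(c * Real.sin x ^ 2)))
      _ = (∫ x, Real.exp (-(c * Real.sin x ^ 2))
            ∂(volume.restrict (Set.Ioc (-Real.pi) Real.pi))) ^ d := by simp
      _ ≤ _ := by
          refine pow_le_pow_left₀ (integral_nonneg fun x => (Real.exp_pos _).le) ?_ d
          exact integral_exp_sin_sq_le hc
  have h2 : √(Real.pi / (c / 4)) ≤ √(16 * d * Real.pi) / √(t + 1) := by
    rw [← Real.sqrt_div (by positivity)]
    refine Real.sqrt_le_sqrt ?_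
    rw [div_le_div_iff₀ (by positivity) (by positivity)]
    have : c / 4 * (8 * d) = t := by simp only [c]; field_simp; norm_num
    nlinarith [mul_pos hd hpi]
  have h3 : heat d t x ≤ (K / √(t + 1)) ^ d / (2 * Real.pi) ^ d := by
    rw [le_div_iff₀ (by positivity)]
    refine h1.trans ?_
    gcongr
    rw [show K / √(t + 1) = 3 * (√(16 * d * Real.pi) / √(t + 1)) by simp only [K]; ring]
    gcongr
  calc heat d t x ≤ _ := h3
    _ = (K ^ d / (2 * Real.pi) ^ d) / (√(t + 1)) ^ d := by rw [div_pow]; ring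
    _ ≤ _ := by gcongr; exact le_max_right _ _

/-- The walk being far at the end of a stretch only costs Chebyshev's factor on top of the bound
on the heat kernel. -/
lemma measure_walk_eq_and_far_le {C : ℝ} (hC : 0 ≤ C)
    (h : ∀ (t : ℕ) (x : Fin d → ℤ), heat d t x ≤ C / (√(t + 1)) ^ d)
    (a b : ℕ) (z : Fin d → ℤ) (i : Fin d) {r : ℝ} (hr : 0 < r) :
    (noiseLaw d).real {ω | walk ω (a + b) = z ∧ r ≤ |(walk ω a i : ℝ)|} ≤
      C / (√(b + 1)) ^ d * (a / r ^ 2) := by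
  have hA : DetBy a {ω : Noise d | r ≤ |(walk ω a i : ℝ)|} :=
    detBy_walk le_rfl {x : Fin d → ℤ | r ≤ |(x i : ℝ)|}
  refine (measure_le_mul_of_glue (isStop_const a) hA.measurableSet
    ((measurableSet_walk_eq (a + b) z).inter hA.measurableSet) (c := C / (√(b + 1)) ^ d)
    (by positivity) ?_ ?_).trans ?_
  · intro ω ω' hω hE
    exact hω ((hA.glue_mem_iff ω ω').1 hE.2)
  · intro ω _
    refine le_trans (measureReal_mono ?_) (h b (z - walk ω a))
    rintro ω' ⟨h1, _⟩
    have h1 : walk (glue a ω ω') (a + b) = z := h1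
    rw [walk_glue_add] at h1
    exact eq_sub_of_add_eq' h1
  · refine mul_le_mul_of_nonneg_left (le_trans (measureReal_mono ?_) (measure_far_le a hr))
      (by positivity)
    intro ω hω
    exact ⟨i, hω⟩

/-- Exchanging the two stretches of a walk keeps its law. -/
lemma measure_swap_stretches (a b : ℕ) (z : Fin d → ℤ) (s : Set (Fin d → ℤ)) :
    (noiseLaw d).real {ω | walk ω (a + b) = z ∧ walk (shift a ω) b ∈ s} =
      (noiseLaw d).real {ω | walk ω (b + a) = z ∧ walk ω b ∈ s} := by
  have hs : ∀ n, MeasurableSet {ω : Noise d | walk ω n ∈ s} := fun n =>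
    (detBy_walk le_rfl s).measurableSet
  have m1 : MeasurableSet {ω : Noise d | walk ω (a + b) = z ∧ walk (shift a ω) b ∈ s} :=
    (measurableSet_walk_eq _ _).inter (measurable_shift a (hs b))
  have m2 : MeasurableSet {ω : Noise d | walk ω (b + a) = z ∧ walk ω b ∈ s} :=
    (measurableSet_walk_eq _ _).inter (hs b)
  rw [measureReal_def, measureReal_def,
    ← (measurePreserving_glue (d := d) a).measure_preimage m1.nullMeasurableSet,
    ← (measurePreserving_glue (d := d) b).measure_preimage m2.nullMeasurableSet,
    ← (Measure.measurePreserving_swap (μ := noiseLaw d) (ν := noiseLaw d)).measure_preimage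
      (measurable_glue b m2).nullMeasurableSet]
  congr 2
  ext ⟨ω, ω'⟩
  simp only [Set.mem_preimage, Set.mem_ofPred_eq, shift_glue, walk_glue_add, Prod.swap,
    walk_glue_of_le le_rfl]
  rw [add_comm]

/-- The heat kernel bound, and its improvement by the factor `t / ρ ^ 2` at the distance `ρ`: one of
the two halves of the path covers at least the distance `ρ / 2`, and each half can be taken to come
first. -/
lemma exists_heat_far_le (d : ℕ) [NeZero d] :
    ∃ C : ℝ, 1 ≤ C ∧ (∀ (t : ℕ) (x : Fin d → ℤ), heat d t x ≤ C / (√(t + 1)) ^ d) ∧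
      ∀ (t : ℕ) (x : Fin d → ℤ) (ρ : ℝ), 0 < ρ → (∃ i, ρ ≤ |(x i : ℝ)|) →
        heat d t x ≤ C * ((t + 1) / ρ ^ 2) / (√(t + 1)) ^ d := by
  obtain ⟨C, hC, h⟩ := exists_heat_le d
  have hC0 : 0 ≤ C := by linarith
  have h2d : (1 : ℝ) ≤ (√2) ^ d := one_le_pow₀ (by rw [Real.one_le_sqrt]; norm_num)
  refine ⟨4 * C * (√2) ^ d, by nlinarith, fun t x => (h t x).trans ?_, ?_⟩
  · gcongr; nlinarith
  rintro t x ρ hρ ⟨i, hi⟩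
  obtain ⟨a, b, hab, ha, hb⟩ : ∃ a b : ℕ, a + b = t ∧ t ≤ 2 * a + 1 ∧ t ≤ 2 * b + 1 :=
    ⟨t / 2, t - t / 2, by omega, by omega, by omega⟩
  have hsplit : {ω : Noise d | walk ω t = x} ⊆
      {ω | walk ω (a + b) = x ∧ ρ / 2 ≤ |(walk ω a i : ℝ)|} ∪
      {ω | walk ω (a + b) = x ∧ walk (shift a ω) b ∈ {y : Fin d → ℤ | ρ / 2 ≤ |(y i : ℝ)|}} := by
    intro ω hω
    have hω : walk ω t = x := hω
    by_contra hc
    simp only [Set.mem_union, Set.mem_ofPred_eq, not_or, not_and, not_le, hab, hω,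
      forall_const] at hc
    have h1 : x i = walk ω a i + walk (shift a ω) b i := by
      rw [← hω, ← hab, walk_add]; rfl
    rw [h1] at hi
    push_cast at hi
    have := abs_add_le (walk ω a i : ℝ) (walk (shift a ω) b i : ℝ)
    linarith [hc.1, hc.2]
  have key : ∀ m n : ℕ, m ≤ t → t ≤ 2 * n + 1 →
      C / (√(n + 1)) ^ d * (m / (ρ / 2) ^ 2) ≤
        (C * (√2) ^ d / (√(t + 1)) ^ d) * (4 * m / ρ ^ 2) := by
    intro m n _ hn
    have h1 : √(t + 1) ≤ √2 * √(n + 1) := by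
      rw [← Real.sqrt_mul (by norm_num)]
      refine Real.sqrt_le_sqrt ?_
      have : (t : ℝ) ≤ 2 * n + 1 := by exact_mod_cast hn
      linarith
    have h2 : C / (√(n + 1)) ^ d ≤ C * (√2) ^ d / (√(t + 1)) ^ d := by
      rw [div_le_div_iff₀ (by positivity) (by positivity)]
      calc C * √(t + 1) ^ d ≤ C * (√2 * √(n + 1)) ^ d := by gcongr
        _ = _ := by rw [mul_pow]; ring
    refine mul_le_mul h2 (le_of_eq ?_) (by positivity) (by positivity)
    field_simp
    ring
  calc heat d t x ≤ _ := measureReal_mono hsplit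
    _ ≤ _ := measureReal_union_le _ _
    _ ≤ C / (√(b + 1)) ^ d * (a / (ρ / 2) ^ 2) + C / (√(a + 1)) ^ d * (b / (ρ / 2) ^ 2) := by
        rw [measure_swap_stretches]
        exact add_le_add (measure_walk_eq_and_far_le hC0 h a b x i (by positivity))
          (measure_walk_eq_and_far_le hC0 h b a x i (by positivity))
    _ ≤ (C * (√2) ^ d / (√(t + 1)) ^ d) * (4 * a / ρ ^ 2) +
        (C * (√2) ^ d / (√(t + 1)) ^ d) * (4 * b / ρ ^ 2) :=
        add_le_add (key a b (by omega) hb) (key b a (by omega) ha)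
    _ = (4 * C * (√2) ^ d * (t / ρ ^ 2)) / (√(t + 1)) ^ d := by
        rw [← hab]; push_cast; ring
    _ ≤ _ := by gcongr; linarith

/-- The Green function of the walk run for `N` steps. -/
def green (d : ℕ) [NeZero d] (N : ℕ) (x : Fin d → ℤ) : ℝ := ∑ t ∈ Finset.range N, heat d t x

lemma one_le_green {N : ℕ} (hN : 1 ≤ N) : 1 ≤ green d N 0 := by
  rw [← heat_zero_zero (d := d)]
  exact Finset.single_le_sum (f := fun t => heat d t 0) (fun _ _ => heat_nonneg _ _)
    (Finset.mem_range.2 hN)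

lemma harmonic_eq_sum (N : ℕ) :
    ((harmonic N : ℚ) : ℝ) = ∑ t ∈ Finset.range N, 1 / ((t : ℝ) + 1) := by
  simp [harmonic]

/-- In dimension at least two the heat kernel is bounded by a multiple of the inverse of time, and
the Green function grows at most logarithmically. -/
lemma exists_heat_le_inv (hd : 2 ≤ d) :
    ∃ C : ℝ, 1 ≤ C ∧ (∀ (t : ℕ) (x : Fin d → ℤ), heat d t x ≤ C / (t + 1)) ∧
      ∀ N : ℕ, green d N 0 ≤ C * (1 + Real.log N) := by
  obtain ⟨C, hC, h⟩ := exists_heat_le d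
  have h1 : ∀ (t : ℕ) (x : Fin d → ℤ), heat d t x ≤ C / (t + 1) := by
    intro t x
    refine (h t x).trans ?_
    have h2 : (1 : ℝ) ≤ √(t + 1) := by rw [Real.one_le_sqrt]; linarith [t.cast_nonneg (α := ℝ)]
    have h3 : (t : ℝ) + 1 = √(t + 1) ^ 2 := (Real.sq_sqrt (by positivity)).symm
    conv_rhs => rw [h3]
    gcongr
  refine ⟨C, hC, h1, fun N => ?_⟩
  calc green d N 0 ≤ ∑ t ∈ Finset.range N, C * (1 / ((t : ℝ) + 1)) :=
        Finset.sum_le_sum fun t _ => (h1 t 0).trans_eq (by ring)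
    _ = C * harmonic N := by rw [harmonic_eq_sum, Finset.mul_sum]
    _ ≤ _ := by
        gcongr
        exact harmonic_le_one_add_log N

lemma sum_Ico_inv_le {M K : ℕ} (hM : 1 ≤ M) (hK : M ≤ K) :
    ∑ t ∈ Finset.Ico M K, 1 / ((t : ℝ) + 1) ≤ Real.log K - Real.log M := by
  induction K, hK using Nat.le_induction with
  | base => simp
  | succ K hK ih =>
    rw [Finset.sum_Ico_succ_top hK]
    have hK0 : (0 : ℝ) < K := by exact_mod_cast (by omega : 0 < K)
    have h := Real.one_sub_inv_le_log_of_pos (x := ((K : ℝ) + 1) / K) (by positivity)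
    rw [Real.log_div (by positivity) (by positivity)] at h
    have h2 : 1 - (((K : ℝ) + 1) / K)⁻¹ = 1 / (K + 1) := by field_simp; ring
    push_cast
    linarith

/-- On-diagonal lower bound: the walk is spread over a box, and Cauchy–Schwarz. -/
lemma heat_two_dim_ge (hd : d = 2) (t : ℕ) : 1 / (72 * ((t : ℝ) + 1)) ≤ heat d (t + t) 0 := by
  let m : ℕ := Nat.sqrt (2 * t) + 1
  let B : Finset (Fin d → ℤ) := Fintype.piFinset fun _ => Finset.Icc (-(m : ℤ)) m
  have hcard : (B.card : ℝ) ≤ 18 * (t + 1) := by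
    have h1 : B.card = (2 * m + 1) ^ 2 := by
      simp only [B, Fintype.card_piFinset, Int.card_Icc, Finset.prod_const, Finset.card_univ,
        Fintype.card_fin]
      rw [hd]; congr 1; omega
    have h2 : Nat.sqrt (2 * t) * Nat.sqrt (2 * t) ≤ 2 * t := Nat.sqrt_le _
    have h3 : ((Nat.sqrt (2 * t) : ℕ) : ℝ) * Nat.sqrt (2 * t) ≤ 2 * t := by exact_mod_cast h2
    rw [h1]
    push_cast [m]
    nlinarith [sq_nonneg (((Nat.sqrt (2 * t) : ℕ) : ℝ) - 1)]
  have hhalf : 1 / 2 ≤ ∑ x ∈ B, heat d t x := by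
    have h1 : (noiseLaw d).real (⋃ x ∈ B, {ω | walk ω t = x}) = ∑ x ∈ B, heat d t x := by
      rw [measureReal_biUnion_finset]
      · rfl
      · intro x _ y _ hxy
        refine Set.disjoint_left.2 fun ω h1 h2 => hxy ?_
        exact (show walk ω t = x from h1).symm.trans h2
      · exact fun x _ => measurableSet_walk_eq t x
    rw [← h1]
    have h2 : (⋃ x ∈ B, {ω : Noise d | walk ω t = x})ᶜ ⊆
        {ω | ∃ i, ((m : ℝ) + 1) ≤ |(walk ω t i : ℝ)|} := by
      intro ω hω
      by_contra hc
      apply hω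
      simp only [Set.mem_iUnion, Set.mem_ofPred_eq, exists_prop, exists_eq_right', B,
        Fintype.mem_piFinset, Finset.mem_Icc]
      intro i
      rw [← abs_le]
      by_contra hi
      refine hc ⟨i, ?_⟩
      have : (m : ℤ) + 1 ≤ |walk ω t i| := by omega
      exact_mod_cast this
    have h3 := (measureReal_mono (μ := noiseLaw d) h2).trans
      (measure_far_le t (by positivity))
    rw [probReal_compl_eq_one_sub (Finset.measurableSet_biUnion _ fun x _ =>
      measurableSet_walk_eq t x)] at h3
    have h4 : (t : ℝ) / ((m : ℝ) + 1) ^ 2 ≤ 1 / 2 := by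
      rw [div_le_div_iff₀ (by positivity) two_pos]
      have h5 : 2 * t < (Nat.sqrt (2 * t) + 1) * (Nat.sqrt (2 * t) + 1) := Nat.lt_succ_sqrt _
      have h6 : 2 * (t : ℝ) ≤ m * m := by exact_mod_cast h5.le
      nlinarith [m.cast_nonneg (α := ℝ)]
    linarith
  have hsq : ∑ x ∈ B, heat d t x ^ 2 ≤ heat d (t + t) 0 := by
    have h1 : ∀ x : Fin d → ℤ, heat d t x ^ 2 =
        (noiseLaw d).real ({ω | walk ω t = x} ∩ shift t ⁻¹' {ω | walk ω t = -x}) := by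
      intro x
      rw [measureReal_inter_shift (detBy_walk_eq le_rfl x) (measurableSet_walk_eq t (-x)), sq]
      congr 1
      exact (heat_neg t x).symm
    simp only [h1]
    rw [← measureReal_biUnion_finset]
    · refine measureReal_mono ?_
      intro ω hω
      simp only [Set.mem_iUnion] at hω
      obtain ⟨x, _, h2, h3⟩ := hω
      change walk ω (t + t) = 0
      have h2 : walk ω t = x := h2
      have h3 : walk (shift t ω) t = -x := h3
      rw [walk_add, h2, h3, add_neg_cancel]
    · intro x _ y _ hxy
      refine Set.disjoint_left.2 fun ω h1 h2 => hxy ?_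
      exact (show walk ω t = x from h1.1).symm.trans h2.1
    · exact fun x _ => (measurableSet_walk_eq t x).inter
        (measurable_shift t (measurableSet_walk_eq t (-x)))
  have hcs : (∑ x ∈ B, heat d t x) ^ 2 ≤ B.card * ∑ x ∈ B, heat d t x ^ 2 :=
    sq_sum_le_card_mul_sum_sq
  have h0 : 0 ≤ heat d (t + t) 0 := heat_nonneg _ _
  rw [div_le_iff₀ (by positivity)]
  have h1 : (1 : ℝ) / 4 ≤ B.card * heat d (t + t) 0 := by
    calc (1 : ℝ) / 4 = (1 / 2) ^ 2 := by norm_num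
      _ ≤ (∑ x ∈ B, heat d t x) ^ 2 := by gcongr
      _ ≤ _ := hcs.trans (by gcongr)
  nlinarith

/-- In dimension two the Green function grows at least logarithmically. -/
lemma green_two_dim_ge (hd : d = 2) (N : ℕ) : Real.log (N + 1) / 72 ≤ green d (2 * N) 0 := by
  have h1 : ∀ N : ℕ, ∑ t ∈ Finset.range N, heat d (t + t) 0 ≤ green d (2 * N) 0 := by
    intro N
    induction N with
    | zero => simp [green]
    | succ N ih =>
      rw [Finset.sum_range_succ, green, show 2 * (N + 1) = 2 * N + 1 + 1 by ring,
        Finset.sum_range_succ, Finset.sum_range_succ, show N + N = 2 * N by ring]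
      have := heat_nonneg (d := d) (2 * N + 1) 0
      have h2 : green d (2 * N) 0 = ∑ t ∈ Finset.range (2 * N), heat d t 0 := rfl
      linarith
  calc Real.log (N + 1) / 72 ≤ (harmonic N : ℝ) / 72 := by
        gcongr; exact_mod_cast log_add_one_le_harmonic N
    _ = ∑ t ∈ Finset.range N, 1 / (72 * ((t : ℝ) + 1)) := by
        rw [harmonic_eq_sum, Finset.sum_div]
        refine Finset.sum_congr rfl fun t _ => ?_
        rw [div_div, mul_comm]
    _ ≤ _ := (Finset.sum_le_sum fun t _ => heat_two_dim_ge hd t).trans (h1 N)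

end

/-! ### Survival, hitting and range estimates -/

/-- The first time at which the event `P t` occurs, truncated at `N`. -/
def firstTime (P : ℕ → Set (Noise d)) (N : ℕ) (ω : Noise d) : ℕ := sInf {t | ω ∈ P t ∨ t = N}

lemma firstTime_le (P : ℕ → Set (Noise d)) (N : ℕ) (ω : Noise d) : firstTime P N ω ≤ N :=
  Nat.sInf_le (Or.inr rfl)

lemma firstTime_le_of_mem {P : ℕ → Set (Noise d)} {N t : ℕ} {ω : Noise d} (h : ω ∈ P t) :
    firstTime P N ω ≤ t :=
  Nat.sInf_le (Or.inl h)

lemma firstTime_mem_or (P : ℕ → Set (Noise d)) (N : ℕ) (ω : Noise d) :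
    ω ∈ P (firstTime P N ω) ∨ firstTime P N ω = N :=
  Nat.sInf_mem (s := {t | ω ∈ P t ∨ t = N}) ⟨N, Or.inr rfl⟩

lemma mem_firstTime {P : ℕ → Set (Noise d)} {N t : ℕ} {ω : Noise d} (h : ω ∈ P t) (ht : t ≤ N) :
    ω ∈ P (firstTime P N ω) := by
  rcases firstTime_mem_or P N ω with h1 | h1
  · exact h1
  · have := firstTime_le_of_mem (N := N) h
    have h2 : t = N := by omega
    rw [h1, ← h2]; exact h

lemma isStop_firstTime {P : ℕ → Set (Noise d)} (hP : ∀ t, DetBy t (P t)) (N : ℕ) :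
    IsStop (firstTime P N) := by
  intro ω ω' h
  have h1 : firstTime P N ω' ≤ firstTime P N ω := by
    rcases firstTime_mem_or P N ω with h2 | h2
    · exact firstTime_le_of_mem (hP _ ω ω' h h2)
    · rw [h2]; exact firstTime_le _ _ _
  refine le_antisymm h1 ?_
  rcases firstTime_mem_or P N ω' with h2 | h2
  · exact firstTime_le_of_mem (hP _ ω' ω (fun i hi => (h i (hi.trans_le h1)).symm) h2)
  · rw [h2]; exact firstTime_le _ _ _

/-- The walk does not return to the origin up to time `s`. -/
def noReturn (d s : ℕ) : Set (Noise d) := {ω | ∀ i, 1 ≤ i → i ≤ s → walk ω i ≠ 0}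

/-- The walk avoids the neighbour `e` of the origin up to time `s`. -/
def avoid (e : Step d) (s : ℕ) : Set (Noise d) := {ω | ∀ i ≤ s, walk ω i ≠ stepVec e}

lemma detBy_noReturn (d s : ℕ) : DetBy s (noReturn d s) := by
  intro ω ω' h hω i hi his
  rw [walk_congr fun j hj => h j (hj.trans_le his)]
  exact hω i hi his

lemma detBy_avoid (e : Step d) (s : ℕ) : DetBy s (avoid e s) := by
  intro ω ω' h hω i his
  rw [walk_congr fun j hj => h j (hj.trans_le his)]
  exact hω i his

section Estimates

variable [NeZero d]

lemma measureReal_map_step (g : Equiv.Perm (Step d)) {E : Set (Noise d)} (hE : MeasurableSet E) :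
    (noiseLaw d).real {ω | (fun i => g (ω i)) ∈ E} = (noiseLaw d).real E := by
  rw [measureReal_def, measureReal_def,
    ← (measurePreserving_map_step g).measure_preimage hE.nullMeasurableSet]
  rfl

lemma measure_avoid_eq (e e' : Step d) (s : ℕ) :
    (noiseLaw d).real (avoid e s) = (noiseLaw d).real (avoid e' s) := by
  obtain ⟨g, A, hA, hg, rfl⟩ := exists_symmetry e e'
  rw [← measureReal_map_step g (detBy_avoid (g e) s).measurableSet]
  congr 1
  ext ω
  simp only [avoid, Set.mem_ofPred_eq, walk_map_step hg, hg, ne_eq, hA.eq_iff]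

/-- Decomposition according to the last visit of the origin. -/
lemma one_le_sum_heat_mul_noReturn (N : ℕ) :
    1 ≤ ∑ t ∈ Finset.range (N + 1), heat d t 0 * (noiseLaw d).real (noReturn d (N - t)) := by
  have h1 : ∀ t, heat d t 0 * (noiseLaw d).real (noReturn d (N - t)) =
      (noiseLaw d).real ({ω | walk ω t = 0} ∩ shift t ⁻¹' noReturn d (N - t)) := fun t => by
    rw [measureReal_inter_shift (detBy_walk_eq le_rfl 0) (detBy_noReturn d _).measurableSet]
    rfl
  simp only [h1]
  refine le_trans ?_ (measureReal_biUnion_finset_le _ _)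
  rw [← probReal_univ (μ := noiseLaw d)]
  refine measureReal_mono (fun ω _ => ?_) (measure_ne_top _ _)
  -- `M` is the time of the last visit of the origin
  let s := (Finset.range (N + 1)).filter fun t => walk ω t = 0
  have hs : s.Nonempty := ⟨0, by simp [s]⟩
  obtain ⟨M, hM, hmax⟩ : ∃ M ∈ s, ∀ y ∈ s, y ≤ M :=
    ⟨s.max' hs, s.max'_mem hs, fun y => s.le_max' y⟩
  simp only [s, Finset.mem_filter, Finset.mem_range] at hM hmax
  simp only [Set.mem_iUnion]
  refine ⟨M, Finset.mem_range.2 hM.1, hM.2, ?_⟩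
  intro i hi hiN h0
  have h2 : walk ω (M + i) = 0 := by rw [walk_add, h0, hM.2, add_zero]
  have h3 := hmax (M + i) ⟨by omega, h2⟩
  omega

omit [NeZero d] in
lemma noReturn_anti {s t : ℕ} (h : s ≤ t) : noReturn d t ⊆ noReturn d s :=
  fun _ hω i hi his => hω i hi (his.trans h)

/-- The probability of not returning for a time `s` decays at most logarithmically. In the
decomposition by the last visit before the time `(K + 1) s`, the visits after the time `K s`
contribute at most `1 / 2` for a large constant `K`, and the others at most the Green function times
the probability in question. -/
lemma exists_noReturn_ge (hd : 2 ≤ d) :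
    ∃ c : ℝ, 0 < c ∧ ∀ s : ℕ, 1 ≤ s → c / (1 + Real.log s) ≤ (noiseLaw d).real (noReturn d s) := by
  obtain ⟨C, hC, hheat, hgreen⟩ := exists_heat_le_inv hd
  let K : ℕ := ⌈2 * C⌉₊
  have hK : 2 * C ≤ K := Nat.le_ceil _
  have hlogK : 0 ≤ Real.log (K + 1) := Real.log_nonneg (by linarith [K.cast_nonneg (α := ℝ)])
  refine ⟨1 / (2 * C * (1 + Real.log (K + 1))), by positivity, fun s hs => ?_⟩
  have hs' : (1 : ℝ) ≤ s := by exact_mod_cast hs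
  have hlogs : 0 ≤ Real.log s := Real.log_nonneg hs'
  set f := (noiseLaw d).real (noReturn d s) with hf
  have hf0 : 0 ≤ f := measureReal_nonneg
  have h1 := one_le_sum_heat_mul_noReturn (d := d) (K * s + s)
  rw [← Finset.sum_range_add_sum_Ico _ (show K * s + 1 ≤ K * s + s + 1 by omega)] at h1
  have h2 : ∑ t ∈ Finset.range (K * s + 1), heat d t 0 *
      (noiseLaw d).real (noReturn d (K * s + s - t)) ≤ green d (K * s + 1) 0 * f := by
    rw [green, Finset.sum_mul]
    refine Finset.sum_le_sum fun t ht => mul_le_mul_of_nonneg_left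
      (measureReal_mono (noReturn_anti ?_)) (heat_nonneg _ _)
    have := Finset.mem_range.1 ht
    omega
  have h3 : ∑ t ∈ Finset.Ico (K * s + 1) (K * s + s + 1), heat d t 0 *
      (noiseLaw d).real (noReturn d (K * s + s - t)) ≤ 1 / 2 := by
    calc _ ≤ ∑ t ∈ Finset.Ico (K * s + 1) (K * s + s + 1), C / (K * s) := by
          refine Finset.sum_le_sum fun t ht => ?_
          have ht' : K * s ≤ t := by have := (Finset.mem_Ico.1 ht).1; omega
          have ht'' : (K : ℝ) * s ≤ t + 1 := by
            have : ((K * s : ℕ) : ℝ) ≤ t := by exact_mod_cast ht'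
            push_cast at this; linarith
          calc _ ≤ C / (t + 1) * 1 := by
                gcongr
                · exact hheat t 0
                · exact measureReal_le_one
            _ ≤ _ := by
                rw [mul_one]
                have : (0 : ℝ) < K := by linarith
                gcongr
      _ = s * (C / (K * s)) := by
          rw [Finset.sum_const, Nat.card_Ico, nsmul_eq_mul]
          congr 2; omega
      _ ≤ 1 / 2 := by
          have hK0 : (0 : ℝ) < K := by linarith
          have : (s : ℝ) * (C / (K * s)) = C / K := by field_simp
          rw [this, div_le_div_iff₀ hK0 two_pos]; linarith
  have h4 : green d (K * s + 1) 0 ≤ C * (1 + Real.log (K + 1)) * (1 + Real.log s) := by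
    refine (hgreen _).trans ?_
    have h5 : Real.log ((K * s + 1 : ℕ) : ℝ) ≤ Real.log (K + 1) + Real.log s := by
      rw [← Real.log_mul (by positivity) (by positivity)]
      refine Real.log_le_log (by positivity) ?_
      push_cast; nlinarith
    rw [mul_assoc]
    gcongr
    nlinarith
  have h5 : 1 / 2 ≤ C * (1 + Real.log (K + 1)) * (1 + Real.log s) * f := by
    have := mul_le_mul_of_nonneg_right h4 hf0
    linarith
  rw [div_div, div_le_iff₀ (by positivity)]
  linarith

/-- After its first step, a walk that does not return to the origin avoids a neighbour of
its position. -/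
lemma noReturn_succ_le_avoid (e : Step d) (s : ℕ) :
    (noiseLaw d).real (noReturn d (s + 1)) ≤ (noiseLaw d).real (avoid e s) := by
  have h := measure_le_mul_of_glue (isStop_const 1) MeasurableSet.univ
    (detBy_noReturn d (s + 1)).measurableSet (c := (noiseLaw d).real (avoid e s))
    measureReal_nonneg (fun ω ω' h => absurd (Set.mem_univ _) h) ?_
  · simpa using h
  intro ω _
  -- seen from the position after the first step, the origin is the opposite neighbour
  rw [measure_avoid_eq e ((ω 0).1, !(ω 0).2)]
  refine measureReal_mono ?_
  intro ω' hω' i hi h0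
  refine hω' (1 + i) (by omega) (by omega) ?_
  rw [walk_glue_add, h0]
  funext j
  have h1 : walk ω 1 = stepVec (ω 0) := by simp [walk]
  rw [h1]
  simp only [Pi.add_apply, stepVec_apply, Pi.zero_apply]
  cases (ω 0).2 <;> by_cases hj : j = (ω 0).1 <;> simp [hj]

/-- The probability of avoiding a neighbour for a time `s` decays at most logarithmically. -/
lemma exists_avoid_ge (hd : 2 ≤ d) :
    ∃ c : ℝ, 0 < c ∧ ∀ s : ℕ, 1 ≤ s → ∀ e : Step d,
      c / (1 + Real.log s) ≤ (noiseLaw d).real (avoid e s) := by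
  obtain ⟨c, hc, h⟩ := exists_noReturn_ge hd
  refine ⟨c / 2, by positivity, fun s hs e => ?_⟩
  have hs' : (1 : ℝ) ≤ s := by exact_mod_cast hs
  refine le_trans ?_ ((h (s + 1) (by omega)).trans (noReturn_succ_le_avoid e s))
  have h1 : Real.log ((s + 1 : ℕ) : ℝ) ≤ Real.log 2 + Real.log s := by
    rw [← Real.log_mul (by positivity) (by positivity)]
    refine Real.log_le_log (by positivity) ?_
    push_cast; linarith
  have h2 := Real.log_two_lt_d9
  have h3 : 0 ≤ Real.log s := Real.log_nonneg hs'
  have h4 : 0 ≤ Real.log ((s + 1 : ℕ) : ℝ) := Real.log_nonneg (by push_cast; linarith)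
  rw [div_div, div_le_div_iff₀ (by positivity) (by positivity)]
  nlinarith

/-- If an event of the past forces a conditional probability at least `c`, the probability is at
least `c` times that of the event of the past. -/
lemma mul_measure_le_of_glue {τ : Noise d → ℕ} (hτ : IsStop τ) {A E : Set (Noise d)}
    (hA : MeasurableSet A) (hE : MeasurableSet E) {c : ℝ} (hc : 0 ≤ c)
    (h : ∀ ω ∈ A, c ≤ (noiseLaw d).real {ω' | glue (τ ω) ω ω' ∈ E}) :
    c * (noiseLaw d).real A ≤ (noiseLaw d).real E := by
  have h1 : ENNReal.ofReal c * noiseLaw d A ≤ noiseLaw d E := by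
    rw [lintegral_glue hτ hE, ← lintegral_indicator_const hA]
    refine lintegral_mono fun ω => ?_
    by_cases hω : ω ∈ A
    · rw [Set.indicator_of_mem hω]
      exact ENNReal.ofReal_le_iff_le_toReal (measure_ne_top _ _) |>.2 (h ω hω)
    · rw [Set.indicator_of_notMem hω]; exact zero_le
  have := ENNReal.toReal_mono (by finiteness) h1
  rwa [ENNReal.toReal_mul, ENNReal.toReal_ofReal hc] at this

/-- The walk visits `z` before time `N`. -/
def hits (z : Fin d → ℤ) (N : ℕ) : Set (Noise d) := {ω | ∃ t < N, walk ω t = z}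

omit [NeZero d] in
lemma detBy_hits (z : Fin d → ℤ) (N : ℕ) : DetBy N (hits z N) := by
  rintro ω ω' h ⟨t, ht, hz⟩
  exact ⟨t, ht, by rw [walk_congr fun j hj => h j (hj.trans ht), hz]⟩

/-- Once the walk has hit `z`, it makes as many visits to `z` on average as the Green function at
the origin tells. -/
lemma measure_hits_mul_green_le (z : Fin d → ℤ) (N : ℕ) :
    (noiseLaw d).real (hits z N) * green d N 0 ≤ green d (2 * N) z := by
  let P : ℕ → Set (Noise d) := fun t => {ω | walk ω t = z}
  have hP : ∀ t, DetBy t (P t) := fun t => detBy_walk_eq le_rfl z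
  let τ := firstTime P N
  have hτ : IsStop τ := isStop_firstTime hP N
  have hmem : ∀ ω ∈ hits z N, walk ω (τ ω) = z ∧ τ ω < N := by
    rintro ω ⟨t, ht, hz⟩
    exact ⟨mem_firstTime (P := P) hz ht.le, (firstTime_le_of_mem (P := P) hz).trans_lt ht⟩
  -- `τ` is the hitting time of `z`, and `E j` the event that `z` is visited again at time `τ + j`
  let E : ℕ → Set (Noise d) := fun j => {ω | ∃ t < N, τ ω = t ∧ walk ω (t + j) = z}
  have hE : ∀ j, MeasurableSet (E j) := by
    intro j
    have : E j = ⋃ t ∈ Finset.range N, ({ω | τ ω = t} ∩ {ω | walk ω (t + j) = z}) := by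
      ext ω; simp [E]
    rw [this]
    exact Finset.measurableSet_biUnion _ fun t _ =>
      (hτ.detBy_eq t).measurableSet.inter (measurableSet_walk_eq _ _)
  have h1 : ∀ j, heat d j 0 * (noiseLaw d).real (hits z N) ≤ (noiseLaw d).real (E j) := by
    intro j
    refine mul_measure_le_of_glue hτ (detBy_hits z N).measurableSet (hE j) (heat_nonneg _ _) ?_
    intro ω hω
    refine measureReal_mono ?_
    intro ω' hω'
    refine ⟨τ ω, (hmem ω hω).2, hτ.glue_eq ω ω', ?_⟩
    rw [walk_glue_add, (hmem ω hω).1, show walk ω' j = 0 from hω', add_zero]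
  have h2 : ∀ j, (noiseLaw d).real (E j) = ∑ t ∈ Finset.range N,
      (noiseLaw d).real ({ω | τ ω = t} ∩ {ω | walk ω (t + j) = z}) := by
    intro j
    have : E j = ⋃ t ∈ Finset.range N, ({ω | τ ω = t} ∩ {ω | walk ω (t + j) = z}) := by
      ext ω; simp [E]
    rw [this, measureReal_biUnion_finset]
    · intro s _ t _ hst
      refine Set.disjoint_left.2 fun ω h3 h4 => hst ?_
      exact (show τ ω = s from h3.1).symm.trans h4.1
    · exact fun t _ => (hτ.detBy_eq t).measurableSet.inter (measurableSet_walk_eq _ _)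
  calc (noiseLaw d).real (hits z N) * green d N 0
      = ∑ j ∈ Finset.range N, heat d j 0 * (noiseLaw d).real (hits z N) := by
        rw [green, mul_comm, Finset.sum_mul]
    _ ≤ ∑ j ∈ Finset.range N, ∑ t ∈ Finset.range N,
        (noiseLaw d).real ({ω | τ ω = t} ∩ {ω | walk ω (t + j) = z}) :=
        Finset.sum_le_sum fun j _ => (h1 j).trans_eq (h2 j)
    _ = ∑ t ∈ Finset.range N, ∑ j ∈ Finset.range N,
        (noiseLaw d).real ({ω | τ ω = t} ∩ {ω | walk ω (t + j) = z}) := Finset.sum_comm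
    _ ≤ ∑ t ∈ Finset.range N, ∑ s ∈ Finset.range (2 * N),
        (noiseLaw d).real ({ω | τ ω = t} ∩ {ω | walk ω s = z}) := by
        refine Finset.sum_le_sum fun t ht => ?_
        have ht := Finset.mem_range.1 ht
        rw [← Finset.sum_image (s := Finset.range N) (g := fun j => t + j)
          (f := fun s => (noiseLaw d).real ({ω | τ ω = t} ∩ {ω | walk ω s = z}))
          (fun a _ b _ h => by simpa using h)]
        refine Finset.sum_le_sum_of_subset_of_nonneg ?_ fun _ _ _ => measureReal_nonneg
        intro s hs
        obtain ⟨j, hj, rfl⟩ := Finset.mem_image.1 hs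
        have := Finset.mem_range.1 hj
        exact Finset.mem_range.2 (by omega)
    _ = ∑ s ∈ Finset.range (2 * N), ∑ t ∈ Finset.range N,
        (noiseLaw d).real ({ω | τ ω = t} ∩ {ω | walk ω s = z}) := Finset.sum_comm
    _ ≤ green d (2 * N) z := by
        refine Finset.sum_le_sum fun s _ => ?_
        rw [← measureReal_biUnion_finset]
        · refine measureReal_mono ?_
          intro ω hω
          simp only [Set.mem_iUnion] at hω
          exact hω.choose_spec.2.2
        · intro a _ b _ hab
          refine Set.disjoint_left.2 fun ω h3 h4 => hab ?_
          exact (show τ ω = a from h3.1).symm.trans h4.1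
        · exact fun t _ => (hτ.detBy_eq t).measurableSet.inter (measurableSet_walk_eq _ _)

end Estimates

section

variable [NeZero d]

/-- In dimension two, the Green function at distance `M`: the times before `M ^ 2` contribute a
constant by the off-diagonal bound, the later ones at most `1 / t` each. -/
lemma green_two_dim_far_le (hd : d = 2) :
    ∃ C : ℝ, 0 < C ∧ ∀ (M N : ℕ) (z : Fin d → ℤ), 1 ≤ M → M ^ 2 ≤ N →
      (∃ i, (M : ℤ) ≤ |z i|) → green d N z ≤ C * (1 + Real.log N - 2 * Real.log M) := by
  obtain ⟨C, hC, hheat, hfar⟩ := exists_heat_far_le d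
  refine ⟨C, by linarith, fun M N z hM hN ⟨i, hi⟩ => ?_⟩
  have hM0 : (0 : ℝ) < M := by exact_mod_cast hM
  have hsq : ∀ t : ℕ, √((t : ℝ) + 1) ^ d = (t : ℝ) + 1 := fun t => by
    rw [hd, Real.sq_sqrt (by positivity)]
  have hi' : (M : ℝ) ≤ |(z i : ℝ)| := by exact_mod_cast hi
  rw [green, ← Finset.sum_range_add_sum_Ico _ hN]
  have h1 : ∑ t ∈ Finset.range (M ^ 2), heat d t z ≤ C := by
    calc _ ≤ ∑ t ∈ Finset.range (M ^ 2), C / (M : ℝ) ^ 2 := by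
          refine Finset.sum_le_sum fun t _ => (hfar t z M hM0 ⟨i, hi'⟩).trans_eq ?_
          rw [hsq]; field_simp
      _ = C := by
          rw [Finset.sum_const, Finset.card_range, nsmul_eq_mul]
          push_cast; field_simp
  have h2 : ∑ t ∈ Finset.Ico (M ^ 2) N, heat d t z ≤
      C * (Real.log N - 2 * Real.log M) := by
    calc _ ≤ ∑ t ∈ Finset.Ico (M ^ 2) N, C * (1 / ((t : ℝ) + 1)) := by
          refine Finset.sum_le_sum fun t _ => (hheat t z).trans_eq ?_
          rw [hsq]; ring
      _ ≤ C * (Real.log N - Real.log ((M ^ 2 : ℕ) : ℝ)) := by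
          rw [← Finset.mul_sum]
          gcongr
          exact sum_Ico_inv_le (Nat.one_le_pow _ _ hM) hN
      _ = _ := by push_cast; rw [Real.log_pow]; push_cast; ring
  linarith

/-- In dimension at least three the Green function decays with the distance, up to a logarithm
(which loses powers of the distance, but is enough at the scales considered). -/
lemma green_transient_far_le (hd : 3 ≤ d) :
    ∃ C : ℝ, 0 < C ∧ ∀ (M N : ℕ) (z : Fin d → ℤ), 1 ≤ M →
      (∃ i, (M : ℤ) ≤ |z i|) → green d N z ≤ C * (1 + Real.log N) / M := by
  obtain ⟨C, hC, hheat, hfar⟩ := exists_heat_far_le d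
  refine ⟨C, by linarith, fun M N z hM ⟨i, hi⟩ => ?_⟩
  have hM0 : (0 : ℝ) < M := by exact_mod_cast hM
  have hi' : (M : ℝ) ≤ |(z i : ℝ)| := by exact_mod_cast hi
  have hterm : ∀ t : ℕ, heat d t z ≤ C / M * (1 / ((t : ℝ) + 1)) := by
    intro t
    set u := √((t : ℝ) + 1) with hu
    have hu2 : (t : ℝ) + 1 = u ^ 2 := (Real.sq_sqrt (by positivity)).symm
    have hu1 : 1 ≤ u := by rw [hu, Real.one_le_sqrt]; linarith [t.cast_nonneg (α := ℝ)]
    have hud : u ^ 3 ≤ u ^ d := pow_le_pow_right₀ hu1 hd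
    have hu0 : 0 < u := by linarith
    rw [hu2]
    rcases le_total u M with h | h
    · refine (hfar t z M hM0 ⟨i, hi'⟩).trans ?_
      rw [← hu, hu2]
      calc C * (u ^ 2 / M ^ 2) / u ^ d ≤ C * (u ^ 2 / M ^ 2) / u ^ 3 := by gcongr
        _ = C / M * (u / M * (1 / u ^ 2)) := by field_simp
        _ ≤ C / M * (1 * (1 / u ^ 2)) := by
            gcongr
            rw [div_le_one hM0]; exact h
        _ = _ := by rw [one_mul]
    · refine (hheat t z).trans ?_
      rw [← hu]
      calc C / u ^ d ≤ C / u ^ 3 := by gcongr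
        _ = C / u * (1 / u ^ 2) := by field_simp
        _ ≤ _ := by gcongr
  calc green d N z ≤ ∑ t ∈ Finset.range N, C / M * (1 / ((t : ℝ) + 1)) :=
        Finset.sum_le_sum fun t _ => hterm t
    _ = C / M * harmonic N := by rw [harmonic_eq_sum, Finset.mul_sum]
    _ ≤ C / M * (1 + Real.log N) := by gcongr; exact harmonic_le_one_add_log N
    _ = _ := by ring

lemma sq_le_two_pow_succ (n : ℕ) : n ^ 2 ≤ 2 ^ (n + 1) := by
  induction n with
  | zero => simp
  | succ n ih =>
    rcases Nat.lt_or_ge n 3 with h | h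
    · interval_cases n <;> norm_num
    · rw [pow_succ 2]; nlinarith

/-- From a distance `2 ^ l ^ 2`, a point is hit before the time `2 ^ (d * l ^ 2 + O(l))` only with
a probability of order `1 / l`. -/
lemma exists_hits_le (hd : 2 ≤ d) (a : ℕ) :
    ∃ K : ℝ, 0 < K ∧ ∀ l : ℕ, 1 ≤ l → ∀ z : Fin d → ℤ, (∃ i, (2 : ℤ) ^ l ^ 2 ≤ |z i|) →
      (noiseLaw d).real (hits z (2 ^ (d * (l + 1) ^ 2 + a * (l + 1) + 1))) ≤ K / l := by
  have hlog2 : Real.log 2 ≤ 1 := by linarith [Real.log_two_lt_d9]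
  have hlog2' : 1 / 2 ≤ Real.log 2 := by linarith [Real.log_two_gt_d9]
  -- In dimension two the Green function up to `2 ^ (2 l² + O(l))` is of order `l` at the distance
  -- `2 ^ l²` and of order `l²` at the origin; in higher dimensions it is tiny at that distance.
  rcases Nat.eq_or_lt_of_le hd with hd2 | hd3
  · obtain ⟨C, hC, h⟩ := green_two_dim_far_le hd2.symm
    refine ⟨C * (12 + 2 * a) * 72, by positivity, fun l hl z hz => ?_⟩
    have hl' : (1 : ℝ) ≤ l := by exact_mod_cast hl
    have ha : (0 : ℝ) ≤ a := a.cast_nonneg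
    set e := d * (l + 1) ^ 2 + a * (l + 1) with he
    have h1 := measure_hits_mul_green_le z (2 ^ (e + 1))
    have h2 := h (2 ^ l ^ 2) (2 * 2 ^ (e + 1)) z Nat.one_le_two_pow (by
      rw [← pow_mul, ← pow_succ']
      exact Nat.pow_le_pow_right two_pos (by rw [he, ← hd2]; nlinarith)) (by exact_mod_cast hz)
    have h3 : Real.log ((2 * 2 ^ (e + 1) : ℕ) : ℝ) = (e + 2 : ℝ) * Real.log 2 := by
      rw [← pow_succ']; push_cast; rw [Real.log_pow]; push_cast; ring
    have h4 : Real.log ((2 ^ l ^ 2 : ℕ) : ℝ) = (l : ℝ) ^ 2 * Real.log 2 := by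
      push_cast; rw [Real.log_pow]; push_cast; ring
    have he' : (e : ℝ) = 2 * (l + 1) ^ 2 + a * (l + 1) := by rw [he, ← hd2]; push_cast; ring
    have h5 : green d (2 * 2 ^ (e + 1)) z ≤ C * ((12 + 2 * a) * l) := by
      refine h2.trans ?_
      rw [h3, h4, he']
      gcongr
      nlinarith [mul_nonneg ha (sub_nonneg.2 hl')]
    have h6 : (l : ℝ) ^ 2 / 72 ≤ green d (2 ^ (e + 1)) 0 := by
      have h7 := green_two_dim_ge hd2.symm (2 ^ e)
      rw [← pow_succ'] at h7
      refine le_trans ?_ h7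
      have h8 : (e : ℝ) * Real.log 2 ≤ Real.log ((2 ^ e : ℕ) + 1 : ℝ) := by
        rw [← Real.log_pow]
        exact Real.log_le_log (by positivity) (by push_cast; linarith)
      have h9 : (l : ℝ) ^ 2 ≤ e * Real.log 2 := by
        have : (2 : ℝ) * l ^ 2 ≤ e := by rw [he']; nlinarith
        nlinarith
      gcongr
      exact h9.trans h8
    have h7 : (noiseLaw d).real (hits z (2 ^ (e + 1))) * ((l : ℝ) ^ 2 / 72) ≤
        C * ((12 + 2 * a) * l) :=
      (mul_le_mul_of_nonneg_left h6 measureReal_nonneg).trans (h1.trans h5)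
    rw [le_div_iff₀ (by positivity)]
    have h8 : (noiseLaw d).real (hits z (2 ^ (e + 1))) * l * (l / 72) ≤
        C * (12 + 2 * a) * 72 * (l / 72) := by linarith
    exact le_of_mul_le_mul_right h8 (by positivity)
  · obtain ⟨C, hC, h⟩ := green_transient_far_le (d := d) hd3
    refine ⟨C * (1 + (4 * d + 2 * a + 2)) * 2, by positivity, fun l hl z hz => ?_⟩
    have hl' : (1 : ℝ) ≤ l := by exact_mod_cast hl
    have ha : (0 : ℝ) ≤ a := a.cast_nonneg
    have hd0 : (0 : ℝ) ≤ d := d.cast_nonneg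
    set e := d * (l + 1) ^ 2 + a * (l + 1) with he
    have h1 := measure_hits_mul_green_le z (2 ^ (e + 1))
    have h2 := h (2 ^ l ^ 2) (2 * 2 ^ (e + 1)) z Nat.one_le_two_pow (by exact_mod_cast hz)
    have h3 : Real.log ((2 * 2 ^ (e + 1) : ℕ) : ℝ) = (e + 2 : ℝ) * Real.log 2 := by
      rw [← pow_succ']; push_cast; rw [Real.log_pow]; push_cast; ring
    have he' : (e : ℝ) = d * (l + 1) ^ 2 + a * (l + 1) := by rw [he]; push_cast; ring
    have hl2 : (l : ℝ) ≤ l ^ 2 := by nlinarith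
    have h4 : 1 + Real.log ((2 * 2 ^ (e + 1) : ℕ) : ℝ) ≤ (1 + (4 * d + 2 * a + 2)) * l ^ 2 := by
      rw [h3]
      have h5 : (e + 2 : ℝ) * Real.log 2 ≤ e + 2 := by
        have : (0 : ℝ) ≤ e := e.cast_nonneg
        nlinarith
      have h6 : ((l : ℝ) + 1) ^ 2 ≤ 4 * l ^ 2 := by nlinarith
      have h7 : (l : ℝ) + 1 ≤ 2 * l ^ 2 := by nlinarith
      have h8 := mul_le_mul_of_nonneg_left h6 hd0
      have h9 := mul_le_mul_of_nonneg_left h7 ha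
      nlinarith
    have h5 : (noiseLaw d).real (hits z (2 ^ (e + 1))) ≤ green d (2 * 2 ^ (e + 1)) z := by
      refine le_trans ?_ h1
      exact le_mul_of_one_le_right measureReal_nonneg (one_le_green Nat.one_le_two_pow)
    have h6 : (l : ℝ) ^ 2 * l ≤ 2 * 2 ^ l ^ 2 := by
      have := sq_le_two_pow_succ (l ^ 2)
      have h7 : ((l : ℝ) ^ 2) ^ 2 ≤ 2 ^ (l ^ 2 + 1) := by exact_mod_cast this
      rw [pow_succ' (2 : ℝ)] at h7
      have h8 := mul_le_mul_of_nonneg_left hl2 (sq_nonneg (l : ℝ))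
      linarith [sq ((l : ℝ) ^ 2)]
    refine (h5.trans h2).trans ?_
    push_cast
    rw [div_le_div_iff₀ (by positivity) (by positivity)]
    push_cast at h4
    calc C * (1 + Real.log (2 * 2 ^ (e + 1))) * l
        ≤ C * ((1 + (4 * d + 2 * a + 2)) * l ^ 2) * l := by gcongr
      _ = C * (1 + (4 * d + 2 * a + 2)) * (l ^ 2 * l) := by ring
      _ ≤ C * (1 + (4 * d + 2 * a + 2)) * (2 * 2 ^ l ^ 2) := by gcongr
      _ = _ := by ring

omit [NeZero d] in
/-- Cauchy–Schwarz: a path with few self-intersections has a large range. -/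
lemma sq_le_card_pathRange_mul (s : ℕ → Fin d → ℤ) (N : ℕ) :
    (N + 1) ^ 2 ≤ (pathRange s N).card *
      ((Finset.range (N + 1) ×ˢ Finset.range (N + 1)).filter fun p => s p.1 = s p.2).card := by
  have h1 : N + 1 = ∑ x ∈ pathRange s N, visits s N x := by
    have := Finset.card_eq_sum_card_image s (Finset.range (N + 1))
    rwa [Finset.card_range] at this
  have h2 : ((Finset.range (N + 1) ×ˢ Finset.range (N + 1)).filter fun p => s p.1 = s p.2).card =
      ∑ x ∈ pathRange s N, visits s N x ^ 2 := by
    rw [Finset.card_eq_sum_card_fiberwise (f := fun p => s p.1) (t := pathRange s N)]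
    · refine Finset.sum_congr rfl fun x _ => ?_
      rw [sq, visits, ← Finset.card_product]
      congr 1
      ext p
      simp only [Finset.mem_filter, Finset.mem_product]
      constructor
      · rintro ⟨⟨⟨h3, h4⟩, h5⟩, h6⟩
        exact ⟨⟨h3, h6⟩, h4, h5.symm.trans h6⟩
      · rintro ⟨⟨h3, h6⟩, h4, h5⟩
        exact ⟨⟨⟨h3, h4⟩, h6.trans h5.symm⟩, h6⟩
    · intro p hp
      simp only [Finset.coe_filter, Finset.mem_product, Set.mem_ofPred_eq] at hp
      exact Finset.mem_coe.2 (Finset.mem_image_of_mem s hp.1.1)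
  rw [h2]
  calc (N + 1) ^ 2 = (∑ x ∈ pathRange s N, visits s N x) ^ 2 := by rw [← h1]
    _ ≤ _ := sq_sum_le_card_mul_sum_sq

lemma measure_walk_eq_walk (i j : ℕ) :
    (noiseLaw d).real {ω | walk ω i = walk ω (i + j)} = heat d j 0 := by
  rw [heat, ← measureReal_shift (n := i) (measurableSet_walk_eq j 0)]
  congr 1
  ext ω
  simp [walk_add]

/-- The range up to time `N` is unlikely to be much smaller than `N`. -/
lemma measure_range_small_le (N : ℕ) {a : ℝ} (ha : 0 < a) :
    (noiseLaw d).real {ω | (pathRange (walk ω) N).card * a < ((N : ℝ) + 1) ^ 2} ≤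
      2 * (N + 1) * green d (N + 1) 0 / a := by
  -- Markov's inequality for the number of pairs of times with the same position
  let pairs : Noise d → Finset (ℕ × ℕ) := fun ω =>
    (Finset.range (N + 1) ×ˢ Finset.range (N + 1)).filter fun p => walk ω p.1 = walk ω p.2
  have hdet : ∀ ω ω' : Noise d, (∀ i < N, ω' i = ω i) → ((pairs ω').card : ℝ) = (pairs ω).card := by
    intro ω ω' h
    congr 2
    refine Finset.filter_congr fun p hp => ?_
    have hp := Finset.mem_product.1 hp
    have h1 := Finset.mem_range.1 hp.1
    have h2 := Finset.mem_range.1 hp.2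
    rw [walk_congr fun j hj => h j (by omega), walk_congr fun j hj => h j (by omega)]
  have hint := integrable_of_detBy (n := N) hdet
  have hexp : ∫ ω, ((pairs ω).card : ℝ) ∂(noiseLaw d) ≤ 2 * (N + 1) * green d (N + 1) 0 := by
    have h1 : ∀ ω, ((pairs ω).card : ℝ) = ∑ i ∈ Finset.range (N + 1), ∑ j ∈ Finset.range (N + 1),
        Set.indicator {ω | walk ω i = walk ω j} (fun _ => (1 : ℝ)) ω := by
      intro ω
      rw [← Finset.sum_product', Finset.card_filter]
      push_cast
      refine Finset.sum_congr rfl fun p _ => ?_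
      simp [Set.indicator_apply]
    have hm : ∀ i j, MeasurableSet {ω : Noise d | walk ω i = walk ω j} := fun i j =>
      measurableSet_eq_fun (measurable_walk i) (measurable_walk j)
    have hI : ∀ i j, Integrable (Set.indicator {ω : Noise d | walk ω i = walk ω j}
        (fun _ => (1 : ℝ))) (noiseLaw d) := fun i j => (integrable_const _).indicator (hm i j)
    simp only [h1]
    rw [integral_finsetSum _ fun i _ => integrable_finsetSum _ fun j _ => hI i j]
    have h2 : ∀ i ∈ Finset.range (N + 1), ∫ ω, ∑ j ∈ Finset.range (N + 1),
        Set.indicator {ω | walk ω i = walk ω j} (fun _ => (1 : ℝ)) ω ∂(noiseLaw d) ≤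
        2 * green d (N + 1) 0 := by
      intro i hi
      have hi := Finset.mem_range.1 hi
      rw [integral_finsetSum _ fun j _ => hI i j]
      simp only [integral_indicator_const _ (hm _ _), smul_eq_mul, mul_one]
      rw [← Finset.sum_range_add_sum_Ico _ hi.le, two_mul]
      refine add_le_add ?_ ?_
      · have h3 : ∀ j ∈ Finset.range i, (noiseLaw d).real {ω | walk ω i = walk ω j} =
            heat d (i - j) 0 := by
          intro j hj
          have hj := Finset.mem_range.1 hj
          rw [← measure_walk_eq_walk j (i - j)]
          congr 1
          ext ω
          rw [show j + (i - j) = i by omega]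
          exact eq_comm
        rw [Finset.sum_congr rfl h3, green]
        rw [← Finset.sum_image (s := Finset.range i) (g := fun j => i - j)
          (f := fun j => heat d j 0) (fun a ha b hb h => by
            have := Finset.mem_range.1 (Finset.mem_coe.1 ha)
            have := Finset.mem_range.1 (Finset.mem_coe.1 hb)
            simp only at h; omega)]
        refine Finset.sum_le_sum_of_subset_of_nonneg ?_ fun _ _ _ => heat_nonneg _ _
        intro s hs
        obtain ⟨j, _, rfl⟩ := Finset.mem_image.1 hs
        exact Finset.mem_range.2 (by omega)
      · rw [Finset.sum_Ico_eq_sum_range, green]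
        simp only [measure_walk_eq_walk]
        refine Finset.sum_le_sum_of_subset_of_nonneg ?_ fun _ _ _ => heat_nonneg _ _
        exact Finset.range_subset_range.2 (by omega)
    refine (Finset.sum_le_sum h2).trans_eq ?_
    rw [Finset.sum_const, Finset.card_range, nsmul_eq_mul]
    push_cast; ring
  have hmk := mul_meas_ge_le_integral_of_nonneg (μ := noiseLaw d)
    (f := fun ω => ((pairs ω).card : ℝ)) (ae_of_all _ fun ω => Nat.cast_nonneg _) hint a
  rw [le_div_iff₀ ha, mul_comm]
  refine le_trans (mul_le_mul_of_nonneg_left (measureReal_mono ?_) ha.le) (hmk.trans hexp)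
  intro ω hω
  change a ≤ ((pairs ω).card : ℝ)
  have hω : (pathRange (walk ω) N).card * a < ((N : ℝ) + 1) ^ 2 := hω
  have h1 : ((N : ℝ) + 1) ^ 2 ≤ (pathRange (walk ω) N).card * ((pairs ω).card : ℝ) := by
    exact_mod_cast sq_le_card_pathRange_mul (walk ω) N
  exact (lt_of_mul_lt_mul_left (hω.trans_le h1) (Nat.cast_nonneg _)).le

end

/-! ### Successive returns to the origin -/

/-- The walk returns to the origin for the first time at time `m`, and has not visited the
neighbour `e` before. -/
def firstReturn (e : Step d) (m : ℕ) : Set (Noise d) :=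
  {ω | 1 ≤ m ∧ walk ω m = 0 ∧ ∀ i, 1 ≤ i → i < m → walk ω i ≠ 0 ∧ walk ω i ≠ stepVec e}

/-- The walk returns to the origin before it visits the neighbour `e`, and the time of the return
belongs to `I`. -/
def returns (I : Set ℕ) (e : Step d) : Set (Noise d) := ⋃ m ∈ I, firstReturn e m

/-- The walk makes `k` successive returns to the origin before it visits the neighbour `e`, each of
them after a time in `I`, and the walk after the last of them belongs to `F`. -/
def multiReturn (I : Set ℕ) (e : Step d) (F : Set (Noise d)) : ℕ → Set (Noise d)
  | 0 => F
  | k + 1 => ⋃ m ∈ I, firstReturn e m ∩ shift m ⁻¹' multiReturn I e F k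

lemma detBy_firstReturn (e : Step d) (m : ℕ) : DetBy m (firstReturn e m) := by
  rintro ω ω' h ⟨h1, h2, h3⟩
  refine ⟨h1, by rw [walk_congr h, h2], fun i hi him => ?_⟩
  rw [walk_congr fun j hj => h j (hj.trans him)]
  exact h3 i hi him

lemma firstReturn_disjoint (e : Step d) {m n : ℕ} (h : m ≠ n) :
    Disjoint (firstReturn e m) (firstReturn e n) := by
  refine Set.disjoint_left.2 fun ω h1 h2 => ?_
  rcases lt_or_gt_of_ne h with h3 | h3
  · exact (h2.2.2 m h1.1 h3).1 h1.2.1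
  · exact (h1.2.2 n h2.1 h3).1 h2.2.1

lemma measurableSet_returns (I : Set ℕ) (e : Step d) : MeasurableSet (returns I e) :=
  MeasurableSet.biUnion I.to_countable fun m _ => (detBy_firstReturn e m).measurableSet

lemma measurableSet_multiReturn (I : Set ℕ) (e : Step d) {F : Set (Noise d)}
    (hF : MeasurableSet F) (k : ℕ) : MeasurableSet (multiReturn I e F k) := by
  induction k with
  | zero => exact hF
  | succ k ih =>
    exact MeasurableSet.biUnion I.to_countable fun m _ =>
      (detBy_firstReturn e m).measurableSet.inter (measurable_shift m ih)

lemma detBy_multiReturn (L : ℕ) (e : Step d) (k : ℕ) :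
    DetBy (k * L) (multiReturn (Set.Iic L) e Set.univ k) := by
  induction k with
  | zero => exact fun _ _ _ _ => Set.mem_univ _
  | succ k ih =>
    intro ω ω' h hω
    simp only [multiReturn, Set.mem_iUnion] at hω ⊢
    obtain ⟨m, hm, h1, h2⟩ := hω
    have hm' : m ≤ L := hm
    refine ⟨m, hm, detBy_firstReturn e m ω ω' (fun i hi => h i ?_) h1, ?_⟩
    · nlinarith
    · refine ih _ _ (fun i hi => h (m + i) ?_) h2
      nlinarith

lemma multiReturn_mono (I : Set ℕ) (e : Step d) {F G : Set (Noise d)} (h : F ⊆ G) (k : ℕ) :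
    multiReturn I e F k ⊆ multiReturn I e G k := by
  induction k with
  | zero => exact h
  | succ k ih =>
    exact Set.iUnion₂_mono fun m _ => Set.inter_subset_inter_right _ (Set.preimage_mono ih)

section Measure

variable [NeZero d]

lemma measure_returns_shift (I : Set ℕ) (e : Step d) {G : Set (Noise d)} (hG : MeasurableSet G) :
    noiseLaw d (⋃ m ∈ I, firstReturn e m ∩ shift m ⁻¹' G) =
      noiseLaw d (returns I e) * noiseLaw d G := by
  rw [returns, measure_biUnion I.to_countable, measure_biUnion I.to_countable,
    ← ENNReal.tsum_mul_right]
  · exact tsum_congr fun m => measure_inter_shift (detBy_firstReturn e m) hG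
  · exact fun m _ n _ h => firstReturn_disjoint e h
  · exact fun m _ => (detBy_firstReturn e m).measurableSet
  · exact fun m _ n _ h => (firstReturn_disjoint e h).mono Set.inter_subset_left
      Set.inter_subset_left
  · exact fun m _ => (detBy_firstReturn e m).measurableSet.inter (measurable_shift m hG)

lemma measure_multiReturn (I : Set ℕ) (e : Step d) {F : Set (Noise d)} (hF : MeasurableSet F)
    (k : ℕ) : (noiseLaw d).real (multiReturn I e F k) =
      (noiseLaw d).real (returns I e) ^ k * (noiseLaw d).real F := by
  induction k with
  | zero => simp [multiReturn]
  | succ k ih =>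
    rw [multiReturn, measureReal_def,
      measure_returns_shift I e (measurableSet_multiReturn I e hF k), ENNReal.toReal_mul]
    change (noiseLaw d).real _ * (noiseLaw d).real _ = _
    rw [ih]; ring

lemma measure_returns_eq (I : Set ℕ) (e e' : Step d) :
    (noiseLaw d).real (returns I e) = (noiseLaw d).real (returns I e') := by
  obtain ⟨g, A, hA, hg, rfl⟩ := exists_symmetry e e'
  rw [← measureReal_map_step g (measurableSet_returns I (g e))]
  congr 1
  ext ω
  simp only [returns, Set.mem_iUnion, firstReturn, Set.mem_ofPred_eq, walk_map_step hg, hg, ne_eq,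
    hA.eq_iff, map_eq_zero_iff A hA]

lemma measure_step_eq (e : Step d) :
    (noiseLaw d).real {ω | ω 0 = e} = (2 * d : ℝ)⁻¹ := by
  have h := (measurePreserving_eval_infinitePi (fun _ : ℕ => stepLaw d) 0).measure_preimage
    (measurableSet_singleton e).nullMeasurableSet
  have h2 : noiseLaw d {ω | ω 0 = e} = stepLaw d {e} := h
  rw [measureReal_def, h2, measure_stepLaw_singleton]
  simp

/-- The probability that the walk returns to the origin before it visits a given neighbour. -/
def returnProb (d : ℕ) [NeZero d] : ℝ := (noiseLaw d).real (returns Set.univ ((0, true) : Step d))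

lemma measure_returns_univ (e : Step d) :
    (noiseLaw d).real (returns Set.univ e) = returnProb d :=
  measure_returns_eq _ _ _

lemma returnProb_pos : 0 < returnProb d := by
  have hd : (0 : ℝ) < d := Nat.cast_pos.2 (Nat.pos_of_ne_zero (NeZero.ne d))
  have h0 : DetBy 1 {ω : Noise d | ω 0 = (0, false)} := by
    intro ω ω' h hω
    change ω' 0 = _
    rw [h 0 one_pos]; exact hω
  have h1 : DetBy 1 {ω : Noise d | ω 0 = (0, true)} := by
    intro ω ω' h hω
    change ω' 0 = _
    rw [h 0 one_pos]; exact hω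
  have h2 : (noiseLaw d).real ({ω | ω 0 = (0, false)} ∩ shift 1 ⁻¹' {ω | ω 0 = (0, true)}) =
      (2 * d : ℝ)⁻¹ * (2 * d : ℝ)⁻¹ := by
    rw [measureReal_inter_shift h0 h1.measurableSet, measure_step_eq, measure_step_eq]
  -- the event of a step in the direction opposite to the neighbour, followed by a step back
  have h3 : (0 : ℝ) < (2 * d : ℝ)⁻¹ * (2 * d : ℝ)⁻¹ := by positivity
  rw [← h2] at h3
  refine h3.trans_le (measureReal_mono ?_)
  rintro ω ⟨h4, h5⟩
  have h4 : ω 0 = (0, false) := h4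
  have h5 : ω 1 = (0, true) := h5
  simp only [returns, Set.mem_iUnion]
  have hne : stepVec ((0, false) : Step d) ≠ stepVec (0, true) := by
    intro h; simpa using stepVec_injective h
  have hw1 : walk ω 1 = stepVec (0, false) := by simp [walk, h4]
  refine ⟨2, Set.mem_univ _, by norm_num, ?_, ?_⟩
  · rw [walk_succ, hw1, h5]
    funext j
    simp only [Pi.add_apply, stepVec_apply, Pi.zero_apply]
    by_cases hj : j = 0 <;> simp [hj]
  · intro i hi hi2
    have : i = 1 := by omega
    subst this
    rw [hw1]
    exact ⟨stepVec_ne_zero _, hne⟩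

lemma returnProb_lt_one : returnProb d < 1 := by
  have hd : (0 : ℝ) < d := Nat.cast_pos.2 (Nat.pos_of_ne_zero (NeZero.ne d))
  have h : returns Set.univ ((0, true) : Step d) ⊆ {ω | ω 0 = (0, true)}ᶜ := by
    intro ω hω h0
    have h0 : ω 0 = (0, true) := h0
    have hw1 : walk ω 1 = stepVec (0, true) := by simp [walk, h0]
    simp only [returns, Set.mem_iUnion] at hω
    obtain ⟨m, _, h1, h2, h3⟩ := hω
    rcases Nat.eq_or_lt_of_le h1 with rfl | h4
    · exact stepVec_ne_zero _ (hw1.symm.trans h2)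
    · exact (h3 1 le_rfl h4).2 hw1
  have hm : MeasurableSet {ω : Noise d | ω 0 = (0, true)} :=
    (measurable_pi_apply 0) (measurableSet_singleton _)
  have h2 := measureReal_mono (μ := noiseLaw d) h
  rw [probReal_compl_eq_one_sub hm, measure_step_eq] at h2
  have h3 : (0 : ℝ) < (2 * d : ℝ)⁻¹ := by positivity
  exact h2.trans_lt (by linarith)

/-- Returns that happen within a bounded time carry almost all of the return probability. -/
lemma exists_returns_Iic_gt {r : ℝ} (hr : r < returnProb d) :
    ∃ L : ℕ, ∀ e : Step d, r < (noiseLaw d).real (returns (Set.Iic L) e) := by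
  have hmono : Monotone fun L : ℕ => returns (Set.Iic L) ((0, true) : Step d) := fun a b hab =>
    Set.biUnion_subset_biUnion_left (Set.Iic_subset_Iic.2 hab)
  have hU : ⋃ L : ℕ, returns (Set.Iic L) ((0, true) : Step d) = returns Set.univ (0, true) := by
    ext ω
    simp only [returns, Set.mem_iUnion, Set.mem_Iic, Set.mem_univ, exists_prop, true_and]
    constructor
    · rintro ⟨L, m, _, h⟩; exact ⟨m, h⟩
    · rintro ⟨m, h⟩; exact ⟨m, m, le_rfl, h⟩
  have ht := tendsto_measure_iUnion_atTop (μ := noiseLaw d) hmono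
  rw [hU] at ht
  have ht2 := (ENNReal.tendsto_toReal (measure_ne_top _ _)).comp ht
  obtain ⟨L, hL⟩ := (ht2.eventually (lt_mem_nhds hr)).exists
  exact ⟨L, fun e => by rw [measure_returns_eq _ e (0, true)]; exact hL⟩

end Measure

lemma hittingTime_lt_iff (ω : Noise d) (e : Step d) :
    hittingTime (walk ω) 0 < hittingTime (walk ω) (stepVec e) ↔ ω ∈ returns Set.univ e := by
  classical
  constructor
  · intro h
    obtain ⟨m, hm⟩ := iInf_lt_iff.1 h
    obtain ⟨⟨hm1, hm0⟩, hmb⟩ := iInf_lt_iff.1 hm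
    have hex : ∃ m, 1 ≤ m ∧ walk ω m = 0 := ⟨m, hm1, hm0⟩
    simp only [returns, Set.mem_iUnion]
    refine ⟨Nat.find hex, Set.mem_univ _, (Nat.find_spec hex).1, (Nat.find_spec hex).2,
      fun i hi him => ⟨fun h0 => Nat.find_min hex him ⟨hi, h0⟩, fun hb => ?_⟩⟩
    have h1 : hittingTime (walk ω) (stepVec e) ≤ i := iInf₂_le i ⟨hi, hb⟩
    have h2 : i < m := him.trans_le (Nat.find_min' hex ⟨hm1, hm0⟩)
    exact absurd (hmb.trans_le h1) (not_lt.2 (by exact_mod_cast h2.le))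
  · intro h
    simp only [returns, Set.mem_iUnion] at h
    obtain ⟨m, _, h1, h2, h3⟩ := h
    have h4 : hittingTime (walk ω) 0 ≤ m := iInf₂_le m ⟨h1, h2⟩
    have h5 : ((m + 1 : ℕ) : ℕ∞) ≤ hittingTime (walk ω) (stepVec e) := by
      refine le_iInf₂ fun j hj => ?_
      have hjm : m ≤ j := by
        by_contra hc
        exact (h3 j hj.1 (not_le.1 hc)).2 hj.2
      have hjm' : m ≠ j := by
        rintro rfl
        exact stepVec_ne_zero e (hj.2.symm.trans h2)
      exact_mod_cast (by omega : m + 1 ≤ j)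
    exact h4.trans_lt (lt_of_lt_of_le (by exact_mod_cast Nat.lt_succ_self m) h5)

/-! ### The upper bound -/

lemma visits_shift {ω : Noise d} {j n : ℕ} (hj : j ≤ n) {x : Fin d → ℤ}
    (hx : ∀ i < j, walk ω i ≠ x) :
    visits (walk ω) n x = visits (walk (shift j ω)) (n - j) (x - walk ω j) := by
  rw [visits, visits]
  refine Finset.card_nbij' (fun i => i - j) (fun i => j + i) ?_ ?_ ?_ ?_
  · intro i hi
    simp only [Finset.coe_filter, Finset.mem_range, Set.mem_ofPred_eq] at hi ⊢
    have hij : j ≤ i := by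
      by_contra hc
      exact hx i (not_le.1 hc) hi.2
    refine ⟨by omega, ?_⟩
    rw [eq_sub_iff_add_eq', ← walk_add, show j + (i - j) = i by omega, hi.2]
  · intro i hi
    simp only [Finset.coe_filter, Finset.mem_range, Set.mem_ofPred_eq] at hi ⊢
    refine ⟨by omega, ?_⟩
    rw [walk_add, hi.2]; abel
  · intro i hi
    simp only [Finset.coe_filter, Finset.mem_range, Set.mem_ofPred_eq] at hi
    have hij : j ≤ i := by
      by_contra hc
      exact hx i (not_le.1 hc) hi.2
    simp only; omega
  · intro i _; simp

/-- Visits of the origin that precede the first visit of a neighbour are successive returns. -/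
lemma mem_multiReturn_of_visits (e : Step d) (k : ℕ) : ∀ (ω : Noise d) (N : ℕ),
    k + 1 ≤ visits (walk ω) N 0 → (∀ i ≤ N, walk ω i ≠ stepVec e) →
      ω ∈ multiReturn Set.univ e Set.univ k := by
  classical
  induction k with
  | zero => exact fun ω N _ _ => Set.mem_univ _
  | succ k ih =>
    intro ω N hv hb
    have hex : ∃ m, 1 ≤ m ∧ m ≤ N ∧ walk ω m = 0 := by
      by_contra! hc
      have : visits (walk ω) N 0 ≤ 1 := by
        rw [visits]
        refine (Finset.card_le_card (t := {0}) fun i hi => ?_).trans_eq (Finset.card_singleton 0)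
        simp only [Finset.mem_filter, Finset.mem_range, Finset.mem_singleton] at hi ⊢
        by_contra h0
        exact hc i (by omega) (by omega) hi.2
      omega
    obtain ⟨h1, h2, h3⟩ := Nat.find_spec hex
    have hmin : ∀ i, 1 ≤ i → i < Nat.find hex → walk ω i ≠ 0 := fun i hi him h0 =>
      Nat.find_min hex him ⟨hi, (him.trans_le h2).le, h0⟩
    generalize Nat.find hex = m at h1 h2 h3 hmin
    rw [multiReturn]
    simp only [Set.mem_iUnion]
    refine ⟨m, Set.mem_univ _, ⟨h1, h3, fun i hi him => ⟨hmin i hi him, hb i (by omega)⟩⟩, ?_⟩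
    refine ih (shift m ω) (N - m) ?_ ?_
    · have hle : visits (walk ω) N 0 ≤ visits (walk (shift m ω)) (N - m) 0 + 1 := by
        rw [visits, visits]
        have hsub : (Finset.range (N + 1)).filter (fun i => walk ω i = 0) ⊆
            insert 0 (((Finset.range (N - m + 1)).filter
              fun i => walk (shift m ω) i = 0).image fun i => m + i) := by
          intro i hi
          simp only [Finset.mem_filter, Finset.mem_range, Finset.mem_insert, Finset.mem_image]
            at hi ⊢
          by_cases hi0 : i = 0
          · exact Or.inl hi0
          · have him : m ≤ i := by
              by_contra hc
              exact hmin i (by omega) (not_le.1 hc) hi.2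
            refine Or.inr ⟨i - m, ⟨by omega, ?_⟩, by omega⟩
            have h5 := walk_add ω m (i - m)
            rw [show m + (i - m) = i by omega, hi.2, h3, zero_add] at h5
            exact h5.symm
        refine (Finset.card_le_card hsub).trans ((Finset.card_insert_le _ _).trans ?_)
        exact Nat.succ_le_succ Finset.card_image_le
      omega
    · intro i hi h0
      refine hb (m + i) (by omega) ?_
      rw [walk_add, h3, zero_add, h0]

lemma mem_innerBoundary {A : Finset (Fin d → ℤ)} {x : Fin d → ℤ} :
    x ∈ innerBoundary A ↔ x ∈ A ∧ ¬ neighbors x ⊆ (A : Set (Fin d → ℤ)) := by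
  classical
  unfold innerBoundary
  exact Finset.mem_filter

/-- A bound on the number of successive returns from every time of the walk bounds the number of
visits to the points of the inner boundary of the range. -/
lemma maxBoundaryVisits_le {ω : Noise d} {n B : ℕ}
    (h : ∀ j ≤ n, ∀ e, ∃ k ≤ B, shift j ω ∉ multiReturn Set.univ e Set.univ k) :
    maxBoundaryVisits (walk ω) n ≤ B := by
  classical
  refine Finset.sup_le fun x hx => ?_
  by_contra hc
  obtain ⟨hx, hb⟩ := mem_innerBoundary.1 hx
  have hex : ∃ j, j < n + 1 ∧ walk ω j = x := by
    simpa only [pathRange, Finset.mem_image, Finset.mem_range] using hx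
  obtain ⟨hj, hjx⟩ := Nat.find_spec hex
  have hmin : ∀ i < Nat.find hex, walk ω i ≠ x := fun i hi h0 =>
    Nat.find_min hex hi ⟨by omega, h0⟩
  generalize Nat.find hex = j at hj hjx hmin
  obtain ⟨b, hbx, hbr⟩ := Set.not_subset.1 hb
  obtain ⟨e, rfl⟩ := (mem_neighbors_iff x b).1 hbx
  obtain ⟨k, hk, hk2⟩ := h j (by omega) e
  refine hk2 (mem_multiReturn_of_visits e k _ (n - j) ?_ ?_)
  · have := visits_shift (n := n) (by omega) hmin
    rw [hjx, sub_self] at this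
    omega
  · intro i hi h0
    apply hbr
    rw [Finset.mem_coe, pathRange, Finset.mem_image]
    refine ⟨j + i, Finset.mem_range.2 (by omega), ?_⟩
    rw [walk_add, hjx, h0]

section UpperBound

variable [NeZero d]

lemma neg_log_returnProb_pos : 0 < -Real.log (returnProb d) := by
  linarith [Real.log_neg (returnProb_pos (d := d)) returnProb_lt_one]

lemma measure_shift_multiReturn (j k : ℕ) (e : Step d) :
    (noiseLaw d).real (shift j ⁻¹' multiReturn Set.univ e Set.univ k) = returnProb d ^ k := by
  rw [measureReal_shift (measurableSet_multiReturn _ _ MeasurableSet.univ _),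
    measure_multiReturn _ _ MeasurableSet.univ, measure_returns_univ]
  simp

lemma ae_maxBoundaryVisits_le {r : ℝ} (hr : 1 / (-Real.log (returnProb d)) < r) :
    ∀ᵐ ω ∂(noiseLaw d), ∃ C : ℝ, ∀ n : ℕ, 1 ≤ n →
      (maxBoundaryVisits (walk ω) n : ℝ) ≤ r * Real.log n + C := by
  have hq := neg_log_returnProb_pos (d := d)
  have hq0 := returnProb_pos (d := d)
  have hr1 : 1 < r * (-Real.log (returnProb d)) := by rwa [div_lt_iff₀ hq] at hr
  have hr0 : 0 < r := lt_trans (by positivity) hr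
  -- the number of returns that almost surely does not occur from large times `j` on
  let k : ℕ → ℕ := fun j => ⌈r * Real.log j⌉₊
  have hle : ∀ (e : Step d) (j : ℕ), noiseLaw d
      (shift j ⁻¹' multiReturn Set.univ e Set.univ (k j)) ≤
      ENNReal.ofReal (if j = 0 then 1 else (j : ℝ) ^ (-(r * (-Real.log (returnProb d))))) := by
    intro e j
    refine (ENNReal.le_ofReal_iff_toReal_le (measure_ne_top _ _) (by positivity)).2 ?_
    change (noiseLaw d).real _ ≤ _
    rw [measure_shift_multiReturn]
    split_ifs with hj
    · exact pow_le_one₀ hq0.le returnProb_lt_one.le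
    · have hj0 : (0 : ℝ) < j := Nat.cast_pos.2 (Nat.pos_of_ne_zero hj)
      rw [← Real.rpow_natCast, Real.rpow_def_of_pos hq0, Real.rpow_def_of_pos hj0,
        Real.exp_le_exp]
      have := Nat.le_ceil (r * Real.log j)
      nlinarith
  -- the exponent exceeds one, since `r` exceeds `1 / (-log q)`, where `q` is `returnProb d`
  have hsum : ∀ e : Step d, ∑' j, noiseLaw d
      (shift j ⁻¹' multiReturn Set.univ e Set.univ (k j)) ≠ ∞ := by
    intro e
    refine ne_top_of_le_ne_top ?_ (ENNReal.tsum_le_tsum (hle e))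
    have hs : Summable fun j : ℕ => if j = 0 then (1 : ℝ) else
        (j : ℝ) ^ (-(r * (-Real.log (returnProb d)))) := by
      rw [← summable_nat_add_iff 1]
      have := (summable_nat_add_iff 1).2 (Real.summable_nat_rpow.2
        (show -(r * (-Real.log (returnProb d))) < -1 by linarith))
      refine this.congr fun j => ?_
      simp
    rw [← ENNReal.ofReal_tsum_of_nonneg (fun j => by positivity) hs]
    exact ENNReal.ofReal_ne_top
  have h1 : ∀ᵐ ω ∂(noiseLaw d), ∀ e : Step d, ∀ᶠ j in atTop,
      ω ∉ shift j ⁻¹' multiReturn Set.univ e Set.univ (k j) :=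
    ae_all_iff.2 fun e => ae_eventually_notMem (hsum e)
  -- the finitely many starting times not covered by Borel–Cantelli contribute a random constant
  have h2 : ∀ᵐ ω ∂(noiseLaw d), ∀ (e : Step d) (j : ℕ), ∃ K,
      ω ∉ shift j ⁻¹' multiReturn Set.univ e Set.univ K := by
    refine ae_all_iff.2 fun e => ae_all_iff.2 fun j => ?_
    rw [ae_iff]
    simp only [not_exists, not_not]
    rw [← measureReal_eq_zero_iff]
    refine le_antisymm (ge_of_tendsto' (tendsto_pow_atTop_nhds_zero_of_lt_one hq0.le
      (returnProb_lt_one (d := d))) fun K => ?_) measureReal_nonneg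
    rw [← measure_shift_multiReturn j K e]
    exact measureReal_mono fun ω hω => hω K
  filter_upwards [h1, h2] with ω hω1 hω2
  obtain ⟨J, hJ⟩ := eventually_atTop.1 (eventually_all.2 hω1)
  choose K hK using hω2
  refine ⟨(∑ j ∈ Finset.range J, ∑ e, K e j : ℕ) + 1, fun n hn => ?_⟩
  have hlog : 0 ≤ Real.log n := Real.log_nonneg (by exact_mod_cast hn)
  have h3 : maxBoundaryVisits (walk ω) n ≤ k n + ∑ j ∈ Finset.range J, ∑ e, K e j := by
    refine maxBoundaryVisits_le fun j hj e => ?_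
    rcases lt_or_ge j J with h4 | h4
    · refine ⟨K e j, le_trans ?_ (Nat.le_add_left _ _), hK e j⟩
      refine (Finset.single_le_sum (f := fun e => K e j) (fun _ _ => Nat.zero_le _)
        (Finset.mem_univ e)).trans ?_
      exact Finset.single_le_sum (f := fun j => ∑ e, K e j) (fun _ _ => Nat.zero_le _)
        (Finset.mem_range.2 h4)
    · refine ⟨k j, le_trans ?_ (Nat.le_add_right _ _), hJ j h4 e⟩
      rcases Nat.eq_zero_or_pos j with rfl | hj0
      · simp [k]
      · have : (0 : ℝ) < j := by exact_mod_cast hj0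
        exact Nat.ceil_le_ceil (mul_le_mul_of_nonneg_left (Real.log_le_log this
          (by exact_mod_cast hj)) hr0.le)
  have h4 : (k n : ℝ) < r * Real.log n + 1 := Nat.ceil_lt_add_one (by positivity)
  have h5 : (maxBoundaryVisits (walk ω) n : ℝ) ≤
      (k n : ℝ) + (∑ j ∈ Finset.range J, ∑ e, K e j : ℕ) := by exact_mod_cast h3
  linarith

end UpperBound

/-! ### Finding a favourite boundary point in a block of time -/

/-- At time `j + 1` the walk discovers a point which is not in `Q`. -/
def newStep (Q : Set (Fin d → ℤ)) (j : ℕ) : Set (Noise d) :=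
  {ω | walk ω (j + 1) ∉ Q ∧ ∀ i ≤ j, walk ω i ≠ walk ω (j + 1)}

/-- At time `j` the neighbour of the walk in the direction `e` is not in `Q`, and has not been
visited yet. -/
def freshNeighbor (Q : Set (Fin d → ℤ)) (j : ℕ) (e : Step d) : Set (Noise d) :=
  {ω | walk ω j + stepVec e ∉ Q ∧ ∀ i ≤ j, walk ω i ≠ walk ω j + stepVec e}

/-- At time `W` there is a point with at least `k` visits, one of whose neighbours is not in `Q`,
has not been visited, and is at a distance at least `ρ` from the walk. -/
def success (Q : Set (Fin d → ℤ)) (W k : ℕ) (ρ : ℤ) : Set (Noise d) :=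
  {ω | ∃ (x : Fin d → ℤ) (e : Step d), k ≤ visits (walk ω) W x ∧ x + stepVec e ∉ Q ∧
    (∀ i ≤ W, walk ω i ≠ x + stepVec e) ∧ ∃ i, ρ ≤ |(x + stepVec e - walk ω W) i|}

lemma detBy_newStep (Q : Set (Fin d → ℤ)) (j : ℕ) : DetBy (j + 1) (newStep Q j) := by
  rintro ω ω' h ⟨h1, h2⟩
  have hw : ∀ i ≤ j + 1, walk ω' i = walk ω i := fun i hi =>
    walk_congr fun m hm => h m (hm.trans_le hi)
  refine ⟨by rwa [hw _ le_rfl], fun i hi => ?_⟩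
  rw [hw _ le_rfl, hw i (by omega)]
  exact h2 i hi

lemma detBy_freshNeighbor (Q : Set (Fin d → ℤ)) (j : ℕ) (e : Step d) :
    DetBy j (freshNeighbor Q j e) := by
  rintro ω ω' h ⟨h1, h2⟩
  have hw : ∀ i ≤ j, walk ω' i = walk ω i := fun i hi =>
    walk_congr fun m hm => h m (hm.trans_le hi)
  refine ⟨by rwa [hw _ le_rfl], fun i hi => ?_⟩
  rw [hw _ le_rfl, hw i hi]
  exact h2 i hi

lemma visits_congr {ω ω' : Noise d} {n : ℕ} (h : ∀ i < n, ω' i = ω i) (x : Fin d → ℤ) :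
    visits (walk ω') n x = visits (walk ω) n x := by
  rw [visits, visits]
  congr 1
  refine Finset.filter_congr fun i hi => ?_
  have := Finset.mem_range.1 hi
  rw [walk_congr fun m hm => h m (by omega)]

lemma detBy_success (Q : Set (Fin d → ℤ)) (W k : ℕ) (ρ : ℤ) : DetBy W (success Q W k ρ) := by
  rintro ω ω' h ⟨x, e, h1, h2, h3, h4⟩
  have hw : ∀ i ≤ W, walk ω' i = walk ω i := fun i hi =>
    walk_congr fun m hm => h m (hm.trans_le hi)
  refine ⟨x, e, by rwa [visits_congr h], h2, fun i hi => ?_, by rwa [hw _ le_rfl]⟩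
  rw [hw i hi]
  exact h3 i hi

lemma newStep_subset (Q : Set (Fin d → ℤ)) (j : ℕ) :
    newStep Q j ⊆ ⋃ e, freshNeighbor Q j e := by
  rintro ω ⟨h1, h2⟩
  rw [walk_succ] at h1 h2
  exact Set.mem_iUnion.2 ⟨ω j, h1, h2⟩

lemma detBy_shift {L : ℕ} {M : Set (Noise d)} (hM : DetBy L M) (j : ℕ) :
    DetBy (j + L) (shift j ⁻¹' M) := fun ω ω' h hω =>
  hM (shift j ω) (shift j ω') (fun i hi => h (j + i) (by omega)) hω

lemma visits_mono (s : ℕ → Fin d → ℤ) {m n : ℕ} (h : m ≤ n) (x : Fin d → ℤ) :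
    visits s m x ≤ visits s n x :=
  Finset.card_le_card (Finset.filter_subset_filter _ (Finset.range_subset_range.2 (by omega)))

lemma visits_shift_le (ω : Noise d) (j n : ℕ) (y : Fin d → ℤ) :
    visits (walk (shift j ω)) n y ≤ visits (walk ω) (j + n) (walk ω j + y) := by
  rw [visits, visits]
  refine Finset.card_le_card_of_injOn (fun i => j + i) ?_ (fun a _ b _ h => by simpa using h)
  intro i hi
  simp only [Finset.coe_filter, Finset.mem_range, Set.mem_ofPred_eq] at hi ⊢
  exact ⟨by omega, by rw [walk_add, hi.2]⟩

lemma visits_glue_le (ω ω' : Noise d) (j n : ℕ) (y : Fin d → ℤ) :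
    visits (walk ω') n y ≤ visits (walk (glue j ω ω')) (j + n) (walk ω j + y) := by
  have := visits_shift_le (glue j ω ω') j n y
  rwa [shift_glue, walk_glue_of_le le_rfl] at this

/-- After `k` returns, each in a time at most `L`, the origin has been visited `k + 1` times. -/
lemma exists_of_mem_multiReturn {L : ℕ} {e : Step d} {F : Set (Noise d)} (k : ℕ) :
    ∀ ω ∈ multiReturn (Set.Iic L) e F k, ∃ t ≤ k * L, walk ω t = 0 ∧
      k + 1 ≤ visits (walk ω) t 0 ∧ (∀ i ≤ t, walk ω i ≠ stepVec e) ∧ shift t ω ∈ F := by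
  induction k with
  | zero =>
    intro ω hω
    refine ⟨0, by simp, walk_zero ω, ?_, ?_, by rw [shift_zero]; exact hω⟩
    · simp [visits, Finset.filter_singleton]
    · intro i hi
      obtain rfl : i = 0 := by omega
      rw [walk_zero]; exact (stepVec_ne_zero e).symm
  | succ k ih =>
    intro ω hω
    simp only [multiReturn, Set.mem_iUnion] at hω
    obtain ⟨m, hm, ⟨h1, h2, h3⟩, h4⟩ := hω
    have hm : m ≤ L := hm
    obtain ⟨t, ht, ht0, hv, hav, hF⟩ := ih _ h4
    refine ⟨m + t, by nlinarith, by rw [walk_add, h2, ht0, add_zero], ?_, ?_,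
      by rwa [← shift_shift]⟩
    · have h5 : insert 0 (((Finset.range (t + 1)).filter
          fun i => walk (shift m ω) i = 0).image fun i => m + i) ⊆
          (Finset.range (m + t + 1)).filter fun i => walk ω i = 0 := by
        intro i hi
        simp only [Finset.mem_insert, Finset.mem_image, Finset.mem_filter, Finset.mem_range] at hi ⊢
        rcases hi with rfl | ⟨i, ⟨hi1, hi2⟩, rfl⟩
        · exact ⟨by omega, walk_zero ω⟩
        · exact ⟨by omega, by rw [walk_add, h2, hi2, add_zero]⟩
      have h6 := Finset.card_le_card h5
      rw [Finset.card_insert_of_notMem (by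
        simp only [Finset.mem_image, not_exists, not_and]
        intro i _; omega), Finset.card_image_of_injective _ (add_right_injective m)] at h6
      rw [visits] at hv ⊢
      omega
    · intro i hi
      rcases Nat.eq_zero_or_pos i with rfl | hi0
      · rw [walk_zero]; exact (stepVec_ne_zero e).symm
      rcases lt_trichotomy i m with h5 | h5 | h5
      · exact (h3 i hi0 h5).2
      · rw [h5, h2]; exact (stepVec_ne_zero e).symm
      · have h6 := hav (i - m) (by omega)
        have h7 := walk_add ω m (i - m)
        rw [show m + (i - m) = i by omega, h2, zero_add] at h7
        rwa [h7]

section Block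

variable [NeZero d]

/-- The second moment method, in a linear form. -/
lemma second_moment_le {ι : Type*} (s : Finset ι) (Y : ι → Set (Noise d))
    (hY : ∀ u, MeasurableSet (Y u)) {A : Set (Noise d)} (hA : MeasurableSet A)
    (h : ∀ u ∈ s, Y u ⊆ A) (b : ℝ) :
    2 * b * ∑ u ∈ s, (noiseLaw d).real (Y u) -
      b ^ 2 * ∑ u ∈ s, ∑ v ∈ s, (noiseLaw d).real (Y u ∩ Y v) ≤ (noiseLaw d).real A := by
  let I : Set (Noise d) → Noise d → ℝ := fun E => E.indicator fun _ => 1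
  have hI : ∀ E, MeasurableSet E → Integrable (I E) (noiseLaw d) := fun E hE =>
    (integrable_const _).indicator hE
  have hint : ∀ E, MeasurableSet E → ∫ ω, I E ω ∂(noiseLaw d) = (noiseLaw d).real E :=
    fun E hE => by
      rw [integral_indicator_const _ hE, smul_eq_mul, mul_one]
  have h1 : Integrable (fun ω => ∑ u ∈ s, I (Y u) ω) (noiseLaw d) :=
    integrable_finsetSum _ fun u _ => hI _ (hY u)
  have h2 : Integrable (fun ω => ∑ u ∈ s, ∑ v ∈ s, I (Y u ∩ Y v) ω) (noiseLaw d) :=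
    integrable_finsetSum _ fun u _ => integrable_finsetSum _ fun v _ =>
      hI _ ((hY u).inter (hY v))
  have e1 : ∫ ω, ∑ u ∈ s, I (Y u) ω ∂(noiseLaw d) = ∑ u ∈ s, (noiseLaw d).real (Y u) := by
    rw [integral_finsetSum _ fun u _ => hI _ (hY u)]
    exact Finset.sum_congr rfl fun u _ => hint _ (hY u)
  have e2 : ∫ ω, ∑ u ∈ s, ∑ v ∈ s, I (Y u ∩ Y v) ω ∂(noiseLaw d) =
      ∑ u ∈ s, ∑ v ∈ s, (noiseLaw d).real (Y u ∩ Y v) := by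
    rw [integral_finsetSum _ fun u _ => integrable_finsetSum _ fun v _ =>
      hI _ ((hY u).inter (hY v))]
    refine Finset.sum_congr rfl fun u _ => ?_
    rw [integral_finsetSum _ fun v _ => hI _ ((hY u).inter (hY v))]
    exact Finset.sum_congr rfl fun v _ => hint _ ((hY u).inter (hY v))
  rw [← e1, ← e2, ← hint A hA, ← integral_const_mul, ← integral_const_mul,
    ← integral_sub (h1.const_mul _) (h2.const_mul _)]
  refine integral_mono ((h1.const_mul _).sub (h2.const_mul _)) (hI A hA) fun ω => ?_
  have h3 : ∑ u ∈ s, ∑ v ∈ s, I (Y u ∩ Y v) ω = (∑ u ∈ s, I (Y u) ω) ^ 2 := by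
    rw [sq, Finset.sum_mul_sum]
    refine Finset.sum_congr rfl fun u _ => Finset.sum_congr rfl fun v _ => ?_
    by_cases hu : ω ∈ Y u <;> by_cases hv : ω ∈ Y v <;> simp [I, hu, hv]
  change 2 * b * ∑ u ∈ s, I (Y u) ω - b ^ 2 * ∑ u ∈ s, ∑ v ∈ s, I (Y u ∩ Y v) ω ≤ I A ω
  rw [h3]
  by_cases hω : ω ∈ A
  · have : I A ω = 1 := Set.indicator_of_mem hω _
    rw [this]
    -- `2 b x - b² x² ≤ 1`, where `x` is the number of events that occur
    nlinarith [sq_nonneg (1 - b * ∑ u ∈ s, I (Y u) ω)]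
  · have : ∑ u ∈ s, I (Y u) ω = 0 := Finset.sum_eq_zero fun u hu =>
      Set.indicator_of_notMem (fun h' => hω (h u hu h')) _
    rw [this]
    have : I A ω = 0 := Set.indicator_of_notMem hω _
    rw [this]; simp

/-- The walk started afresh makes `k` quick returns to the origin before it visits the neighbour
`e`, avoids `e` for a time `W`, and is far from `e` at time `r`. -/
def survivor (L k W : ℕ) (ρ : ℤ) (r : ℕ) (e : Step d) : Set (Noise d) :=
  multiReturn (Set.Iic L) e (avoid e W) k ∩ {ω | ∃ i, ρ ≤ |(stepVec e - walk ω r) i|}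

omit [NeZero d] in
lemma measurableSet_survivor (L k W : ℕ) (ρ : ℤ) (r : ℕ) (e : Step d) :
    MeasurableSet (survivor L k W ρ r e) :=
  (measurableSet_multiReturn _ _ (detBy_avoid e W).measurableSet _).inter
    (detBy_walk le_rfl {y : Fin d → ℤ | ∃ i, ρ ≤ |(stepVec e - y) i|}).measurableSet

/-- The requirement of being far from `e` in the end only halves the probability `p σ` of quick
returns followed by an escape. -/
lemma measure_survivor_ge {L k W s r : ℕ} {ρ : ℤ} {e : Step d} {σ : ℝ} (hσ : 0 ≤ σ)
    (hav : σ ≤ (noiseLaw d).real (avoid e W))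
    (hnear : ∀ t : ℕ, s ≤ t + k * L → ∀ y : Fin d → ℤ,
      (noiseLaw d).real {ω | ∀ i, |(y - walk ω t) i| < ρ} ≤ σ / 2)
    (hs : k * L ≤ s) (hr : s ≤ r) :
    (noiseLaw d).real (returns (Set.Iic L) e) ^ k * (σ / 2) ≤
      (noiseLaw d).real (survivor L k W ρ r e) := by
  set p := (noiseLaw d).real (returns (Set.Iic L) e) ^ k with hp
  have hp0 : 0 ≤ p := by positivity
  let M := multiReturn (Set.Iic L) e (Set.univ : Set (Noise d)) k
  let MA := multiReturn (Set.Iic L) e (avoid e W) k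
  let near : Set (Noise d) := {ω | ∀ i, |(stepVec e - walk ω r) i| < ρ}
  have hnearm : MeasurableSet near :=
    (detBy_walk le_rfl {y : Fin d → ℤ | ∀ i, |(stepVec e - y) i| < ρ}).measurableSet
  have hMd : DetBy (k * L) M := detBy_multiReturn L e k
  have hM : (noiseLaw d).real M = p := by
    simp [M, measure_multiReturn _ _ MeasurableSet.univ, hp]
  have hMA : p * σ ≤ (noiseLaw d).real MA := by
    simp only [MA]
    rw [measure_multiReturn _ _ (detBy_avoid e W).measurableSet]
    exact mul_le_mul_of_nonneg_left hav hp0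
  have h1 : (noiseLaw d).real (M ∩ near) ≤ σ / 2 * p := by
    rw [← hM]
    refine measure_le_mul_of_glue (isStop_const (k * L)) hMd.measurableSet
      (hMd.measurableSet.inter hnearm) (by positivity) ?_ ?_
    · intro ω ω' hω hE
      exact hω ((hMd.glue_mem_iff ω ω').1 hE.1)
    · intro ω _
      refine le_trans (measureReal_mono ?_) (hnear (r - k * L) (by omega)
        (stepVec e - walk ω (k * L)))
      rintro ω' ⟨_, h2⟩ i
      have h3 := h2 i
      have h4 := walk_glue_add (k * L) (r - k * L) ω ω'
      rw [show k * L + (r - k * L) = r by omega] at h4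
      rw [h4] at h3
      simpa [sub_sub] using h3
  have h2 : MA ⊆ survivor L k W ρ r e ∪ (M ∩ near) := by
    intro ω hω
    by_cases h3 : ∃ i, ρ ≤ |(stepVec e - walk ω r) i|
    · exact Or.inl ⟨hω, h3⟩
    · push Not at h3
      exact Or.inr ⟨multiReturn_mono _ _ (Set.subset_univ _) k hω, h3⟩
  have h3 := (measureReal_mono (μ := noiseLaw d) h2).trans (measureReal_union_le _ _)
  linarith

omit [NeZero d] in
lemma survivor_subset_success {Q : Set (Fin d → ℤ)} {L k W s j : ℕ} {ρ : ℤ} {e : Step d}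
    (hs : k * L ≤ s) (hj : j + s ≤ W) :
    freshNeighbor Q j e ∩ shift j ⁻¹' survivor L k W ρ (W - j) e ⊆ success Q W k ρ := by
  rintro ω ⟨⟨h1, h2⟩, h3, i, hi⟩
  obtain ⟨t, ht, ht0, hv, hav, hF⟩ := exists_of_mem_multiReturn k _ h3
  refine ⟨walk ω j, e, ?_, h1, ?_, i, ?_⟩
  · have h4 := visits_shift_le ω j t 0
    have h5 := visits_mono (walk ω) (show j + t ≤ W by omega) (walk ω j + 0)
    rw [add_zero] at h4 h5
    omega
  · intro n hn
    rcases le_or_gt n j with h4 | h4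
    · exact h2 n h4
    · have h5 := walk_add ω j (n - j)
      rw [show j + (n - j) = n by omega] at h5
      rw [h5]
      intro h6
      have h6 := add_left_cancel h6
      rcases le_or_gt (n - j) t with h7 | h7
      · exact hav _ h7 h6
      · have h8 := walk_add (shift j ω) t (n - j - t)
        rw [show t + (n - j - t) = n - j by omega, ht0, zero_add] at h8
        rw [h8] at h6
        exact hF _ (by omega) h6
  · have h4 := walk_add ω j (W - j)
    rw [show j + (W - j) = W by omega] at h4
    rw [h4]
    simpa using hi

/-- Quick returns from two times at a distance larger than `k L` are independent. -/
lemma measure_inter_quick_returns_le {L k : ℕ} (e e' : Step d) {p : ℝ}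
    (hp : ∀ e, (noiseLaw d).real (multiReturn (Set.Iic L) e Set.univ k) = p) (j j' : ℕ) :
    (noiseLaw d).real (shift j ⁻¹' multiReturn (Set.Iic L) e Set.univ k ∩
      shift j' ⁻¹' multiReturn (Set.Iic L) e' Set.univ k) ≤
      p ^ 2 + if j < j' + k * L ∧ j' < j + k * L then p else 0 := by
  have hm : ∀ e : Step d, MeasurableSet (multiReturn (Set.Iic L) e Set.univ k) := fun e =>
    measurableSet_multiReturn _ _ MeasurableSet.univ _
  have hp0 : 0 ≤ p := by rw [← hp e]; exact measureReal_nonneg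
  have far : ∀ (a b : Step d) (m n : ℕ), m + k * L ≤ n →
      (noiseLaw d).real (shift m ⁻¹' multiReturn (Set.Iic L) a Set.univ k ∩
      shift n ⁻¹' multiReturn (Set.Iic L) b Set.univ k) = p ^ 2 := by
    intro a b m n h
    rw [measureReal_inter_shift ((detBy_shift (detBy_multiReturn L a k) m).mono h) (hm b),
      measureReal_shift (hm a), hp, hp, sq]
  split_ifs with h
  · refine (measureReal_mono Set.inter_subset_left).trans ?_
    rw [measureReal_shift (hm e), hp]
    nlinarith [sq_nonneg p]
  · rw [add_zero]
    rcases not_and_or.1 h with h | h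
    · rw [Set.inter_comm]
      exact (far e' e j' j (by omega)).le
    · exact (far e e' j j' (by omega)).le

/-- The second moment of the number of times with quick returns is of the order of the square `(p W)
^ 2` of the first one, as soon as the latter is at least `k L`. -/
lemma sum_inter_quick_returns_le {L k W n : ℕ} {p : ℝ} (hn : n ≤ W)
    (hp : ∀ e : Step d, (noiseLaw d).real (multiReturn (Set.Iic L) e Set.univ k) = p)
    (hL : k * L ≤ p * W) :
    ∑ u ∈ Finset.range n ×ˢ (Finset.univ : Finset (Step d)),
      ∑ v ∈ Finset.range n ×ˢ (Finset.univ : Finset (Step d)),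
        (noiseLaw d).real (shift u.1 ⁻¹' multiReturn (Set.Iic L) u.2 Set.univ k ∩
          shift v.1 ⁻¹' multiReturn (Set.Iic L) v.2 Set.univ k) ≤ 12 * d ^ 2 * (p * W) ^ 2 := by
  have hp0 : 0 ≤ p := by rw [← hp (0, true)]; exact measureReal_nonneg
  have hnW : (n : ℝ) ≤ W := by exact_mod_cast hn
  have h1 : ∀ j : ℕ, ∑ j' ∈ Finset.range n,
      (p ^ 2 + if j < j' + k * L ∧ j' < j + k * L then p else 0) ≤ 3 * (p * W) * p := by
    intro j
    rw [Finset.sum_add_distrib, Finset.sum_const, Finset.card_range, nsmul_eq_mul,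
      ← Finset.sum_filter, Finset.sum_const, nsmul_eq_mul]
    have h2 : ((Finset.range n).filter fun j' => j < j' + k * L ∧ j' < j + k * L).card ≤
        2 * (k * L) := by
      refine (Finset.card_le_card (t := Finset.Ico (j + 1 - k * L) (j + k * L)) fun i hi => ?_).trans
        ?_
      · simp only [Finset.mem_filter, Finset.mem_Ico] at hi ⊢
        omega
      · rw [Nat.card_Ico]; omega
    have h3 : (((Finset.range n).filter fun j' => j < j' + k * L ∧ j' < j + k * L).card : ℝ) ≤
        2 * (k * L) := by exact_mod_cast h2
    have h4 := mul_le_mul_of_nonneg_right (h3.trans (mul_le_mul_of_nonneg_left hL two_pos.le)) hp0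
    have h5 := mul_le_mul_of_nonneg_right hnW (sq_nonneg p)
    nlinarith
  calc _ ≤ ∑ u ∈ Finset.range n ×ˢ (Finset.univ : Finset (Step d)),
      ∑ v ∈ Finset.range n ×ˢ (Finset.univ : Finset (Step d)),
        (p ^ 2 + if u.1 < v.1 + k * L ∧ v.1 < u.1 + k * L then p else 0) :=
        Finset.sum_le_sum fun u _ => Finset.sum_le_sum fun v _ =>
          measure_inter_quick_returns_le u.2 v.2 hp u.1 v.1
    _ ≤ ∑ u ∈ Finset.range n ×ˢ (Finset.univ : Finset (Step d)), 2 * d * (3 * (p * W) * p) := by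
        refine Finset.sum_le_sum fun u _ => ?_
        rw [Finset.sum_product_right]
        refine (Finset.sum_le_sum fun e _ => h1 u.1).trans_eq ?_
        simp [mul_comm]
    _ = n * (2 * d) * (2 * d * (3 * (p * W) * p)) := by
        simp [mul_comm, mul_assoc]
    _ ≤ W * (2 * d) * (2 * d * (3 * (p * W) * p)) := by gcongr
    _ = _ := by ring

/-- In a block of length `W`, a favourite boundary point outside `Q` is found with a probability
which is controlled by the mean number of points outside `Q` that are discovered. -/
lemma block_success {Q : Set (Fin d → ℤ)} {L k W s : ℕ} {ρ : ℤ} {σ p : ℝ} (hσ : 0 ≤ σ)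
    (hp : ∀ e : Step d, (noiseLaw d).real (returns (Set.Iic L) e) ^ k = p) (hp0 : 0 < p)
    (hav : ∀ e : Step d, σ ≤ (noiseLaw d).real (avoid e W))
    (hnear : ∀ t : ℕ, s ≤ t + k * L → ∀ y : Fin d → ℤ,
      (noiseLaw d).real {ω | ∀ i, |(y - walk ω t) i| < ρ} ≤ σ / 2)
    (hs : k * L ≤ s) (hsW : s ≤ W) (hW : 0 < W) (hL : k * L ≤ p * W) {a : ℝ} (ha : 0 < a) :
    a * σ * ∑ j ∈ Finset.range (W - s), (noiseLaw d).real (newStep Q j) ≤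
      W * ((noiseLaw d).real (success Q W k ρ) + 12 * d ^ 2 * a ^ 2) := by
  have hW0 : (0 : ℝ) < W := by exact_mod_cast hW
  let S := Finset.range (W - s) ×ˢ (Finset.univ : Finset (Step d))
  let Y : ℕ × Step d → Set (Noise d) := fun u =>
    freshNeighbor Q u.1 u.2 ∩ shift u.1 ⁻¹' survivor L k W ρ (W - u.1) u.2
  have hY : ∀ u, MeasurableSet (Y u) := fun u =>
    (detBy_freshNeighbor Q u.1 u.2).measurableSet.inter
      (measurable_shift _ (measurableSet_survivor _ _ _ _ _ _))
  have hsub : ∀ u ∈ S, Y u ⊆ success Q W k ρ := by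
    intro u hu
    have := Finset.mem_range.1 (Finset.mem_product.1 hu).1
    exact survivor_subset_success hs (by omega)
  -- the first moment of the number of pairs `(j, e)` with quick returns and a lasting fresh
  -- neighbour
  have hfirst : (p * (σ / 2)) * ∑ j ∈ Finset.range (W - s), (noiseLaw d).real (newStep Q j) ≤
      ∑ u ∈ S, (noiseLaw d).real (Y u) := by
    rw [Finset.sum_product, Finset.mul_sum]
    refine Finset.sum_le_sum fun j hj => ?_
    have hj := Finset.mem_range.1 hj
    calc p * (σ / 2) * (noiseLaw d).real (newStep Q j)
        ≤ p * (σ / 2) * ∑ e, (noiseLaw d).real (freshNeighbor Q j e) := by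
          gcongr
          exact (measureReal_mono (newStep_subset Q j)).trans (measureReal_iUnion_fintype_le _)
      _ ≤ _ := by
          rw [Finset.mul_sum]
          refine Finset.sum_le_sum fun e _ => ?_
          have h1 := measure_survivor_ge (r := W - j) hσ (hav e) hnear hs (by omega)
          rw [hp e] at h1
          simp only [Y]
          rw [measureReal_inter_shift (detBy_freshNeighbor Q j e)
            (measurableSet_survivor _ _ _ _ _ _), mul_comm]
          gcongr
  -- for the second moment everything but the quick returns is dropped
  have hsecond : ∑ u ∈ S, ∑ v ∈ S, (noiseLaw d).real (Y u ∩ Y v) ≤ 12 * d ^ 2 * (p * W) ^ 2 := by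
    refine le_trans (Finset.sum_le_sum fun u _ => Finset.sum_le_sum fun v _ =>
      measureReal_mono ?_) (sum_inter_quick_returns_le (Nat.sub_le W s) (fun e => ?_) hL)
    · refine Set.inter_subset_inter ?_ ?_ <;>
      · rintro ω ⟨_, h2, _⟩
        exact multiReturn_mono _ _ (Set.subset_univ _) k h2
    · rw [measure_multiReturn _ _ MeasurableSet.univ, hp]; simp
  have h := second_moment_le S Y hY (detBy_success Q W k ρ).measurableSet hsub (a / (p * W))
  set D := ∑ j ∈ Finset.range (W - s), (noiseLaw d).real (newStep Q j)
  have h1 : 2 * (a / (p * W)) * ((p * (σ / 2)) * D) - (a / (p * W)) ^ 2 * (12 * d ^ 2 * (p * W) ^ 2)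
      ≤ (noiseLaw d).real (success Q W k ρ) := by
    refine le_trans (sub_le_sub ?_ ?_) h <;> gcongr
  have h2 : 2 * (a / (p * W)) * ((p * (σ / 2)) * D) = a * σ * D / W := by field_simp
  have h3 : (a / (p * W)) ^ 2 * (12 * d ^ 2 * (p * W) ^ 2) = 12 * d ^ 2 * a ^ 2 := by field_simp
  rw [h2, h3] at h1
  rw [← div_le_iff₀' hW0]
  linarith

end Block

/-! ### Searching through many blocks -/

/-- The points to be avoided by the walk restarted at time `T`: those of `Q` and those already
visited, seen from the position of the walk. -/
def residual (Q : Set (Fin d → ℤ)) (ω : Noise d) (T : ℕ) : Set (Fin d → ℤ) :=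
  {z | walk ω T + z ∈ Q ∨ ∃ i ≤ T, walk ω i = walk ω T + z}

/-- None of the first `n` blocks of length `W` ends with a success. -/
def noSuccess (Q : Set (Fin d → ℤ)) (W k : ℕ) (ρ : ℤ) (n : ℕ) : Set (Noise d) :=
  {ω | ∀ i, 1 ≤ i → i ≤ n → ω ∉ success Q (i * W) k ρ}

lemma detBy_noSuccess (Q : Set (Fin d → ℤ)) (W k : ℕ) (ρ : ℤ) (n : ℕ) :
    DetBy (n * W) (noSuccess Q W k ρ n) := by
  intro ω ω' h hω i hi hin hs
  refine hω i hi hin (detBy_success Q (i * W) k ρ ω' ω (fun m hm => (h m ?_).symm) hs)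
  exact hm.trans_le (Nat.mul_le_mul_right W hin)

lemma noSuccess_anti (Q : Set (Fin d → ℤ)) (W k : ℕ) (ρ : ℤ) {m n : ℕ} (h : m ≤ n) :
    noSuccess Q W k ρ n ⊆ noSuccess Q W k ρ m :=
  fun _ hω i hi him => hω i hi (him.trans h)

lemma newStep_of_glue {Q : Set (Fin d → ℤ)} {T j : ℕ} {ω ω' : Noise d}
    (h : glue T ω ω' ∈ newStep Q (T + j)) : ω' ∈ newStep (residual Q ω T) j := by
  obtain ⟨h1, h2⟩ := h
  rw [add_assoc, walk_glue_add] at h1 h2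
  refine ⟨?_, fun i hi h3 => ?_⟩
  · rintro (h3 | ⟨i, hi, h3⟩)
    · exact h1 h3
    · exact h2 i (by omega) (by rw [walk_glue_of_le hi, h3])
  · exact h2 (T + i) (by omega) (by rw [walk_glue_add, h3])

lemma success_glue {Q : Set (Fin d → ℤ)} {T W k : ℕ} {ρ : ℤ} {ω ω' : Noise d}
    (h : ω' ∈ success (residual Q ω T) W k ρ) : glue T ω ω' ∈ success Q (T + W) k ρ := by
  obtain ⟨x, e, h1, h2, h3, i, h4⟩ := h
  simp only [residual, Set.mem_ofPred_eq, not_or, not_exists, not_and] at h2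
  refine ⟨walk ω T + x, e, h1.trans (visits_glue_le _ _ _ _ _), by rw [add_assoc]; exact h2.1, ?_,
    i, ?_⟩
  · intro n hn h5
    rcases le_or_gt n T with h6 | h6
    · rw [walk_glue_of_le h6, add_assoc] at h5
      exact h2.2 n h6 h5
    · have h7 := walk_glue_add T (n - T) ω ω'
      rw [show T + (n - T) = n by omega] at h7
      rw [h7, add_assoc] at h5
      exact h3 (n - T) (by omega) (add_left_cancel h5)
  · rw [walk_glue_add, add_assoc, add_sub_add_left_eq_sub]
    exact h4

/-- Every point of the range is the starting point, a point of `Q`, or is discovered. -/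
lemma card_pathRange_le (s : ℕ → Fin d → ℤ) (Q : Finset (Fin d → ℤ)) (N : ℕ)
    [DecidablePred fun j => s (j + 1) ∉ (Q : Set (Fin d → ℤ)) ∧ ∀ i ≤ j, s i ≠ s (j + 1)] :
    (pathRange s N).card ≤ 1 + Q.card + ((Finset.range N).filter fun j =>
      s (j + 1) ∉ (Q : Set (Fin d → ℤ)) ∧ ∀ i ≤ j, s i ≠ s (j + 1)).card := by
  classical
  have h : pathRange s N ⊆ ({s 0} ∪ Q) ∪ ((Finset.range N).filter fun j =>
      s (j + 1) ∉ (Q : Set (Fin d → ℤ)) ∧ ∀ i ≤ j, s i ≠ s (j + 1)).image fun j => s (j + 1) := by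
    intro y hy
    have hex : ∃ j, j < N + 1 ∧ s j = y := by
      simpa only [pathRange, Finset.mem_image, Finset.mem_range] using hy
    obtain ⟨hj, hjy⟩ := Nat.find_spec hex
    have hmin : ∀ i < Nat.find hex, s i ≠ y := fun i hi h0 =>
      Nat.find_min hex hi ⟨by omega, h0⟩
    generalize Nat.find hex = j at hj hjy hmin
    simp only [Finset.mem_union, Finset.mem_singleton, Finset.mem_image, Finset.mem_filter,
      Finset.mem_range]
    by_cases hQ : y ∈ Q
    · exact Or.inl (Or.inr hQ)
    cases j with
    | zero => exact Or.inl (Or.inl hjy.symm)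
    | succ j =>
      refine Or.inr ⟨j, ⟨by omega, by rw [hjy]; exact_mod_cast hQ, fun i hi => ?_⟩, hjy⟩
      rw [hjy]
      exact hmin i (by omega)
  refine (Finset.card_le_card h).trans ((Finset.card_union_le _ _).trans ?_)
  refine add_le_add ((Finset.card_union_le _ _).trans ?_) Finset.card_image_le
  simp

/-- Counting in blocks of length `W`, and leaving out the last `s` times of each of them. -/
lemma sum_range_blocks_le (f : ℕ → ℝ) (hf1 : ∀ j, f j ≤ 1) (W s B : ℕ) :
    ∑ j ∈ Finset.range (B * W), f j ≤
      ∑ i ∈ Finset.range B, ∑ j ∈ Finset.range (W - s), f (i * W + j) + B * s := by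
  induction B with
  | zero => simp
  | succ B ih =>
    have h1 : ∑ j ∈ Finset.range W, f (B * W + j) ≤
        ∑ j ∈ Finset.range (W - s), f (B * W + j) + s := by
      rw [← Finset.sum_range_add_sum_Ico _ (Nat.sub_le W s)]
      gcongr
      refine (Finset.sum_le_sum fun j _ => hf1 _).trans ?_
      rw [Finset.sum_const, Nat.card_Ico, nsmul_eq_mul, mul_one]
      exact_mod_cast (by omega : W - (W - s) ≤ s)
    rw [Nat.succ_mul, Finset.sum_range_add, Finset.sum_range_succ]
    push_cast
    linarith

section Search

variable [NeZero d]

/-- One more block: given the past, the bound on a block applies to the walk started afresh, with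
the points visited in the past added to the forbidden ones. -/
lemma block_step {W k n : ℕ} {ρ : ℤ} {b c : ℝ} (hb : 0 ≤ b) (hc : 0 ≤ c)
    (hblock : ∀ Q : Set (Fin d → ℤ), b * ∑ j ∈ Finset.range n, (noiseLaw d).real (newStep Q j) ≤
      W * ((noiseLaw d).real (success Q W k ρ) + c)) (Q : Set (Fin d → ℤ)) (i : ℕ) :
    b * ∑ j ∈ Finset.range n, (noiseLaw d).real (noSuccess Q W k ρ i ∩ newStep Q (i * W + j)) ≤
      W * ((noiseLaw d).real (noSuccess Q W k ρ i) -
        (noiseLaw d).real (noSuccess Q W k ρ (i + 1)) + c) := by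
  have hN := (detBy_noSuccess Q W k ρ i).measurableSet
  have hS := (detBy_success Q ((i + 1) * W) k ρ).measurableSet
  have hD : ∀ j, MeasurableSet (newStep Q (i * W + j)) := fun j =>
    (detBy_newStep Q (i * W + j)).measurableSet
  let I : Set (Noise d) → Noise d → ℝ := fun E => E.indicator fun _ => 1
  have hI : ∀ E, MeasurableSet E → Integrable (I E) (noiseLaw d) := fun E hE =>
    (integrable_const _).indicator hE
  have hint : ∀ E, MeasurableSet E → ∫ ω, I E ω ∂(noiseLaw d) = (noiseLaw d).real E :=
    fun E hE => by rw [integral_indicator_const _ hE, smul_eq_mul, mul_one]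
  -- failing in `i` blocks but not in `i + 1` of them is a success in the block `i + 1`
  have hdiff : (noiseLaw d).real (noSuccess Q W k ρ i) -
      (noiseLaw d).real (noSuccess Q W k ρ (i + 1)) =
      (noiseLaw d).real (noSuccess Q W k ρ i ∩ success Q ((i + 1) * W) k ρ) := by
    have h1 : noSuccess Q W k ρ (i + 1) =
        noSuccess Q W k ρ i \ success Q ((i + 1) * W) k ρ := by
      ext ω
      constructor
      · intro h
        exact ⟨noSuccess_anti Q W k ρ (Nat.le_succ i) h, h (i + 1) (by omega) le_rfl⟩
      · rintro ⟨h2, h3⟩ m hm hmi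
        rcases Nat.lt_or_ge m (i + 1) with h4 | h4
        · exact h2 m hm (by omega)
        · obtain rfl : m = i + 1 := by omega
          exact h3
    rw [h1, ← measureReal_inter_add_sdiff hS (s := noSuccess Q W k ρ i)]
    ring
  have hf : Integrable (fun ω => b * ∑ j ∈ Finset.range n,
      I (noSuccess Q W k ρ i ∩ newStep Q (i * W + j)) ω) (noiseLaw d) :=
    (integrable_finsetSum _ fun j _ => hI _ (hN.inter (hD j))).const_mul b
  have hg : Integrable (fun ω => W * (I (noSuccess Q W k ρ i ∩ success Q ((i + 1) * W) k ρ) ω + c))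
      (noiseLaw d) :=
    ((hI _ (hN.inter hS)).add (integrable_const c)).const_mul _
  have key := integral_le_of_glue (isStop_const (i * W)) hf hg ?_
  · rw [integral_const_mul, integral_const_mul,
      integral_finsetSum _ fun j _ => hI _ (hN.inter (hD j)),
      integral_add (hI _ (hN.inter hS)) (integrable_const c), hint _ (hN.inter hS)] at key
    simp only [hint _ (hN.inter (hD _)), integral_const, probReal_univ, one_smul] at key
    rw [hdiff]
    exact key
  intro ω
  have hsec : ∀ E : Set (Noise d), (fun ω' => I E (glue (i * W) ω ω')) =
      I {ω' | glue (i * W) ω ω' ∈ E} := by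
    intro E; funext ω'; rfl
  have hsecm : ∀ E : Set (Noise d), MeasurableSet E →
      MeasurableSet {ω' | glue (i * W) ω ω' ∈ E} := fun E hE =>
    ((measurable_glue (i * W)).comp (measurable_const.prodMk measurable_id)) hE
  rw [integral_const_mul, integral_const_mul, integral_finsetSum _ fun j _ => by
    rw [hsec]; exact hI _ (hsecm _ (hN.inter (hD j))),
    integral_add (by rw [hsec]; exact hI _ (hsecm _ (hN.inter hS))) (integrable_const c)]
  simp only [hsec, hint _ (hsecm _ (hN.inter (hD _))), hint _ (hsecm _ (hN.inter hS)),
    integral_const, probReal_univ, one_smul]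
  by_cases hω : ω ∈ noSuccess Q W k ρ i
  · refine le_trans ?_ ((hblock (residual Q ω (i * W))).trans ?_)
    · exact mul_le_mul_of_nonneg_left (Finset.sum_le_sum fun j _ =>
        measureReal_mono fun ω' hω' => newStep_of_glue hω'.2) hb
    · refine mul_le_mul_of_nonneg_left (add_le_add_left (measureReal_mono fun ω' hω' => ?_) c)
        (Nat.cast_nonneg _)
      refine ⟨((detBy_noSuccess Q W k ρ i).glue_mem_iff ω ω').2 hω, ?_⟩
      rw [show (i + 1) * W = i * W + W by ring]
      exact success_glue hω'
  · have h1 : ∀ j, {ω' | glue (i * W) ω ω' ∈ noSuccess Q W k ρ i ∩ newStep Q (i * W + j)} = ∅ := by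
      intro j
      refine Set.eq_empty_of_forall_notMem fun ω' hω' => ?_
      exact hω (((detBy_noSuccess Q W k ρ i).glue_mem_iff ω ω').1 hω'.1)
    simp only [h1, measureReal_empty, Finset.sum_const_zero, mul_zero]
    positivity

/-- The search through `B` blocks fails with a small probability, unless the walk has a small
range. -/
lemma measure_noSuccess_le {W k s B : ℕ} {ρ : ℤ} {b c : ℝ} (hb : 0 ≤ b) (hc : 0 ≤ c)
    (hblock : ∀ Q : Set (Fin d → ℤ),
      b * ∑ j ∈ Finset.range (W - s), (noiseLaw d).real (newStep Q j) ≤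
        W * ((noiseLaw d).real (success Q W k ρ) + c)) (Q : Finset (Fin d → ℤ)) {R : ℝ}
    (hR : 2 * (1 + Q.card + B * s) ≤ R) :
    b * (R / 2) * (noiseLaw d).real (noSuccess (Q : Set (Fin d → ℤ)) W k ρ B ∩
      {ω | R ≤ (pathRange (walk ω) (B * W)).card}) ≤ W * (1 + B * c) := by
  classical
  set Qs : Set (Fin d → ℤ) := (Q : Set (Fin d → ℤ)) with hQs
  let N := noSuccess Qs W k ρ
  let E : ℕ → ℕ → Set (Noise d) := fun i j => N i ∩ newStep Qs (i * W + j)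
  have hE : ∀ i j, MeasurableSet (E i j) := fun i j =>
    (detBy_noSuccess Qs W k ρ i).measurableSet.inter (detBy_newStep Qs _).measurableSet
  let I : Set (Noise d) → Noise d → ℝ := fun E => E.indicator fun _ => 1
  have hI : ∀ E, MeasurableSet E → Integrable (I E) (noiseLaw d) := fun E hE =>
    (integrable_const _).indicator hE
  have hint : ∀ E, MeasurableSet E → ∫ ω, I E ω ∂(noiseLaw d) = (noiseLaw d).real E :=
    fun E hE => by rw [integral_indicator_const _ hE, smul_eq_mul, mul_one]
  have h1 : (R / 2) * (noiseLaw d).real (N B ∩ {ω | R ≤ (pathRange (walk ω) (B * W)).card}) ≤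
      ∑ i ∈ Finset.range B, ∑ j ∈ Finset.range (W - s), (noiseLaw d).real (E i j) := by
    have h2 : ∑ i ∈ Finset.range B, ∑ j ∈ Finset.range (W - s), (noiseLaw d).real (E i j) =
        ∫ ω, ∑ i ∈ Finset.range B, ∑ j ∈ Finset.range (W - s), I (E i j) ω ∂(noiseLaw d) := by
      rw [integral_finsetSum _ fun i _ => integrable_finsetSum _ fun j _ => hI _ (hE i j)]
      refine Finset.sum_congr rfl fun i _ => ?_
      rw [integral_finsetSum _ fun j _ => hI _ (hE i j)]
      exact Finset.sum_congr rfl fun j _ => (hint _ (hE i j)).symm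
    rw [h2]
    -- Markov's inequality for the number of discoveries made before the first success; without a
    -- success and with a range of size `R` it is at least `R / 2`
    have h3 := mul_meas_ge_le_integral_of_nonneg (μ := noiseLaw d)
      (f := fun ω => ∑ i ∈ Finset.range B, ∑ j ∈ Finset.range (W - s), I (E i j) ω)
      (ae_of_all _ fun ω => Finset.sum_nonneg fun i _ => Finset.sum_nonneg fun j _ =>
        Set.indicator_nonneg (fun _ _ => zero_le_one) _)
      (integrable_finsetSum _ fun i _ => integrable_finsetSum _ fun j _ => hI _ (hE i j)) (R / 2)
    refine le_trans (mul_le_mul_of_nonneg_left (measureReal_mono ?_) ?_) h3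
    · rintro ω ⟨hω, hωR⟩
      have hωR : R ≤ (pathRange (walk ω) (B * W)).card := hωR
      change R / 2 ≤ ∑ i ∈ Finset.range B, ∑ j ∈ Finset.range (W - s), I (E i j) ω
      have h4 := card_pathRange_le (walk ω) Q (B * W)
      have h5 : (((Finset.range (B * W)).filter fun j => walk ω (j + 1) ∉ (Q : Set (Fin d → ℤ)) ∧
          ∀ i ≤ j, walk ω i ≠ walk ω (j + 1)).card : ℝ) =
          ∑ j ∈ Finset.range (B * W), I (newStep Qs j) ω := by
        rw [Finset.card_filter]
        push_cast
        refine Finset.sum_congr rfl fun j _ => ?_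
        simp only [I, Set.indicator_apply]
        exact if_congr Iff.rfl rfl rfl
      have h6 := sum_range_blocks_le (fun j => I (newStep Qs j) ω)
        (fun j => Set.indicator_le_self' (fun _ _ => zero_le_one) _) W s B
      have h7 : ∀ i ∈ Finset.range B, ∀ j, I (newStep Qs (i * W + j)) ω = I (E i j) ω := by
        intro i hi j
        have hNi : ω ∈ N i := noSuccess_anti Qs W k ρ (Finset.mem_range.1 hi).le hω
        simp only [I, E, Set.indicator_apply, Set.mem_inter_iff, hNi, true_and]
      rw [Finset.sum_congr rfl fun i hi => Finset.sum_congr rfl fun j _ => h7 i hi j, ← h5] at h6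
      have h8 : ((pathRange (walk ω) (B * W)).card : ℝ) ≤ 1 + Q.card +
        (((Finset.range (B * W)).filter fun j => walk ω (j + 1) ∉ (Q : Set (Fin d → ℤ)) ∧
          ∀ i ≤ j, walk ω i ≠ walk ω (j + 1)).card : ℝ) := by exact_mod_cast h4
      linarith
    · have : (0 : ℝ) ≤ 1 + Q.card + B * s := by positivity
      linarith
  have h2 : b * ∑ i ∈ Finset.range B, ∑ j ∈ Finset.range (W - s), (noiseLaw d).real (E i j) ≤
      W * (1 + B * c) := by
    rw [Finset.mul_sum]
    -- the probabilities of a first success in the several blocks telescope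
    calc _ ≤ ∑ i ∈ Finset.range B, W * ((noiseLaw d).real (N i) -
          (noiseLaw d).real (N (i + 1)) + c) :=
          Finset.sum_le_sum fun i _ => block_step hb hc hblock Qs i
      _ = W * (((noiseLaw d).real (N 0) - (noiseLaw d).real (N B)) + B * c) := by
          rw [← Finset.mul_sum, Finset.sum_add_distrib, Finset.sum_range_sub']
          simp
      _ ≤ _ := by
          gcongr
          have h3 : (noiseLaw d).real (N 0) ≤ 1 := measureReal_le_one
          have h4 : 0 ≤ (noiseLaw d).real (N B) := measureReal_nonneg
          linarith
  calc _ = b * ((R / 2) * (noiseLaw d).real (N B ∩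
        {ω | R ≤ (pathRange (walk ω) (B * W)).card})) := by ring
    _ ≤ _ := (mul_le_mul_of_nonneg_left h1 hb).trans h2

end Search

/-! ### Two candidates far apart -/

/-- The lattice point `z` is at sup-distance at least `ρ` from the origin. -/
def Far (ρ : ℤ) (z : Fin d → ℤ) : Prop := ∃ i, ρ ≤ |z i|

lemma far_sub_comm {ρ : ℤ} {x y : Fin d → ℤ} (h : Far ρ (x - y)) : Far ρ (y - x) := by
  obtain ⟨i, hi⟩ := h
  refine ⟨i, ?_⟩
  rw [Pi.sub_apply] at hi ⊢
  rwa [abs_sub_comm]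

/-- The function `f` only depends on the steps made before the stopping time `τ`. -/
def PastDet {α : Type*} (τ : Noise d → ℕ) (f : Noise d → α) : Prop :=
  ∀ ω ω' : Noise d, (∀ i < τ ω, ω' i = ω i) → f ω' = f ω

/-- A random candidate `c`, chosen at time `τ`, and a fixed point `z` are both hit: the candidate
between the times `τ` and `H`, the point `z` before `H`. -/
def bothHit (τ : Noise d → ℕ) (c : Noise d → Option (Fin d → ℤ)) (z : Fin d → ℤ) (H : ℕ) :
    Set (Noise d) :=
  {ω | ∃ b, c ω = some b ∧ (∃ t < H, walk ω t = z) ∧ ∃ u < H, τ ω ≤ u ∧ walk ω u = b}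

lemma IsStop.max {σ τ : Noise d → ℕ} (hσ : IsStop σ) (hτ : IsStop τ) :
    IsStop fun ω => max (σ ω) (τ ω) := by
  intro ω ω' h
  simp only
  rw [hσ ω ω' fun i hi => h i (hi.trans_le (le_max_left _ _)),
    hτ ω ω' fun i hi => h i (hi.trans_le (le_max_right _ _))]

section TwoHits

variable [NeZero d]

/-- A candidate chosen at time `τ` far from the walk is hit with a small probability. -/
lemma measure_candidate_hit_le {τ : Noise d → ℕ} (hτ : IsStop τ) {T H : ℕ} (hT : ∀ ω, τ ω ≤ T)
    {c : Noise d → Option (Fin d → ℤ)} (hc : PastDet τ c) {ρ : ℤ} {η : ℝ} (hη : 0 ≤ η)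
    (hhit : ∀ z : Fin d → ℤ, Far ρ z → (noiseLaw d).real (hits z H) ≤ η)
    (hfar : ∀ ω b, c ω = some b → Far ρ (b - walk ω (τ ω))) :
    (noiseLaw d).real {ω | ∃ b, c ω = some b ∧ ∃ u < H, τ ω ≤ u ∧ walk ω u = b} ≤ η := by
  have hmeas : DetBy (max H T)
      {ω : Noise d | ∃ b, c ω = some b ∧ ∃ u < H, τ ω ≤ u ∧ walk ω u = b} := by
    rintro ω ω' h ⟨b, h1, u, hu, h2, h3⟩
    have hpast : ∀ i < τ ω, ω' i = ω i := fun i hi =>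
      h i (hi.trans_le ((hT ω).trans (le_max_right _ _)))
    refine ⟨b, by rw [hc ω ω' hpast, h1], u, hu, by rwa [hτ ω ω' hpast], ?_⟩
    rw [walk_congr fun i hi => h i ((hi.trans hu).trans_le (le_max_left _ _)), h3]
  refine (measure_le_mul_of_glue hτ MeasurableSet.univ hmeas.measurableSet hη
    (fun ω _ h => absurd (Set.mem_univ ω) h) fun ω _ => ?_).trans ?_
  · rcases hb : c ω with _ | b
    · have : {ω' | glue (τ ω) ω ω' ∈ {ω : Noise d | ∃ b, c ω = some b ∧
          ∃ u < H, τ ω ≤ u ∧ walk ω u = b}} = ∅ := by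
        refine Set.eq_empty_of_forall_notMem ?_
        rintro ω' ⟨b, h1, _⟩
        rw [hc ω _ fun i hi => glue_apply_of_lt hi _ _, hb] at h1
        cases h1
      rw [this]; simpa using hη
    · refine le_trans (measureReal_mono ?_) (hhit _ (hfar ω b hb))
      rintro ω' ⟨b', h1, u, hu, h2, h3⟩
      rw [hc ω _ fun i hi => glue_apply_of_lt hi _ _, hb] at h1
      obtain rfl := Option.some.inj h1
      rw [hτ.glue_eq] at h2
      refine ⟨u - τ ω, by omega, ?_⟩
      have h4 := walk_glue_add (τ ω) (u - τ ω) ω ω'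
      rw [show τ ω + (u - τ ω) = u by omega, h3] at h4
      exact eq_sub_of_add_eq' h4.symm
  · exact mul_le_of_le_one_right hη measureReal_le_one

/-- A fixed point and a candidate, far from each other and from the walk, are both hit only with a
probability of the second order: whichever is hit last is far from the walk when the other one has
been hit. -/
lemma measure_bothHit_le {τ : Noise d → ℕ} (hτ : IsStop τ) {T H : ℕ} (hT : ∀ ω, τ ω ≤ T)
    {c : Noise d → Option (Fin d → ℤ)} (hc : PastDet τ c) {ρ : ℤ} {η : ℝ} (hη : 0 ≤ η)
    (hhit : ∀ z : Fin d → ℤ, Far ρ z → (noiseLaw d).real (hits z H) ≤ η)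
    {z : Fin d → ℤ} (hz : Far ρ z)
    (hfar : ∀ ω b, c ω = some b → Far ρ (b - walk ω (τ ω)))
    (hfarz : ∀ ω b, c ω = some b → Far ρ (b - z)) :
    (noiseLaw d).real (bothHit τ c z H) ≤ 2 * η ^ 2 := by
  let P : ℕ → Set (Noise d) := fun t => {ω | walk ω t = z}
  have hP : ∀ t, DetBy t (P t) := fun t => detBy_walk_eq le_rfl z
  -- `T₁` and `T₂` are the hitting times of `z` and of the candidate, the latter after time `τ`
  let T₁ := firstTime P H
  have hT₁ : IsStop T₁ := isStop_firstTime hP H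
  let P' : ℕ → Set (Noise d) := fun t => {ω | τ ω ≤ t ∧ c ω = some (walk ω t)}
  have hP' : ∀ t, DetBy t (P' t) := by
    rintro t ω ω' h ⟨h1, h2⟩
    have hpast : ∀ i < τ ω, ω' i = ω i := fun i hi => h i (hi.trans_le h1)
    exact ⟨by rwa [hτ ω ω' hpast], by rw [hc ω ω' hpast, h2, walk_congr h]⟩
  let T₂ := firstTime P' H
  have hT₂ : IsStop T₂ := isStop_firstTime hP' H
  let σ : Noise d → ℕ := fun ω => max (T₁ ω) (τ ω)
  have hσ : IsStop σ := hT₁.max hτ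
  -- `EA`: the candidate is hit after `z`; `EB`: `z` is hit after the candidate. When `z` is hit
  -- before the candidate has been chosen, the walk is restarted at time `τ` only.
  let EA : Set (Noise d) := {ω | T₁ ω < H ∧ ∃ b, c ω = some b ∧ ∃ u < H, σ ω ≤ u ∧ walk ω u = b}
  let EB : Set (Noise d) := {ω | (T₂ ω < H ∧ ω ∈ P' (T₂ ω)) ∧ ∃ t < H, T₂ ω ≤ t ∧ walk ω t = z}
  have hsub : bothHit τ c z H ⊆ EA ∪ EB := by
    rintro ω ⟨b, hb, ⟨t, ht, htz⟩, u, hu, hτu, hub⟩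
    have h1 : T₁ ω ≤ t := firstTime_le_of_mem (P := P) htz
    have h1z : walk ω (T₁ ω) = z := mem_firstTime (P := P) htz ht.le
    by_cases h2 : σ ω ≤ u
    · exact Or.inl ⟨by omega, b, hb, u, hu, h2, hub⟩
    · have h3 : u < T₁ ω := by
        by_contra hc
        exact h2 (max_le (not_lt.1 hc) hτu)
      have h4 : ω ∈ P' u := ⟨hτu, by rw [hub, hb]⟩
      have h5 : T₂ ω ≤ u := firstTime_le_of_mem h4
      exact Or.inr ⟨⟨by omega, mem_firstTime h4 hu.le⟩, T₁ ω, by omega, by omega, h1z⟩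
  have hpastn : ∀ ω ω' : Noise d, (∀ i < max H T, ω' i = ω i) → T₁ ω' = T₁ ω ∧ T₂ ω' = T₂ ω ∧
      τ ω' = τ ω ∧ c ω' = c ω ∧ ∀ t < H, walk ω' t = walk ω t := by
    intro ω ω' h
    have a1 : T₁ ω ≤ H := firstTime_le _ _ _
    have a2 : T₂ ω ≤ H := firstTime_le _ _ _
    have hp : ∀ i < τ ω, ω' i = ω i := fun i hi =>
      h i (hi.trans_le ((hT ω).trans (le_max_right _ _)))
    exact ⟨hT₁ ω ω' fun i hi => h i (by omega), hT₂ ω ω' fun i hi => h i (by omega),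
      hτ ω ω' hp, hc ω ω' hp, fun t ht => walk_congr fun i hi => h i (by omega)⟩
  have hEAm : MeasurableSet EA := by
    refine DetBy.measurableSet (n := max H T) ?_
    rintro ω ω' h ⟨h1, b, hb, u, hu, h2, h3⟩
    obtain ⟨e1, _, e3, e4, e5⟩ := hpastn ω ω' h
    refine ⟨by rwa [e1], b, by rwa [e4], u, hu, ?_, by rwa [e5 u hu]⟩
    change max (T₁ ω') (τ ω') ≤ u
    rw [e1, e3]; exact h2
  have hBm : MeasurableSet {ω : Noise d | T₂ ω < H ∧ ω ∈ P' (T₂ ω)} := by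
    refine DetBy.measurableSet (n := max H T) ?_
    rintro ω ω' h ⟨h1, h2, h3⟩
    obtain ⟨_, e2, e3, e4, e5⟩ := hpastn ω ω' h
    refine ⟨by rwa [e2], ?_⟩
    rw [e2]
    exact ⟨by rwa [e3], by rw [e4, e5 _ h1, h3]⟩
  have hEBm : MeasurableSet EB := by
    refine DetBy.measurableSet (n := max H T) ?_
    rintro ω ω' h ⟨⟨h1, h2, h3⟩, t, ht, h4, h5⟩
    obtain ⟨_, e2, e3, e4, e5⟩ := hpastn ω ω' h
    refine ⟨⟨by rwa [e2], ?_⟩, t, ht, by rwa [e2], by rw [e5 t ht, h5]⟩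
    rw [e2]
    exact ⟨by rwa [e3], by rw [e4, e5 _ h1, h3]⟩
  have hA1 : MeasurableSet {ω : Noise d | T₁ ω < H} := hT₁.measurable (measurableSet_Iio)
  have hA2 : (noiseLaw d).real {ω : Noise d | T₁ ω < H} ≤ η := by
    refine le_trans (measureReal_mono ?_) (hhit z hz)
    intro ω hω
    have hω : T₁ ω < H := hω
    refine ⟨T₁ ω, hω, ?_⟩
    rcases firstTime_mem_or P H ω with h | h
    · exact h
    · have : T₁ ω = H := h
      omega
  have hEA : (noiseLaw d).real EA ≤ η * η := by
    refine (measure_le_mul_of_glue hσ hA1 hEAm hη ?_ ?_).trans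
      (mul_le_mul_of_nonneg_left hA2 hη)
    · rintro ω ω' hω ⟨h1, _⟩
      apply hω
      have h2 : T₁ (glue (σ ω) ω ω') = T₁ ω := hT₁ ω _ fun i hi =>
        glue_apply_of_lt (hi.trans_le (le_max_left _ _)) _ _
      rw [h2] at h1; exact h1
    · intro ω hω
      have hω : T₁ ω < H := hω
      have hcg : ∀ ω', c (glue (σ ω) ω ω') = c ω := fun ω' => hc ω _ fun i hi =>
        glue_apply_of_lt (hi.trans_le (le_max_right _ _)) _ _
      rcases hb : c ω with _ | b
      · have : {ω' | glue (σ ω) ω ω' ∈ EA} = ∅ := by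
          refine Set.eq_empty_of_forall_notMem ?_
          rintro ω' ⟨_, b, h1, _⟩
          rw [hcg, hb] at h1
          cases h1
        rw [this]; simpa using hη
      · have hF : Far ρ (b - walk ω (σ ω)) := by
          rcases le_total (T₁ ω) (τ ω) with h | h
          · have : σ ω = τ ω := max_eq_right h
            rw [this]; exact hfar ω b hb
          · have h1 : σ ω = T₁ ω := max_eq_left h
            have h2 : walk ω (T₁ ω) = z := by
              rcases firstTime_mem_or P H ω with h3 | h3
              · exact h3
              · have : T₁ ω = H := h3
                omega
            rw [h1, h2]; exact hfarz ω b hb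
        refine le_trans (measureReal_mono ?_) (hhit _ hF)
        rintro ω' ⟨_, b', h1, u, hu, h2, h3⟩
        rw [hcg, hb] at h1
        obtain rfl := Option.some.inj h1
        rw [hσ.glue_eq] at h2
        refine ⟨u - σ ω, by omega, ?_⟩
        have h4 := walk_glue_add (σ ω) (u - σ ω) ω ω'
        rw [show σ ω + (u - σ ω) = u by omega, h3] at h4
        exact eq_sub_of_add_eq' h4.symm
  have hB2 : (noiseLaw d).real {ω : Noise d | T₂ ω < H ∧ ω ∈ P' (T₂ ω)} ≤ η := by
    refine le_trans (measureReal_mono ?_) (measure_candidate_hit_le hτ hT hc hη hhit hfar)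
    rintro ω ⟨h1, h2, h3⟩
    exact ⟨_, h3, T₂ ω, h1, h2, rfl⟩
  have hEB : (noiseLaw d).real EB ≤ η * η := by
    refine (measure_le_mul_of_glue hT₂ hBm hEBm hη ?_ ?_).trans
      (mul_le_mul_of_nonneg_left hB2 hη)
    · rintro ω ω' hω ⟨⟨h1, h2⟩, _⟩
      apply hω
      rw [hT₂.glue_eq] at h1 h2
      exact ⟨h1, ((hP' (T₂ ω)).glue_mem_iff ω ω').1 h2⟩
    · rintro ω ⟨_, _, h2⟩
      refine le_trans (measureReal_mono ?_) (hhit _ (far_sub_comm (hfarz ω _ h2)))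
      rintro ω' ⟨_, t, ht, h3, h4⟩
      rw [hT₂.glue_eq] at h3
      refine ⟨t - T₂ ω, by omega, ?_⟩
      have h5 := walk_glue_add (T₂ ω) (t - T₂ ω) ω ω'
      rw [show T₂ ω + (t - T₂ ω) = t by omega, h4] at h5
      exact eq_sub_of_add_eq' h5.symm
  have h1 := (measureReal_mono (μ := noiseLaw d) hsub).trans (measureReal_union_le _ _)
  linarith [sq η]

end TwoHits

/-- The point `b` witnesses a success at time `T`. -/
def IsCandidate (Q : Set (Fin d → ℤ)) (T k : ℕ) (ρ : ℤ) (ω : Noise d) (b : Fin d → ℤ) : Prop :=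
  ∃ (x : Fin d → ℤ) (e : Step d), b = x + stepVec e ∧ k ≤ visits (walk ω) T x ∧ b ∉ Q ∧
    (∀ i ≤ T, walk ω i ≠ b) ∧ Far ρ (b - walk ω T)

lemma isCandidate_congr {Q : Set (Fin d → ℤ)} {T k : ℕ} {ρ : ℤ} {ω ω' : Noise d}
    (h : ∀ i < T, ω' i = ω i) (b : Fin d → ℤ) :
    IsCandidate Q T k ρ ω' b ↔ IsCandidate Q T k ρ ω b := by
  have hw : ∀ i ≤ T, walk ω' i = walk ω i := fun i hi =>
    walk_congr fun m hm => h m (hm.trans_le hi)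
  have h1 : (∀ i ≤ T, walk ω' i ≠ b) ↔ ∀ i ≤ T, walk ω i ≠ b :=
    forall₂_congr fun i hi => by rw [hw i hi]
  simp only [IsCandidate, visits_congr h, hw T le_rfl, h1]

open Classical in
/-- A chosen element satisfying a predicate, if there is one. -/
def pick {α : Type*} (p : α → Prop) : Option α := if h : ∃ a, p a then some h.choose else none

lemma pick_spec {α : Type*} {p : α → Prop} {a : α} (h : pick p = some a) : p a := by
  unfold pick at h
  split_ifs at h with h1
  rw [← Option.some.inj h]
  exact h1.choose_spec

lemma not_exists_of_pick_eq_none {α : Type*} {p : α → Prop} (h : pick p = none) : ¬ ∃ a, p a := by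
  unfold pick at h
  split_ifs at h with h1
  exact h1

/-- The first successful block yields a stopping time and a candidate chosen at that time. -/
lemma exists_candidate (Q : Set (Fin d → ℤ)) (W k : ℕ) (ρ : ℤ) (B : ℕ) :
    ∃ (τ : Noise d → ℕ) (c : Noise d → Option (Fin d → ℤ)), IsStop τ ∧ (∀ ω, τ ω ≤ B * W) ∧
      PastDet τ c ∧ (∀ ω b, c ω = some b → IsCandidate Q (τ ω) k ρ ω b) ∧
      {ω | c ω = none} ⊆ noSuccess Q W k ρ B := by
  let P : ℕ → Set (Noise d) := fun t =>
    {ω | ∃ i, 1 ≤ i ∧ i ≤ B ∧ t = i * W ∧ ω ∈ success Q t k ρ}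
  have hP : ∀ t, DetBy t (P t) := by
    rintro t ω ω' h ⟨i, h1, h2, h3, h4⟩
    exact ⟨i, h1, h2, h3, detBy_success Q t k ρ ω ω' h h4⟩
  let τ := firstTime P (B * W)
  have hτ : IsStop τ := isStop_firstTime hP _
  refine ⟨τ, fun ω => pick (IsCandidate Q (τ ω) k ρ ω), hτ, firstTime_le _ _, ?_,
    fun ω b h => pick_spec h, ?_⟩
  · intro ω ω' h
    simp only
    rw [hτ ω ω' h]
    congr 1
    funext b
    exact propext (isCandidate_congr h b)
  · intro ω hω i hi hiB hs
    refine not_exists_of_pick_eq_none hω ?_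
    have h1 : ω ∈ P (i * W) := ⟨i, hi, hiB, rfl, hs⟩
    obtain ⟨_, _, _, _, x, e, h2, h3, h4, h5⟩ :=
      mem_firstTime h1 (Nat.mul_le_mul_right W hiB)
    exact ⟨x + stepVec e, x, e, rfl, h2, h3, h4, h5⟩

/-- Some point has at least `k` visits at time `N`, and a neighbour not visited before `H`. -/
def lasting (d k N H : ℕ) : Set (Noise d) :=
  {ω | ∃ (x : Fin d → ℤ) (e : Step d), k ≤ visits (walk ω) N x ∧ ∀ t < H, walk ω t ≠ x + stepVec e}

lemma detBy_lasting_compl (d k N H : ℕ) : DetBy (max N H) (lasting d k N H)ᶜ := by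
  rintro ω ω' h hω ⟨x, e, h1, h2⟩
  refine hω ⟨x, e, ?_, fun t ht => ?_⟩
  · rwa [visits_congr fun i hi => h i (hi.trans_le (le_max_left _ _))] at h1
  · have h3 := h2 t ht
    rwa [walk_congr fun i hi => h i ((hi.trans ht).trans_le (le_max_right _ _))] at h3

lemma exists_ball (z : Fin d → ℤ) (ρ : ℕ) : ∃ S : Finset (Fin d → ℤ), S.card ≤ (2 * ρ) ^ d ∧
    ∀ y, ¬ Far (ρ : ℤ) (y - z) → y ∈ S := by
  refine ⟨Fintype.piFinset fun i => Finset.Ioo (z i - ρ) (z i + ρ), ?_, fun y hy => ?_⟩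
  · rw [Fintype.card_piFinset]
    refine (Finset.prod_le_prod' (g := fun _ => 2 * ρ) fun i _ => ?_).trans_eq (by simp)
    rw [Int.card_Ioo]; omega
  · rw [Fintype.mem_piFinset]
    intro i
    simp only [Far, not_exists, not_le] at hy
    have := abs_lt.1 (hy i)
    rw [Pi.sub_apply] at this
    rw [Finset.mem_Ioo]
    constructor <;> linarith [this.1, this.2]

/-- Two searches in a row produce two candidates, and at least one of them survives with high
probability. -/
lemma measure_lasting_compl_le [NeZero d] {W k B₁ B₂ H ρ N : ℕ} {δ₁ δ₂ η : ℝ} (hδ : 0 ≤ δ₂)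
    (hη : 0 ≤ η)
    (hhit : ∀ z : Fin d → ℤ, Far (ρ : ℤ) z → (noiseLaw d).real (hits z H) ≤ η)
    (h₁ : (noiseLaw d).real (noSuccess (∅ : Set (Fin d → ℤ)) W k ρ B₁) ≤ δ₁)
    (h₂ : ∀ Q : Finset (Fin d → ℤ), Q.card ≤ B₁ * W + 1 + (2 * ρ) ^ d →
      (noiseLaw d).real (noSuccess (Q : Set (Fin d → ℤ)) W k ρ B₂) ≤ δ₂)
    (hN : B₁ * W + B₂ * W ≤ N) :
    (noiseLaw d).real (lasting d k N H)ᶜ ≤ δ₁ + δ₂ + 2 * η ^ 2 := by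
  classical
  obtain ⟨τ, c, hτ, hτB, hc, hcand, hnone⟩ := exists_candidate (∅ : Set (Fin d → ℤ)) W k ρ B₁
  have hbad : MeasurableSet ((lasting d k N H)ᶜ : Set (Noise d)) :=
    (detBy_lasting_compl d k N H).measurableSet
  have hsome : DetBy (B₁ * W) {ω | c ω ≠ none} := by
    intro ω ω' h hω
    change c ω' ≠ none
    rw [hc ω ω' fun i hi => h i (hi.trans_le (hτB ω))]
    exact hω
  have hcg : ∀ ω ω', c (glue (τ ω) ω ω') = c ω := fun ω ω' =>
    hc ω _ fun i hi => glue_apply_of_lt hi _ _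
  have hmain : (noiseLaw d).real ((lasting d k N H)ᶜ ∩ {ω | c ω ≠ none}) ≤ δ₂ + 2 * η ^ 2 := by
    refine (measure_le_mul_of_glue hτ hsome.measurableSet (hbad.inter hsome.measurableSet)
      (c := δ₂ + 2 * η ^ 2) (by positivity) ?_ ?_).trans
      (mul_le_of_le_one_right (by positivity) measureReal_le_one)
    · rintro ω ω' hω ⟨_, h⟩
      apply hω
      have h : c (glue (τ ω) ω ω') ≠ none := h
      rw [hcg] at h; exact h
    intro ω hω
    obtain ⟨b₁, hb₁⟩ := Option.ne_none_iff_exists'.1 hω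
    obtain ⟨x₁, e₁, rfl, hv₁, -, hun₁, hfar₁⟩ := hcand ω b₁ hb₁
    -- the first candidate, the past range and the ball around the first candidate, all seen from
    -- the position of the walk at the time of the first success
    set z := x₁ + stepVec e₁ - walk ω (τ ω) with hz
    obtain ⟨S, hS, hSmem⟩ := exists_ball z ρ
    let Q : Finset (Fin d → ℤ) :=
      (Finset.range (τ ω + 1)).image (fun i => walk ω i - walk ω (τ ω)) ∪ S
    have hQ : Q.card ≤ B₁ * W + 1 + (2 * ρ) ^ d := by
      refine (Finset.card_union_le _ _).trans (add_le_add ?_ hS)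
      refine Finset.card_image_le.trans ?_
      rw [Finset.card_range]
      exact Nat.succ_le_succ (hτB ω)
    obtain ⟨τ', c', hτ', hτB', hc', hcand', hnone'⟩ :=
      exists_candidate (Q : Set (Fin d → ℤ)) W k ρ B₂
    have hboth := measure_bothHit_le hτ' hτB' hc' hη hhit hfar₁
      (fun ω' b hb => by
        obtain ⟨x, e, _, _, _, _, h⟩ := hcand' ω' b hb
        exact h)
      (fun ω' b hb => by
        obtain ⟨x, e, _, _, h, _, _⟩ := hcand' ω' b hb
        by_contra hF
        exact h (Finset.mem_coe.2 (Finset.mem_union_right _ (hSmem b hF))))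
    have hsub : {ω' | glue (τ ω) ω ω' ∈ (lasting d k N H)ᶜ ∩ {ω | c ω ≠ none}} ⊆
        noSuccess (Q : Set (Fin d → ℤ)) W k ρ B₂ ∪ bothHit τ' c' z H := by
      rintro ω' ⟨hbad', _⟩
      by_cases hn : c' ω' = none
      · exact Or.inl (hnone' hn)
      obtain ⟨b₂, hb₂⟩ := Option.ne_none_iff_exists'.1 hn
      obtain ⟨x₂, e₂, rfl, hv₂, hQ₂, hun₂, _⟩ := hcand' ω' b₂ hb₂
      have hτ1 := hτB ω
      have hτ2 := hτB' ω'
      -- an unhit candidate would make the event `lasting` occur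
      have hhit₁ : ∃ t < H, walk ω' t = z := by
        by_contra! hno
        refine hbad' ⟨x₁, e₁, ?_, fun t ht h0 => ?_⟩
        · refine hv₁.trans ?_
          rw [← visits_congr fun i hi => glue_apply_of_lt hi ω ω']
          exact visits_mono _ (by omega) _
        · rcases le_or_gt t (τ ω) with h3 | h3
          · rw [walk_glue_of_le h3] at h0
            exact hun₁ t h3 h0
          · have h4 := walk_glue_add (τ ω) (t - τ ω) ω ω'
            rw [show τ ω + (t - τ ω) = t by omega, h0] at h4
            exact hno (t - τ ω) (by omega) (eq_sub_of_add_eq' h4.symm)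
      have hhit₂ : ∃ u < H, τ' ω' ≤ u ∧ walk ω' u = x₂ + stepVec e₂ := by
        by_contra! hno
        refine hbad' ⟨walk ω (τ ω) + x₂, e₂, ?_, fun t ht h0 => ?_⟩
        · exact hv₂.trans ((visits_glue_le ω ω' (τ ω) (τ' ω') x₂).trans
            (visits_mono _ (by omega) _))
        · rw [add_assoc] at h0
          rcases le_or_gt t (τ ω) with h3 | h3
          · rw [walk_glue_of_le h3] at h0
            refine hQ₂ (Finset.mem_coe.2 (Finset.mem_union_left _ (Finset.mem_image.2
              ⟨t, Finset.mem_range.2 (by omega), ?_⟩)))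
            exact sub_eq_of_eq_add' h0
          · have h4 := walk_glue_add (τ ω) (t - τ ω) ω ω'
            rw [show τ ω + (t - τ ω) = t by omega, h0] at h4
            have h5 := add_left_cancel h4
            rcases le_or_gt (t - τ ω) (τ' ω') with h6 | h6
            · exact hun₂ _ h6 h5.symm
            · exact hno (t - τ ω) (by omega) h6.le h5.symm
      exact Or.inr ⟨_, hb₂, hhit₁, hhit₂⟩
    exact (measureReal_mono hsub).trans ((measureReal_union_le _ _).trans
      (add_le_add (h₂ Q hQ) hboth))
  have hsub : (lasting d k N H)ᶜ ⊆ noSuccess (∅ : Set (Fin d → ℤ)) W k ρ B₁ ∪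
      ((lasting d k N H)ᶜ ∩ {ω | c ω ≠ none}) := by
    intro ω hω
    by_cases h : c ω = none
    · exact Or.inl (hnone h)
    · exact Or.inr ⟨hω, h⟩
  have := (measureReal_mono (μ := noiseLaw d) hsub).trans (measureReal_union_le _ _)
  linarith

/-! ### The sequence of scales -/

lemma eventually_mul_sq_le_two_pow (c : ℝ) : ∀ᶠ l : ℕ in atTop, c * (l : ℝ) ^ 2 ≤ 2 ^ l := by
  have h := (tendsto_pow_const_div_const_pow_of_one_lt 2 (one_lt_two (α := ℝ))).const_mul c
  rw [mul_zero] at h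
  filter_upwards [h.eventually (gt_mem_nhds one_pos)] with l hl
  rw [← mul_div_assoc, div_lt_one (by positivity)] at hl
  exact hl.le

lemma log_two_pow_le (n : ℕ) : Real.log ((2 : ℝ) ^ n) ≤ n := by
  rw [Real.log_pow]
  have := Real.log_two_lt_d9
  nlinarith [(Nat.cast_nonneg n : (0 : ℝ) ≤ n)]

section Scales

variable [NeZero d]

/-- The walk is close to a given point with a small probability. -/
lemma exists_near_le (hd : 2 ≤ d) : ∃ C : ℝ, 0 < C ∧ ∀ (ρ t : ℕ) (y : Fin d → ℤ),
    (noiseLaw d).real {ω | ∀ i, |(y - walk ω t) i| < ((ρ : ℕ) : ℤ)} ≤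
      (2 * ρ) ^ d * (C / (t + 1)) := by
  obtain ⟨C, hC1, hC, -⟩ := exists_heat_le_inv hd
  refine ⟨C, by linarith, fun ρ t y => ?_⟩
  obtain ⟨S, hS, hmem⟩ := exists_ball y ρ
  have hsub : {ω : Noise d | ∀ i, |(y - walk ω t) i| < ((ρ : ℕ) : ℤ)} ⊆
      ⋃ x ∈ S, {ω | walk ω t = x} := by
    intro ω hω
    refine Set.mem_biUnion (hmem (walk ω t) fun h => ?_) rfl
    obtain ⟨i, hi⟩ := far_sub_comm h
    exact absurd (hω i) (not_lt.2 hi)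
  refine (measureReal_mono hsub (measure_ne_top _ _)).trans
    ((measureReal_biUnion_finset_le _ _).trans ?_)
  refine (Finset.sum_le_card_nsmul _ _ (C / (t + 1)) fun x _ => hC t x).trans ?_
  rw [nsmul_eq_mul]
  refine mul_le_mul_of_nonneg_right ?_ (by positivity)
  exact_mod_cast hS

/-- The probability of `r log n` successive returns before the first visit of a neighbour is of
larger order than the inverse of the block length, where `n` is the total length of the walk. -/
lemma exists_returns_pow_ge (hd : 2 ≤ d) {r : ℝ} (hr0 : 0 ≤ r)
    (hr : r * (-Real.log (returnProb d)) < 1) :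
    ∃ L : ℕ, ∀ᶠ l : ℕ in atTop, ∃ p : ℝ, (∀ e : Step d,
      (noiseLaw d).real (returns (Set.Iic L) e) ^
        ⌊r * Real.log (2 ^ (d * l ^ 2 + 11 * l))⌋₊ = p) ∧ 0 < p ∧
          2 ^ l ≤ p * (2 ^ (d * l ^ 2 + 4 * l) : ℕ) := by
  have hq0 := returnProb_pos (d := d)
  -- returns within a bounded time are almost as likely as returns
  obtain ⟨q', hq'0, hq', hθ⟩ : ∃ q', 0 < q' ∧ q' < returnProb d ∧ r * (-Real.log q') < 1 := by
    have hcont : Tendsto (fun x => r * (-Real.log x)) (𝓝[<] returnProb d)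
        (𝓝 (r * (-Real.log (returnProb d)))) :=
      (((Real.continuousAt_log hq0.ne').neg.const_mul r).tendsto).mono_left nhdsWithin_le_nhds
    obtain ⟨x, h3, h1, h2⟩ := ((hcont.eventually (gt_mem_nhds hr)).and
      (Ioo_mem_nhdsLT hq0)).exists
    exact ⟨x, h1, h2, h3⟩
  obtain ⟨L, hL⟩ := exists_returns_Iic_gt hq'
  set θ : ℝ := r * (-Real.log q') with hθdef
  refine ⟨L, ?_⟩
  filter_upwards [eventually_ge_atTop ⌈8 / (1 - θ)⌉₊, eventually_ge_atTop 1] with l hl4 hl0'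
  have hl0 : (1 : ℝ) ≤ l := by exact_mod_cast hl0'
  have hl8 : 8 ≤ (1 - θ) * l := by
    have := (Nat.le_ceil _).trans (Nat.cast_le.2 hl4)
    rwa [div_le_iff₀' (by linarith)] at this
  have hlogn : 0 ≤ Real.log ((2 : ℝ) ^ (d * l ^ 2 + 11 * l)) :=
    Real.log_nonneg (one_le_pow₀ one_le_two)
  have hkle := Nat.floor_le (mul_nonneg hr0 hlogn)
  generalize ⌊r * Real.log ((2 : ℝ) ^ (d * l ^ 2 + 11 * l))⌋₊ = k at hkle
  refine ⟨(noiseLaw d).real (returns (Set.Iic L) (0, true)) ^ k,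
    fun e => by rw [measure_returns_eq], pow_pos (hq'0.trans (hL _)) _, ?_⟩
  have h1 : Real.exp (-(θ * Real.log (2 ^ (d * l ^ 2 + 11 * l)))) ≤
      (noiseLaw d).real (returns (Set.Iic L) ((0, true) : Step d)) ^ k := by
    refine le_trans ?_ (pow_le_pow_left₀ hq'0.le (hL _).le k)
    rw [← Real.rpow_natCast q' k, Real.rpow_def_of_pos hq'0, Real.exp_le_exp, hθdef]
    have : Real.log q' < 0 := Real.log_neg hq'0 (hq'.trans returnProb_lt_one)
    have := mul_le_mul_of_nonneg_right hkle (neg_nonneg.2 this.le)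
    linarith
  have h2 : (2 : ℝ) ^ l ≤ Real.exp (-(θ * Real.log (2 ^ (d * l ^ 2 + 11 * l)))) *
      (2 ^ (d * l ^ 2 + 4 * l) : ℕ) := by
    have h3 : ((2 ^ (d * l ^ 2 + 4 * l) : ℕ) : ℝ) =
        Real.exp (Real.log 2 * (d * l ^ 2 + 4 * l : ℕ)) := by
      rw [← Real.rpow_def_of_pos two_pos, Real.rpow_natCast]
      push_cast
      rfl
    have h4 : (2 : ℝ) ^ l = Real.exp (Real.log 2 * l) := by
      rw [← Real.rpow_def_of_pos two_pos, Real.rpow_natCast]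
    rw [h3, h4, ← Real.exp_add, Real.exp_le_exp, Real.log_pow]
    push_cast
    have h5 : (l : ℝ) ≤ (1 - θ) * (d * l ^ 2) + (4 - 11 * θ) * l := by
      have hd2 : (2 : ℝ) ≤ d := by exact_mod_cast hd
      have h6 : 8 * (l : ℝ) ≤ (1 - θ) * l * l := mul_le_mul_of_nonneg_right hl8 (by linarith)
      have h7 : (1 - θ) * l * l * 2 ≤ (1 - θ) * l * l * d :=
        mul_le_mul_of_nonneg_left hd2 (by nlinarith)
      have h8 : θ * l ≤ l := by nlinarith
      linarith
    calc Real.log 2 * l ≤ Real.log 2 * ((1 - θ) * (d * l ^ 2) + (4 - 11 * θ) * l) :=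
          mul_le_mul_of_nonneg_left h5 (Real.log_pos one_lt_two).le
      _ = _ := by ring
  exact h2.trans (mul_le_mul_of_nonneg_right h1 (Nat.cast_nonneg _))

set_option maxHeartbeats 800000 in
/-- The search for a success, through `2 ^ (β l)` blocks of length `2 ^ (d l² + 4 l)`, fails with a
probability that is summable over the scales, even if a set of forbidden points is prescribed, of
smaller order than the expected range. -/
lemma exists_noSuccess_scale_le (hd : 2 ≤ d) {r : ℝ} (hr0 : 0 < r)
    (hr : r * (-Real.log (returnProb d)) < 1) :
    ∃ A : ℝ, 0 ≤ A ∧ ∀ᶠ l : ℕ in atTop, ∀ β : ℕ, 4 ≤ β → β ≤ 6 → ∀ Q : Finset (Fin d → ℤ),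
      Q.card + 1 ≤ 4 * 2 ^ (d * l ^ 2 + (β + 2) * l) →
        (noiseLaw d).real (noSuccess (Q : Set (Fin d → ℤ)) (2 ^ (d * l ^ 2 + 4 * l))
          ⌊r * Real.log (2 ^ (d * l ^ 2 + 11 * l))⌋₊ ((2 ^ l ^ 2 : ℕ) : ℤ) (2 ^ (β * l))) ≤
            A * ((l : ℝ) ^ 2 * (1 / 2) ^ l) := by
  obtain ⟨L, hL⟩ := exists_returns_pow_ge hd hr0.le hr
  obtain ⟨c, hc0, hc⟩ := exists_avoid_ge hd
  obtain ⟨C₁, hC₁, hnear⟩ := exists_near_le hd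
  obtain ⟨C₂, hC₂, -, hgreen⟩ := exists_heat_le_inv hd
  have hd0 : (0 : ℝ) ≤ d := Nat.cast_nonneg d
  refine ⟨2 * (1 + 12 * d ^ 2) * ((d + 5) / c) + 2 * C₂ * (d + 12), by positivity, ?_⟩
  filter_upwards [eventually_mul_sq_le_two_pow (r * L * (d + 11)),
    eventually_mul_sq_le_two_pow (2 ^ (d + 2) * C₁ * ((d + 5) / c)),
    eventually_ge_atTop (4 + d), hL] with l hl1 hl2 hl3 hl5
  intro β hβ4 hβ6 Q hQ
  have hl0 : (1 : ℝ) ≤ l := by exact_mod_cast (by omega : 1 ≤ l)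
  set n : ℕ := d * l ^ 2 + 11 * l with hn
  set W : ℕ := 2 ^ (d * l ^ 2 + 4 * l) with hW
  set s : ℕ := 2 ^ (d * l ^ 2 + 2 * l) with hs
  set k : ℕ := ⌊r * Real.log (2 ^ n)⌋₊ with hk
  set B : ℕ := 2 ^ (β * l) with hB
  set σ : ℝ := c / (1 + Real.log W) with hσ
  have hlogn : 0 ≤ Real.log ((2 : ℝ) ^ n) := Real.log_nonneg (one_le_pow₀ one_le_two)
  have hkle : (k : ℝ) ≤ r * Real.log (2 ^ n) := Nat.floor_le (by positivity)
  have hn2 : (n : ℝ) ≤ (d + 11) * l ^ 2 := by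
    rw [hn]; push_cast; nlinarith
  have hkL : (k * L : ℝ) ≤ 2 ^ l := by
    refine le_trans ?_ hl1
    have h1 : (k : ℝ) ≤ r * ((d + 11) * l ^ 2) :=
      hkle.trans (mul_le_mul_of_nonneg_left ((log_two_pow_le n).trans hn2) hr0.le)
    calc (k * L : ℝ) ≤ r * ((d + 11) * l ^ 2) * L := by gcongr
      _ = _ := by ring
  have hkL' : k * L ≤ 2 ^ l := by exact_mod_cast hkL
  have h2s : 2 * 2 ^ l ≤ s := by
    rw [hs, ← pow_succ']
    exact Nat.pow_le_pow_right two_pos (by nlinarith)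
  have hW1 : 1 ≤ W := Nat.one_le_two_pow
  have hlogW : 1 + Real.log W ≤ (d + 5) * l ^ 2 := by
    have : Real.log W ≤ (d * l ^ 2 + 4 * l : ℕ) := by
      rw [hW]; push_cast; exact_mod_cast log_two_pow_le _
    push_cast at this
    nlinarith
  have hlogW0 : 0 ≤ Real.log W := Real.log_nonneg (by exact_mod_cast hW1)
  have hσ0 : 0 < σ := by positivity
  have hσinv : 1 / σ ≤ (d + 5) / c * l ^ 2 := by
    rw [hσ, one_div_div, div_mul_eq_mul_div]
    gcongr
  obtain ⟨p, hp, hp0, hpW⟩ := hl5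
  -- the parameter `4⁻ˡ` balances the two terms of the bound on the probability of failure, for the
  -- least number `2 ^ (4 l)` of blocks
  have hblock : ∀ Q : Set (Fin d → ℤ), (1 / 4) ^ l * σ *
      ∑ j ∈ Finset.range (W - s), (noiseLaw d).real (newStep Q j) ≤
        W * ((noiseLaw d).real (success Q W k ((2 ^ l ^ 2 : ℕ) : ℤ)) +
          12 * d ^ 2 * ((1 / 4) ^ l) ^ 2) := by
    intro Q
    refine block_success hσ0.le hp hp0 (fun e => hc W hW1 e) (fun t ht y => ?_) ?_ ?_ hW1
      (hkL.trans hpW) (by positivity)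
    · refine (hnear _ t y).trans ?_
      have h1 : s ≤ 2 * (t + 1) := by omega
      have h2 : (s : ℝ) / 2 ≤ t + 1 := by
        have : (s : ℝ) ≤ 2 * (t + 1) := by exact_mod_cast h1
        linarith
      have h3 : (2 * ((2 ^ l ^ 2 : ℕ) : ℝ)) ^ d = 2 ^ d * 2 ^ (d * l ^ 2) := by
        push_cast; rw [mul_pow, ← pow_mul, mul_comm (l ^ 2)]
      have h4 : (s : ℝ) = 2 ^ (d * l ^ 2) * (2 ^ l * 2 ^ l) := by
        rw [hs]; push_cast; rw [pow_add, two_mul, pow_add]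
      calc (2 * ((2 ^ l ^ 2 : ℕ) : ℝ)) ^ d * (C₁ / (t + 1))
          ≤ 2 ^ d * 2 ^ (d * l ^ 2) * (C₁ / (s / 2)) := by
            rw [h3]
            gcongr
        _ = 2 ^ d * C₁ * 2 / (2 ^ l * 2 ^ l) := by
            rw [h4]; field_simp
        _ ≤ σ / 2 := by
            rw [div_le_div_iff₀ (by positivity) two_pos]
            have h5 : 1 ≤ σ * ((d + 5) / c * l ^ 2) := by
              rwa [div_le_iff₀' hσ0] at hσinv
            have h6 : (1 : ℝ) ≤ 2 ^ l := one_le_pow₀ one_le_two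
            calc 2 ^ d * C₁ * 2 * 2 = 2 ^ (d + 2) * C₁ * 1 := by ring
              _ ≤ 2 ^ (d + 2) * C₁ * (σ * ((d + 5) / c * l ^ 2)) := by gcongr
              _ = σ * (2 ^ (d + 2) * C₁ * ((d + 5) / c) * l ^ 2) := by ring
              _ ≤ σ * (2 ^ l * 1) := by rw [mul_one]; gcongr
              _ ≤ σ * (2 ^ l * 2 ^ l) := by gcongr
    · omega
    · rw [hs, hW]
      exact Nat.pow_le_pow_right two_pos (by omega)
  -- the range of the walk is large
  set N : ℕ := B * W with hN
  have hNeq : N = 2 ^ (d * l ^ 2 + (4 + β) * l) := by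
    rw [hN, hB, hW, ← pow_add]; congr 1; ring
  set R : ℝ := N / 2 ^ l with hR
  have hRc : 2 * (1 + (Q.card : ℝ) + B * s) ≤ R := by
    have h1 : B * s = 2 ^ (d * l ^ 2 + (β + 2) * l) := by
      rw [hB, hs, ← pow_add]; congr 1; ring
    have h2 : N = 2 ^ (d * l ^ 2 + (β + 2) * l) * (2 ^ l * 2 ^ l) := by
      rw [hNeq, ← pow_add, ← pow_add]; congr 1; ring
    rw [← h1] at hQ h2
    have h3 : (16 : ℝ) ≤ 2 ^ l := by
      calc (16 : ℝ) = 2 ^ 4 := by norm_num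
        _ ≤ 2 ^ l := pow_le_pow_right₀ one_le_two (by omega)
    have h4 : (Q.card : ℝ) + 1 ≤ 4 * (B * s : ℕ) := by exact_mod_cast hQ
    have h5 : R = (B * s : ℕ) * 2 ^ l := by
      rw [hR, h2]; push_cast; field_simp
    have h6 : ((B * s : ℕ) : ℝ) * 16 ≤ (B * s : ℕ) * 2 ^ l :=
      mul_le_mul_of_nonneg_left h3 (Nat.cast_nonneg _)
    rw [h5]
    have h7 : (0 : ℝ) ≤ (B * s : ℕ) := Nat.cast_nonneg _
    push_cast at h4 h6 h7 ⊢
    linarith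
  have hmain := measure_noSuccess_le (by positivity) (by positivity) hblock Q hRc
  rw [← hN] at hmain
  set F := noSuccess (Q : Set (Fin d → ℤ)) W k ((2 ^ l ^ 2 : ℕ) : ℤ) B
  set G : Set (Noise d) := {ω | R ≤ (pathRange (walk ω) N).card}
  have hsub : F ⊆ (F ∩ G) ∪ {ω : Noise d |
      ((pathRange (walk ω) N).card : ℝ) * ((N + 1) * 2 ^ l) < ((N : ℝ) + 1) ^ 2} := by
    intro ω hω
    by_cases h : ω ∈ G
    · exact Or.inl ⟨hω, h⟩
    · refine Or.inr ?_
      have h1 : ((pathRange (walk ω) N).card : ℝ) < N / 2 ^ l := not_le.1 h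
      rw [lt_div_iff₀ (by positivity)] at h1
      have h2 : (0 : ℝ) < N + 1 := by positivity
      rw [Set.mem_ofPred_eq]
      nlinarith
  have hN0 : (0 : ℝ) < N := by rw [hNeq]; positivity
  have hsmall := measure_range_small_le (d := d) N
    (show (0 : ℝ) < ((N : ℝ) + 1) * 2 ^ l by positivity)
  have hlogN : 1 + Real.log ((N + 1 : ℕ) : ℝ) ≤ (d + 12) * l ^ 2 := by
    have h1 : Real.log ((N + 1 : ℕ) : ℝ) ≤ (d * l ^ 2 + (4 + β) * l + 1 : ℕ) := by
      refine le_trans (Real.log_le_log (by positivity) ?_) (log_two_pow_le _)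
      have : N + 1 ≤ 2 ^ (d * l ^ 2 + (4 + β) * l + 1) := by
        rw [pow_succ, ← hNeq]
        have : 1 ≤ N := by rw [hNeq]; exact Nat.one_le_two_pow
        omega
      exact_mod_cast this
    have h2 : (β : ℝ) ≤ 6 := by exact_mod_cast hβ6
    push_cast at h1 ⊢
    have h3 : (β : ℝ) * l ≤ 6 * l := mul_le_mul_of_nonneg_right h2 (by linarith)
    have h4 : (l : ℝ) ≤ l ^ 2 := by rw [sq]; exact le_mul_of_one_le_left (by linarith) hl0
    linarith
  have hs2 : 2 * ((N : ℝ) + 1) * green d (N + 1) 0 / ((N + 1) * 2 ^ l) ≤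
      2 * C₂ * (d + 12) * (l ^ 2 * (1 / 2) ^ l) := by
    have h1 : green d (N + 1) 0 ≤ C₂ * ((d + 12) * l ^ 2) :=
      (hgreen _).trans (mul_le_mul_of_nonneg_left hlogN (by linarith))
    have h2 : 2 * ((N : ℝ) + 1) * green d (N + 1) 0 / ((N + 1) * 2 ^ l) =
        2 * green d (N + 1) 0 * (1 / 2) ^ l := by
      rw [one_div, inv_pow]; field_simp
    rw [h2]
    calc 2 * green d (N + 1) 0 * (1 / 2) ^ l ≤ 2 * (C₂ * ((d + 12) * l ^ 2)) * (1 / 2) ^ l := by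
          gcongr
      _ = _ := by ring
  have hm2 : (noiseLaw d).real (F ∩ G) ≤
      2 * (1 + 12 * d ^ 2) * ((d + 5) / c) * (l ^ 2 * (1 / 2) ^ l) := by
    have h1 : (1 : ℝ) ≤ B * ((1 / 4) ^ l) ^ 2 := by
      have : ((1 / 4 : ℝ) ^ l) ^ 2 = 1 / 2 ^ (4 * l) := by
        rw [one_div, one_div, inv_pow, inv_pow, pow_mul, ← pow_mul, mul_comm l 2, pow_mul]
        norm_num
      rw [this, hB, mul_one_div, le_div_iff₀ (by positivity), one_mul]
      push_cast
      exact pow_le_pow_right₀ one_le_two (Nat.mul_le_mul_right l hβ4)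
    have h2 : (W : ℝ) * (1 + B * (12 * d ^ 2 * ((1 / 4) ^ l) ^ 2)) ≤
        (1 + 12 * d ^ 2) * (N * ((1 / 4) ^ l) ^ 2) := by
      rw [hN]; push_cast
      have : (W : ℝ) * (1 + B * (12 * d ^ 2 * ((1 / 4) ^ l) ^ 2)) ≤
          W * (B * ((1 / 4) ^ l) ^ 2 + B * (12 * d ^ 2 * ((1 / 4) ^ l) ^ 2)) := by gcongr
      exact this.trans_eq (by ring)
    have h3 := hmain.trans h2
    have h4 : (1 / 4 : ℝ) ^ l * σ * (R / 2) * (noiseLaw d).real (F ∩ G) =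
        (σ * ((noiseLaw d).real (F ∩ G) / (2 * 2 ^ l))) * (N * (1 / 4) ^ l) := by
      rw [hR]; field_simp
    have h5 : (1 + 12 * (d : ℝ) ^ 2) * (N * ((1 / 4) ^ l) ^ 2) =
        ((1 + 12 * d ^ 2) * (1 / 4) ^ l) * (N * (1 / 4) ^ l) := by ring
    rw [h4, h5] at h3
    have h6 := le_of_mul_le_mul_right h3 (by positivity)
    have h7 : (1 / 4 : ℝ) ^ l = (1 / 2) ^ l / 2 ^ l := by
      rw [one_div, one_div, inv_pow, inv_pow, show (4 : ℝ) = 2 * 2 by norm_num, mul_pow]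
      field_simp
    rw [h7] at h6
    have h8 : (noiseLaw d).real (F ∩ G) ≤ 2 * (1 + 12 * d ^ 2) * (1 / σ) * (1 / 2) ^ l := by
      have h9 : σ * (noiseLaw d).real (F ∩ G) ≤ 2 * ((1 + 12 * d ^ 2) * (1 / 2) ^ l) := by
        have e1 : σ * ((noiseLaw d).real (F ∩ G) / (2 * 2 ^ l)) =
            (σ * (noiseLaw d).real (F ∩ G)) / (2 * 2 ^ l) := by ring
        rw [e1, ← mul_div_assoc, div_le_div_iff₀ (by positivity) (by positivity)] at h6
        have h2l : (0 : ℝ) < 2 ^ l := by positivity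
        nlinarith
      rw [← le_div_iff₀' hσ0] at h9
      exact h9.trans_eq (by ring)
    refine h8.trans ?_
    calc 2 * (1 + 12 * (d : ℝ) ^ 2) * (1 / σ) * (1 / 2) ^ l
        ≤ 2 * (1 + 12 * (d : ℝ) ^ 2) * ((d + 5) / c * l ^ 2) * (1 / 2) ^ l := by gcongr
      _ = _ := by ring
  calc (noiseLaw d).real F ≤ _ := measureReal_mono hsub
    _ ≤ _ := measureReal_union_le _ _
    _ ≤ _ := add_le_add hm2 (hsmall.trans hs2)
    _ = _ := by ring

end Scales

/-! ### The lower bound -/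

/-- A point visited `k` times and with a neighbour unvisited before `H` counts until `H`. -/
lemma le_maxBoundaryVisits {ω : Noise d} {k N H n : ℕ} (h : ω ∈ lasting d k N H) (hk : 1 ≤ k)
    (hN : N ≤ n) (hH : n < H) : k ≤ maxBoundaryVisits (walk ω) n := by
  classical
  obtain ⟨x, e, h1, h2⟩ := h
  have h3 : k ≤ visits (walk ω) n x := h1.trans (visits_mono _ hN _)
  refine h3.trans (Finset.le_sup (f := visits (walk ω) n) (mem_innerBoundary.2 ⟨?_, ?_⟩))
  · obtain ⟨j, hj⟩ := Finset.card_pos.1 (hk.trans h3)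
    rw [Finset.mem_filter] at hj
    exact Finset.mem_image.2 ⟨j, hj⟩
  · refine fun hsub => ?_
    have h4 := hsub ((mem_neighbors_iff x _).2 ⟨e, rfl⟩)
    rw [Finset.mem_coe, pathRange, Finset.mem_image] at h4
    obtain ⟨t, ht, hte⟩ := h4
    exact h2 t (by rw [Finset.mem_range] at ht; omega) hte

section LowerBound

variable [NeZero d]

/-- At every large scale, some point visited `r log n` times has a neighbour that is not visited
until twice the next scale. -/
lemma ae_eventually_mem_lasting (hd : 2 ≤ d) {r : ℝ} (hr0 : 0 < r)
    (hr : r * (-Real.log (returnProb d)) < 1) :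
    ∀ᵐ ω ∂(noiseLaw d), ∀ᶠ l : ℕ in atTop,
      ω ∈ lasting d ⌊r * Real.log (2 ^ (d * l ^ 2 + 11 * l))⌋₊ (2 ^ (d * l ^ 2 + 11 * l))
        (2 ^ (d * (l + 1) ^ 2 + 11 * (l + 1) + 1)) := by
  obtain ⟨A, hA, hS⟩ := exists_noSuccess_scale_le hd hr0 hr
  obtain ⟨K, hK, hhit⟩ := exists_hits_le hd 11
  obtain ⟨l₀, hl₀⟩ := eventually_atTop.1 (hS.and (eventually_ge_atTop (d + 1)))
  have hbound : ∀ l ≥ l₀, (noiseLaw d).real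
      (lasting d ⌊r * Real.log (2 ^ (d * l ^ 2 + 11 * l))⌋₊ (2 ^ (d * l ^ 2 + 11 * l))
        (2 ^ (d * (l + 1) ^ 2 + 11 * (l + 1) + 1)))ᶜ ≤
      2 * A * ((l : ℝ) ^ 2 * (1 / 2) ^ l) + 2 * K ^ 2 * (1 / (l : ℝ) ^ 2) := by
    intro l hl
    obtain ⟨h1, h2⟩ := hl₀ l hl
    refine (measure_lasting_compl_le (W := 2 ^ (d * l ^ 2 + 4 * l)) (B₁ := 2 ^ (4 * l))
      (B₂ := 2 ^ (6 * l)) (ρ := 2 ^ l ^ 2) (δ₁ := A * ((l : ℝ) ^ 2 * (1 / 2) ^ l))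
      (δ₂ := A * ((l : ℝ) ^ 2 * (1 / 2) ^ l)) (η := K / l) (by positivity) (by positivity)
      ?_ ?_ ?_ ?_).trans_eq ?_
    · rintro z ⟨i, hi⟩
      exact hhit l (by omega) z ⟨i, by push_cast at hi; exact hi⟩
    · have := h1 4 le_rfl (by norm_num) ∅ ?_
      · simpa using this
      · rw [Finset.card_empty, zero_add]
        exact Nat.one_le_iff_ne_zero.2 (by positivity)
    · refine fun Q hQ => h1 6 (by norm_num) le_rfl Q ?_
      have e1 : 2 ^ (4 * l) * 2 ^ (d * l ^ 2 + 4 * l) = 2 ^ (d * l ^ 2 + (6 + 2) * l) := by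
        rw [← pow_add]; congr 1; ring
      have e2 : (2 * 2 ^ l ^ 2) ^ d ≤ 2 ^ (d * l ^ 2 + (6 + 2) * l) := by
        rw [← pow_succ', ← pow_mul]
        exact Nat.pow_le_pow_right two_pos (by nlinarith)
      have e3 : 1 ≤ 2 ^ (d * l ^ 2 + (6 + 2) * l) := Nat.one_le_two_pow
      omega
    · have e1 : 2 ^ (4 * l) * 2 ^ (d * l ^ 2 + 4 * l) ≤ 2 ^ (d * l ^ 2 + 10 * l) := by
        rw [← pow_add]; exact Nat.pow_le_pow_right two_pos (by omega)
      have e2 : 2 ^ (6 * l) * 2 ^ (d * l ^ 2 + 4 * l) = 2 ^ (d * l ^ 2 + 10 * l) := by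
        rw [← pow_add]; congr 1; ring
      have e3 : 2 ^ (d * l ^ 2 + 10 * l + 1) ≤ 2 ^ (d * l ^ 2 + 11 * l) :=
        Nat.pow_le_pow_right two_pos (by omega)
      rw [pow_succ] at e3
      omega
    · rw [div_pow]; ring
  have hsum : Summable fun l : ℕ =>
      2 * A * ((l : ℝ) ^ 2 * (1 / 2) ^ l) + 2 * K ^ 2 * (1 / (l : ℝ) ^ 2) :=
    ((summable_pow_mul_geometric_of_norm_lt_one 2 (r := (1 / 2 : ℝ)) (by norm_num)).mul_left
      _).add ((Real.summable_one_div_nat_pow.2 one_lt_two).mul_left _)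
  have hfin : ∑' l, noiseLaw d
      (lasting d ⌊r * Real.log (2 ^ (d * (l + l₀) ^ 2 + 11 * (l + l₀)))⌋₊
        (2 ^ (d * (l + l₀) ^ 2 + 11 * (l + l₀)))
        (2 ^ (d * (l + l₀ + 1) ^ 2 + 11 * (l + l₀ + 1) + 1)))ᶜ ≠ ∞ := by
    have hs := (summable_nat_add_iff l₀).2 hsum
    refine ne_top_of_le_ne_top (?_ : ∑' l, ENNReal.ofReal _ ≠ ∞) (ENNReal.tsum_le_tsum fun l =>
      (ENNReal.le_ofReal_iff_toReal_le (measure_ne_top _ _) ?_).2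
        (hbound (l + l₀) (Nat.le_add_left _ _)))
    · rw [← ENNReal.ofReal_tsum_of_nonneg (fun l => by positivity) hs]
      exact ENNReal.ofReal_ne_top
    · positivity
  filter_upwards [ae_eventually_notMem hfin] with ω hω
  obtain ⟨l₁, hl₁⟩ := eventually_atTop.1 hω
  refine eventually_atTop.2 ⟨l₁ + l₀, fun l hl => ?_⟩
  have := hl₁ (l - l₀) (by omega)
  rw [show l - l₀ + l₀ = l by omega] at this
  exact not_not.1 this

lemma ae_le_maxBoundaryVisits (hd : 2 ≤ d) {r : ℝ} (hr : r < 1 / (-Real.log (returnProb d))) :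
    ∀ᵐ ω ∂(noiseLaw d), ∀ᶠ n : ℕ in atTop,
      r * Real.log n ≤ (maxBoundaryVisits (walk ω) n : ℝ) := by
  have hq := neg_log_returnProb_pos (d := d)
  obtain ⟨r', hr1, hr2⟩ := exists_between (max_lt hr (show (0 : ℝ) < _ by positivity))
  obtain ⟨hrr', hr'0⟩ := max_lt_iff.1 hr1
  rw [lt_div_iff₀ hq] at hr2
  filter_upwards [ae_eventually_mem_lasting hd hr'0 hr2] with ω hω
  -- consecutive scales have logarithms that are equivalent at infinity
  let g : ℕ → ℕ := fun l => d * l ^ 2 + 11 * l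
  have hg : ∀ᶠ l : ℕ in atTop, r * Real.log (2 ^ g (l + 1)) ≤ r' * Real.log (2 ^ g l) - 1 ∧
      2 ≤ r' * Real.log (2 ^ g l) := by
    have hε : 0 < r' - r := sub_pos.2 hrr'
    filter_upwards [eventually_ge_atTop 1, eventually_ge_atTop ⌈4 / r'⌉₊,
      eventually_ge_atTop ⌈(|r| * (3 * d + 11) + 2) / (r' - r)⌉₊] with l h1 h2 h3
    have hl1 : (1 : ℝ) ≤ l := by exact_mod_cast h1
    have hl2 := (Nat.le_ceil _).trans (Nat.cast_le.2 h2)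
    have hl3 := (Nat.le_ceil _).trans (Nat.cast_le.2 h3)
    rw [div_le_iff₀' hr'0] at hl2
    rw [div_le_iff₀' hε] at hl3
    have hlog : 1 / 2 ≤ Real.log 2 := by linarith [Real.log_two_gt_d9]
    have hd1 : (1 : ℝ) ≤ d := by exact_mod_cast (by omega : 1 ≤ d)
    have hgl : (l : ℝ) * l ≤ g l := by simp only [g]; push_cast; nlinarith
    have hgs : (g (l + 1) : ℝ) - g l ≤ (3 * d + 11) * l := by
      simp only [g]; push_cast; nlinarith
    have hgs0 : (0 : ℝ) ≤ g (l + 1) - g l := by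
      simp only [g]; push_cast; nlinarith
    rw [Real.log_pow, Real.log_pow]
    constructor
    · have e1 : (|r| * (3 * d + 11) + 2) * l ≤ (r' - r) * l * l :=
        mul_le_mul_of_nonneg_right hl3 (by linarith)
      have e2 : (r' - r) * (l * l) ≤ (r' - r) * g l := mul_le_mul_of_nonneg_left hgl hε.le
      have e3 : r * (g (l + 1) - g l) ≤ |r| * ((3 * d + 11) * l) :=
        mul_le_mul (le_abs_self r) hgs hgs0 (abs_nonneg r)
      have e4 : 2 ≤ r' * g l - r * g (l + 1) := by linarith
      nlinarith
    · have e1 : 4 ≤ r' * g l := by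
        have e2 : (l : ℝ) ≤ l * l := le_mul_of_one_le_left (by linarith) hl1
        have := mul_le_mul_of_nonneg_left (e2.trans hgl) hr'0.le
        linarith
      nlinarith
  obtain ⟨l₀, hl₀⟩ := eventually_atTop.1 (hω.and hg)
  have hgm : StrictMono g := strictMono_nat_of_lt_succ fun l => by simp only [g]; nlinarith
  refine eventually_atTop.2 ⟨2 ^ g l₀, fun n hn => ?_⟩
  obtain ⟨l, hl, hl1, hl2⟩ : ∃ l ≥ l₀, 2 ^ g l ≤ n ∧ n < 2 ^ g (l + 1) := by
    have hex : ∃ l, n < 2 ^ g l := ⟨n, n.lt_two_pow_self.trans_le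
      (Nat.pow_le_pow_right two_pos (hgm.id_le n))⟩
    classical
    have h1 := Nat.find_spec hex
    have h2 : l₀ < Nat.find hex := by
      by_contra hc
      exact absurd h1 (not_lt.2 ((Nat.pow_le_pow_right two_pos
        (hgm.monotone (not_lt.1 hc))).trans hn))
    refine ⟨Nat.find hex - 1, by omega, not_lt.1 (Nat.find_min hex (by omega)), ?_⟩
    rwa [show Nat.find hex - 1 + 1 = Nat.find hex by omega]
  obtain ⟨hmem, h1, h2⟩ := hl₀ l hl
  have hn0 : 1 ≤ n := Nat.one_le_two_pow.trans hl1
  have hle := le_maxBoundaryVisits hmem (Nat.le_floor (by push_cast; linarith)) hl1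
    (hl2.trans (Nat.pow_lt_pow_right one_lt_two (Nat.lt_succ_self _)))
  have hlog : 0 ≤ Real.log n := Real.log_nonneg (by exact_mod_cast hn0)
  have hlog2 : Real.log n ≤ Real.log (2 ^ g (l + 1)) :=
    Real.log_le_log (by exact_mod_cast hn0) (by exact_mod_cast hl2.le)
  have hfl := Nat.lt_floor_add_one (r' * Real.log (2 ^ g l))
  have hle' : ((⌊r' * Real.log (2 ^ g l)⌋₊ : ℕ) : ℝ) ≤ maxBoundaryVisits (walk ω) n := by
    exact_mod_cast hle
  rcases le_or_gt r 0 with h0 | h0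
  · exact (mul_nonpos_of_nonpos_of_nonneg h0 hlog).trans (Nat.cast_nonneg _)
  · have := mul_le_mul_of_nonneg_left hlog2 h0.le
    linarith

lemma ae_tendsto_maxBoundaryVisits (hd : 2 ≤ d) : ∀ᵐ ω ∂(noiseLaw d), Tendsto
    (fun n : ℕ => (maxBoundaryVisits (walk ω) n : ℝ) / Real.log n) atTop
      (𝓝 (1 / (-Real.log (returnProb d)))) := by
  set b := 1 / (-Real.log (returnProb d)) with hb
  have hlow : ∀ᵐ ω ∂(noiseLaw d), ∀ m : ℕ, ∀ᶠ n : ℕ in atTop,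
      (b - 1 / (m + 1)) * Real.log n ≤ (maxBoundaryVisits (walk ω) n : ℝ) :=
    ae_all_iff.2 fun m => ae_le_maxBoundaryVisits hd (by
      have : (0 : ℝ) < 1 / (m + 1) := Nat.one_div_pos_of_nat
      linarith)
  have hup : ∀ᵐ ω ∂(noiseLaw d), ∀ m : ℕ, ∃ C : ℝ, ∀ n : ℕ, 1 ≤ n →
      (maxBoundaryVisits (walk ω) n : ℝ) ≤ (b + 1 / (m + 1)) * Real.log n + C :=
    ae_all_iff.2 fun m => ae_maxBoundaryVisits_le (by
      have : (0 : ℝ) < 1 / (m + 1) := Nat.one_div_pos_of_nat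
      linarith)
  have hlog : Tendsto (fun n : ℕ => Real.log n) atTop atTop :=
    Real.tendsto_log_atTop.comp tendsto_natCast_atTop_atTop
  filter_upwards [hlow, hup] with ω h1 h2
  refine tendsto_order.2 ⟨fun x hx => ?_, fun x hx => ?_⟩
  · obtain ⟨m, hm⟩ := exists_nat_one_div_lt (sub_pos.2 hx)
    filter_upwards [h1 m, hlog.eventually_gt_atTop 0] with n hn hn0
    rw [lt_div_iff₀ hn0]
    exact lt_of_lt_of_le (mul_lt_mul_of_pos_right (by linarith) hn0) hn
  · obtain ⟨m, hm⟩ := exists_nat_one_div_lt (sub_pos.2 hx)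
    obtain ⟨C, hC⟩ := h2 m
    have hgap : 0 < x - b - 1 / (m + 1) := by linarith
    filter_upwards [eventually_ge_atTop 1, hlog.eventually_gt_atTop 0,
      hlog.eventually_gt_atTop (C / (x - b - 1 / (m + 1)))] with n hn hn0 hnC
    rw [div_lt_iff₀ hn0]
    rw [div_lt_iff₀ hgap] at hnC
    have := hC n hn
    linarith

end LowerBound

/-! ### Transfer to an arbitrary simple random walk -/

section Transfer

variable [NeZero d] {Ω : Type*} [MeasurableSpace Ω] {P : Measure Ω} [IsProbabilityMeasure P]
  {S : ℕ → Ω → (Fin d → ℤ)}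

/-- The sequence of the steps of a path, read off from its increments. An increment that is not a
unit vector is decoded arbitrarily. -/
def decode (s : ℕ → (Fin d → ℤ)) : Noise d := fun n =>
  Function.invFun (stepVec (d := d)) (s (n + 1) - s n)

omit [IsProbabilityMeasure P] in
lemma IsSimpleRandomWalk.measurable_decode (h : IsSimpleRandomWalk P 0 S) :
    Measurable fun ω => decode fun n => S n ω :=
  measurable_pi_lambda _ fun _ => (measurable_of_countable _).comp
    ((h.measurable _).sub (h.measurable _))

lemma IsSimpleRandomWalk.ae_exists_step (h : IsSimpleRandomWalk P 0 S) (n : ℕ) :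
    ∀ᵐ ω ∂P, ∃ e, stepVec e = S (n + 1) ω - S n ω := by
  have hm : Measurable fun ω => S (n + 1) ω - S n ω := (h.measurable _).sub (h.measurable _)
  have hset : {ω | ∃ e, stepVec e = S (n + 1) ω - S n ω} =
      ⋃ e : Step d, {ω | S (n + 1) ω - S n ω = stepVec e} := by
    ext ω; simp [eq_comm]
  have hmeas : ∀ e : Step d, MeasurableSet {ω | S (n + 1) ω - S n ω = stepVec e} := fun e =>
    hm (measurableSet_singleton _)
  have h1 : P {ω | ∃ e, stepVec e = S (n + 1) ω - S n ω} = 1 := by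
    rw [hset, measure_iUnion (fun e e' hne => ?_) hmeas, tsum_fintype]
    · rw [Finset.sum_congr rfl fun e _ => h.law n (stepVec e) (by
        rw [neighbors_zero]; exact Set.mem_range_self e)]
      rw [← Finset.sum_congr rfl fun e _ => measure_stepLaw_singleton (d := d) e,
        sum_measure_singleton, Finset.coe_univ, measure_univ]
    · refine Set.disjoint_left.2 fun ω h2 h3 => hne (stepVec_injective ?_)
      exact h2.symm.trans h3
  exact (prob_compl_eq_zero_iff (hset ▸ MeasurableSet.iUnion hmeas)).2 h1

lemma IsSimpleRandomWalk.ae_eq_walk (h : IsSimpleRandomWalk P 0 S) :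
    ∀ᵐ ω ∂P, (fun n => S n ω) = walk (decode fun n => S n ω) := by
  filter_upwards [ae_all_iff.2 h.ae_exists_step, h.start] with ω h1 h2
  funext n
  induction n with
  | zero => rw [h2, walk_zero]
  | succ n ih =>
    rw [walk_succ, ← ih, decode, Function.invFun_eq (h1 n), add_sub_cancel]

lemma IsSimpleRandomWalk.map_decode (h : IsSimpleRandomWalk P 0 S) :
    P.map (fun ω => decode fun n => S n ω) = noiseLaw d := by
  have hdec : Measurable (Function.invFun (stepVec (d := d))) := measurable_of_countable _
  have hind := h.indep.comp (fun _ => Function.invFun (stepVec (d := d))) fun _ => hdec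
  have hm : ∀ n, Measurable fun ω => S (n + 1) ω - S n ω := fun n =>
    (h.measurable _).sub (h.measurable _)
  have := hind.map_fun_eq_infinitePi_map fun n => hdec.comp (hm n)
  refine this.trans ?_
  rw [noiseLaw]
  congr 1
  funext n
  refine Measure.ext_of_singleton fun e => ?_
  rw [Measure.map_apply (hdec.comp (hm n)) (measurableSet_singleton e),
    measure_stepLaw_singleton, ← h.law n (stepVec e) (by
      rw [neighbors_zero]; exact Set.mem_range_self e)]
  refine measure_congr ?_
  filter_upwards [h.ae_exists_step n] with ω hω
  refine propext ⟨fun he => ?_, fun he => ?_⟩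
  · change S (n + 1) ω - S n ω = stepVec e
    rw [← Function.invFun_eq hω]
    exact congrArg stepVec he
  · change Function.invFun stepVec (S (n + 1) ω - S n ω) = e
    rw [show S (n + 1) ω - S n ω = stepVec e from he]
    exact Function.leftInverse_invFun stepVec_injective e

lemma IsSimpleRandomWalk.measure_hittingTime_lt (h : IsSimpleRandomWalk P 0 S)
    {b : Fin d → ℤ} (hb : b ∈ neighbors (0 : Fin d → ℤ)) :
    P.real {ω | hittingTime (fun n => S n ω) 0 < hittingTime (fun n => S n ω) b} =
      returnProb d := by
  obtain ⟨e, rfl⟩ : b ∈ Set.range stepVec := neighbors_zero (d := d) ▸ hb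
  rw [← measure_returns_univ e, ← h.map_decode,
    map_measureReal_apply h.measurable_decode (measurableSet_returns _ _)]
  refine measureReal_congr ?_
  filter_upwards [h.ae_eq_walk] with ω hω
  refine propext ?_
  change hittingTime (fun n => S n ω) 0 < hittingTime (fun n => S n ω) (stepVec e) ↔
    (decode fun n => S n ω) ∈ returns Set.univ e
  rw [← hittingTime_lt_iff, ← hω]

lemma IsSimpleRandomWalk.ae_tendsto (hd : 2 ≤ d) (h : IsSimpleRandomWalk P 0 S) :
    ∀ᵐ ω ∂P, Tendsto (fun n : ℕ => (maxBoundaryVisits (fun k => S k ω) n : ℝ) / Real.log n) atTop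
      (𝓝 (1 / (-Real.log (returnProb d)))) := by
  have h1 := ae_of_ae_map h.measurable_decode.aemeasurable
    (h.map_decode.symm ▸ ae_tendsto_maxBoundaryVisits hd)
  filter_upwards [h1, h.ae_eq_walk] with ω h2 h3
  rwa [h3]

end Transfer

end SimpleWalk

end

theorem theorem2p1 (d : ℕ) (hd : 2 ≤ d) :
    ∃ q : ℝ, 0 < q ∧ q < 1 ∧
      ∀ (Ω : Type*) [MeasurableSpace Ω] (P : Measure Ω) [IsProbabilityMeasure P]
        (S : ℕ → Ω → (Fin d → ℤ)), SimpleWalk.IsSimpleRandomWalk P 0 S →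
        (∀ b ∈ SimpleWalk.neighbors (0 : Fin d → ℤ),
          P.real {ω | SimpleWalk.hittingTime (fun n => S n ω) 0 <
            SimpleWalk.hittingTime (fun n => S n ω) b} = q) ∧
        ∀ᵐ ω ∂P, Tendsto
          (fun n : ℕ => (SimpleWalk.maxBoundaryVisits (fun k => S k ω) n : ℝ) / Real.log n)
          atTop (𝓝 (1 / (-Real.log q))) := by
  have : NeZero d := ⟨by omega⟩
  exact ⟨SimpleWalk.returnProb d, SimpleWalk.returnProb_pos, SimpleWalk.returnProb_lt_one,
    fun Ω _ P _ S h => ⟨fun b hb => h.measure_hittingTime_lt hb, h.ae_tendsto hd⟩⟩
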